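/- For a graph $G$ with a given (not necessarily proper) edge colouring, a path is called a rainbow path if all its edges have distinct colours. The rainbow connection number $\mathrm{rc}(G)$ is the minimum number of colours needed to colour the edges of $G$ so that every pair of vertices is joined by at least one rainbow path ($\mathrm{rc}(G)=\infty$ if there is no such colouring, that is, if the finite graph $G$ is disconnected). Let $\mathcal G(n,p)$ be the Erdős–Rényi random graph on $n$ vertices, in which each of the $\binom n2$ potential edges is present independently with probability $p$. Let $c\in\mathbb R$ be a constant, let $p=p(n)\in[0,1]$ with $p(n)=\sqrt{\frac{2\log n+c}{n}}$ for all sufficiently large $n$, and let $G\sim\mathcal G(n,p)$. Then $$\lim_{n\to\infty}\mathbb P(\mathrm{rc}(G)=2)=e^{-e^{-c}/2}\qquad\text{and}\qquad \lim_{n\to\infty}\mathbb P(\mathrm{rc}(G)=3)=1-e^{-e^{-c}/2}.$$ -/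

import Mathlib

namespace SimpleGraph

/-- A walk `w` is a rainbow path for the edge colouring `C` if it is a path and `C` takes distinct
values on its (distinct) edges. The colouring need not be proper. -/
def Walk.IsRainbowPath {V K : Type*} {G : SimpleGraph V} (C : G.EdgeLabeling K) {u v : V}
    (w : G.Walk u v) : Prop :=
  w.IsPath ∧ ∀ e f : G.edgeSet, (e : Sym2 V) ∈ w.edges → (f : Sym2 V) ∈ w.edges → C e = C f → e = f

/-- An edge colouring is a rainbow colouring if every pair of vertices is joined by at least one
rainbow path. -/
def EdgeLabeling.IsRainbow {V K : Type*} {G : SimpleGraph V} (C : G.EdgeLabeling K) : Prop :=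
  ∀ u v : V, ∃ w : G.Walk u v, w.IsRainbowPath C

/-- The rainbow connection number: the least `k` such that `G` has a rainbow colouring with
`k` available colours, and `⊤` if there is no such `k` (as for a disconnected graph). -/
noncomputable def rainbowConnectionNumber {V : Type*} (G : SimpleGraph V) : ℕ∞ :=
  sInf {m : ℕ∞ | ∃ k : ℕ, m = k ∧ ∃ C : G.EdgeLabeling (Fin k), C.IsRainbow}

end SimpleGraph

/-! Call a non-adjacent pair bad if it has no common neighbour. Two colours cannot suffice while a
bad pair exists. The proof shows that, with high probability, bad pairs are the only obstruction to
two colours and that three colours always suffice. The limit law is then that of the number of bad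
pairs, which is asymptotically Poisson with mean `e^{-c}/2`: there are about `n²/2` pairs, and each
is bad with probability about `exp(-np²) = e^{-c}/n²`. Since `G` is complete with vanishing
probability, at least two colours are needed.

Two colours for every pair that has a common neighbour (`exists_two_colouring`). A typical pair has
about `2 log n` common neighbours, and a random two-colouring fails on a pair with `q` of them with
probability `2^{-q}`. This is too large for a union bound when `q` is near `(3/4) log n`, but
conflicts are local: a pair shares edges with only about `q√n` others up to logarithmic factors, so
the Lovász local lemma applies because `(3/4) log 2 > 1/2`. Non-adjacent pairs with between 1 and
`(3/4) log n` common neighbours, the light pairs, are coloured by hand instead. Each gets a common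
neighbour whose two edges lie on no two-path of another light pair, and these edges receive
different colours. Heavier pairs use only edges free of such commitments.

Such safe common neighbours exist because a pair is light with probability about `n^{-0.514}`, again
beyond `n^{-1/2}`. First moment bounds then exclude finitely many configurations (`PatternFree`), so
that a pair has a bounded number of unsafe common neighbours, and none at all if it has boundedly
many common neighbours.

Three colours (`rainbowConnectionNumber_le_three_of_colouring`). Bad pairs are few and
vertex-disjoint. For each bad pair a private edge at one end gets the third colour; the edges form a
matching, so no two-coloured two-path is spoiled, and the private edge followed by a two-coloured
two-path joins the bad pair.

The Poisson limit comes from the binomial moments and Bonferroni's inequalities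
(`tendsto_binomialMoment`, `tendsto_of_bonferroni`). -/

/-! ### Expectations over a Bernoulli random subset; used with `p` for the graph and `1/2` for the
colouring. -/

open Finset in
/-- The expectation of `f` at a random subset of `E` that contains each element of `E` independently
with probability `p`. -/
noncomputable def bernExp {α : Type*} [DecidableEq α] (p : ℝ) (E : Finset α)
    (f : Finset α → ℝ) : ℝ :=
  ∑ S ∈ E.powerset, p ^ #S * (1 - p) ^ #(E \ S) * f S

section bernExp
open Finset

variable {α : Type*} [DecidableEq α] {p : ℝ} {E : Finset α} {f g : Finset α → ℝ}

theorem bernExp_congr (h : ∀ S ⊆ E, f S = g S) : bernExp p E f = bernExp p E g :=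
  Finset.sum_congr rfl fun S hS => by rw [h S (mem_powerset.1 hS)]

theorem bernExp_mono (h0 : 0 ≤ p) (h1 : p ≤ 1) (h : ∀ S ⊆ E, f S ≤ g S) :
    bernExp p E f ≤ bernExp p E g :=
  Finset.sum_le_sum fun S hS => mul_le_mul_of_nonneg_left (h S (mem_powerset.1 hS))
    (mul_nonneg (pow_nonneg h0 _) (pow_nonneg (by linarith) _))

theorem bernExp_add : bernExp p E (fun S => f S + g S) = bernExp p E f + bernExp p E g := by
  simp [bernExp, mul_add, Finset.sum_add_distrib]

theorem bernExp_const_mul (c : ℝ) : bernExp p E (fun S => c * f S) = c * bernExp p E f := by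
  simp only [bernExp, Finset.mul_sum]
  exact Finset.sum_congr rfl fun S _ => by ring

theorem bernExp_sub : bernExp p E (fun S => f S - g S) = bernExp p E f - bernExp p E g := by
  simp [bernExp, mul_sub, Finset.sum_sub_distrib]

theorem bernExp_sum {ι : Type*} (I : Finset ι) (F : ι → Finset α → ℝ) :
    bernExp p E (fun S => ∑ i ∈ I, F i S) = ∑ i ∈ I, bernExp p E (F i) := by
  simp only [bernExp, Finset.mul_sum]
  exact Finset.sum_comm

theorem bernExp_const (c : ℝ) : bernExp p E (fun _ => c) = c := by
  have := Finset.sum_pow_mul_eq_add_pow p (1 - p) E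
  simp only [bernExp, ← Finset.sum_mul]
  rw [Finset.sum_congr rfl (g := fun S => p ^ #S * (1 - p) ^ (#E - #S)), this]
  · simp
  · intro S hS
    rw [card_sdiff_of_subset (mem_powerset.1 hS)]

theorem bernExp_nonneg (h0 : 0 ≤ p) (h1 : p ≤ 1) (h : ∀ S ⊆ E, 0 ≤ f S) : 0 ≤ bernExp p E f := by
  have := bernExp_mono (f := fun _ => 0) h0 h1 h
  rwa [bernExp_const] at this

@[simp] theorem bernExp_empty : bernExp p ∅ f = f ∅ := by simp [bernExp]

theorem bernExp_insert {a : α} (ha : a ∉ E) : bernExp p (insert a E) f =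
    p * bernExp p E (fun S => f (insert a S)) + (1 - p) * bernExp p E f := by
  simp only [bernExp]
  rw [Finset.sum_powerset_insert ha, add_comm, Finset.mul_sum, Finset.mul_sum]
  congr 1
  · refine Finset.sum_congr rfl fun S hS => ?_
    have hS' := mem_powerset.1 hS
    rw [card_insert_of_notMem (fun h => ha (hS' h)), insert_sdiff_insert]
    rw [sdiff_insert_of_notMem ha]
    ring
  · refine Finset.sum_congr rfl fun S hS => ?_
    have hS' := mem_powerset.1 hS
    rw [insert_sdiff_of_notMem _ (fun h => ha (hS' h)), card_insert_of_notMem (by simp [ha])]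
    ring

theorem bernExp_union {E' : Finset α} (h : Disjoint E E') : bernExp p (E ∪ E') f =
    bernExp p E (fun S => bernExp p E' (fun T => f (S ∪ T))) := by
  induction E using Finset.induction_on generalizing f with
  | empty => simp
  | insert a E ha ih =>
    rw [disjoint_insert_left] at h
    rw [insert_union, bernExp_insert (by simp [ha, h.1]), bernExp_insert ha, ih h.2, ih h.2]
    simp [insert_union]

/-- `f` depends on its argument only through the intersection with `D`. -/
def DependsOnFinset (f : Finset α → ℝ) (D : Finset α) : Prop := ∀ S, f S = f (S ∩ D)

theorem DependsOnFinset.mono {D D' : Finset α} (h : DependsOnFinset f D) (hD : D ⊆ D') :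
    DependsOnFinset f D' := fun S => by
  rw [h S, h (S ∩ D'), inter_assoc, inter_eq_right.2 hD]

theorem DependsOnFinset.congr_on {D S T : Finset α} (h : DependsOnFinset f D)
    (hST : S ∩ D = T ∩ D) : f S = f T := by rw [h S, h T, hST]

theorem DependsOnFinset.prod {ι : Type*} (I : Finset ι) {F : ι → Finset α → ℝ} {D : Finset α}
    (h : ∀ i ∈ I, DependsOnFinset (F i) D) : DependsOnFinset (fun S => ∏ i ∈ I, F i S) D :=
  fun S => Finset.prod_congr rfl fun i hi => h i hi S

/-- Sampling `E ∩ D` and `E \ D` in turn makes the expectation iterated; `f` is constant in the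
inner variable and `g` in the outer one. -/
theorem bernExp_mul {D D' : Finset α} (hf : DependsOnFinset f D) (hg : DependsOnFinset g D')
    (h : Disjoint D D') :
    bernExp p E (fun S => f S * g S) = bernExp p E f * bernExp p E g := by
  have hE : E ∩ D ∪ E \ D = E := by rw [union_comm]; exact sdiff_union_inter E D
  have hd : Disjoint (E ∩ D) (E \ D) := (disjoint_sdiff_inter E D).symm
  have e1 : ∀ S ⊆ E ∩ D, ∀ T ⊆ E \ D, f (S ∪ T) = f S := by
    intro S _ T hT
    refine hf.congr_on ?_
    ext x
    have := @hT x
    simp only [mem_sdiff, mem_inter, mem_union] at *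
    tauto
  have e2 : ∀ S ⊆ E ∩ D, ∀ T ⊆ E \ D, g (S ∪ T) = g T := by
    intro S hS T _
    refine hg.congr_on ?_
    ext x
    have h1 := @hS x
    have h2 := fun a b => (disjoint_left.1 h) (a := x) a b
    simp only [mem_inter, mem_union] at *
    tauto
  have key : ∀ F : Finset α → ℝ, bernExp p E F =
      bernExp p (E ∩ D) (fun S => bernExp p (E \ D) (fun T => F (S ∪ T))) := fun F => by
    rw [← bernExp_union hd, hE]
  rw [key, key f, key g]
  rw [bernExp_congr (g := fun S => bernExp p (E \ D) g * f S)
    (fun S hS => by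
      rw [bernExp_congr (g := fun T => f S * g T) (fun T hT => by rw [e1 S hS T hT, e2 S hS T hT]),
        bernExp_const_mul, mul_comm]), bernExp_const_mul, mul_comm]
  congr 1
  · exact bernExp_congr fun S hS => by
      rw [bernExp_congr (g := fun _ => f S) (fun T hT => e1 S hS T hT), bernExp_const]
  · rw [bernExp_congr (f := fun S => bernExp p (E \ D) (fun T => g (S ∪ T)))
      (g := fun _ => bernExp p (E \ D) g)
      (fun S hS => bernExp_congr (fun T hT => e2 S hS T hT)), bernExp_const]

theorem bernExp_prod {ι : Type*} (I : Finset ι) {F : ι → Finset α → ℝ}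
    {D : ι → Finset α} (h : ∀ i ∈ I, DependsOnFinset (F i) (D i))
    (hD : (I : Set ι).PairwiseDisjoint D) :
    bernExp p E (fun S => ∏ i ∈ I, F i S) = ∏ i ∈ I, bernExp p E (F i) := by
  classical
  induction I using Finset.induction_on with
  | empty => simp [bernExp_const]
  | insert a I ha ih =>
    simp only [prod_insert ha]
    rw [bernExp_mul (D := D a) (D' := I.biUnion D) (h a (by simp)), ih]
    · exact fun i hi => h i (by simp [hi])
    · exact hD.subset (by simp)
    · exact DependsOnFinset.prod I fun i hi => (h i (by simp [hi])).mono (subset_biUnion_of_mem D hi)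
    · rw [disjoint_biUnion_right]
      intro i hi
      exact hD (by simp) (by simp [hi]) (by rintro rfl; exact ha hi)

theorem bernExp_subset {T : Finset α} (hT : T ⊆ E) :
    bernExp p E (fun S => if T ⊆ S then 1 else 0) = p ^ #T := by
  have h1 : ∀ a ∈ E, bernExp p E (fun S => if a ∈ S then 1 else 0) = p := by
    intro a ha
    obtain ⟨E', hE', rfl⟩ : ∃ E', a ∉ E' ∧ insert a E' = E := ⟨E.erase a, by simp, insert_erase ha⟩
    rw [bernExp_insert hE', bernExp_congr (f := fun S => if a ∈ S then 1 else 0) (g := fun _ => 0)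
      (fun S hS => if_neg fun h => hE' (hS h))]
    simp [bernExp_const]
  have h2 : (fun S : Finset α => if T ⊆ S then (1 : ℝ) else 0) =
      fun S => ∏ a ∈ T, if a ∈ S then (1 : ℝ) else 0 := by
    ext S
    rw [prod_ite_zero]
    simp [subset_iff]
  rw [h2, bernExp_prod (F := fun a S => if a ∈ S then (1 : ℝ) else 0) T (D := fun a => {a})]
  · rw [prod_congr rfl fun a ha => h1 a (hT ha), prod_const]
  · intro a _ S
    simp
  · intro a _ b _ hab
    simpa using hab

theorem bernExp_disjoint {T : Finset α} (hT : T ⊆ E) :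
    bernExp p E (fun S => if Disjoint T S then 1 else 0) = (1 - p) ^ #T := by
  have h1 : ∀ a ∈ E, bernExp p E (fun S => if a ∉ S then 1 else 0) = 1 - p := by
    intro a ha
    have := bernExp_subset (p := p) (singleton_subset_iff.2 ha)
    have h3 : (fun S : Finset α => if a ∉ S then (1 : ℝ) else 0) =
        fun S => 1 - if {a} ⊆ S then 1 else 0 := by
      ext S
      by_cases h : a ∈ S <;> simp [h]
    rw [h3, bernExp_sub, this, bernExp_const]
    simp
  have h2 : (fun S : Finset α => if Disjoint T S then (1 : ℝ) else 0) =
      fun S => ∏ a ∈ T, if a ∉ S then (1 : ℝ) else 0 := by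
    ext S
    rw [prod_ite_zero]
    simp [disjoint_left]
  rw [h2, bernExp_prod (F := fun a S => if a ∉ S then (1 : ℝ) else 0) T (D := fun a => {a})]
  · rw [prod_congr rfl fun a ha => h1 a (hT ha), prod_const]
  · intro a _ S
    simp
  · intro a _ b _ hab
    simpa using hab

end bernExp

/-! ### The Lovász local lemma -/

section LocalLemma
open Finset

variable {α ι : Type*} [DecidableEq α] {p : ℝ} {E : Finset α}

theorem one_sub_sum_le_prod {I : Finset ι} {a : ι → ℝ} (h0 : ∀ i ∈ I, 0 ≤ a i)
    (h1 : ∀ i ∈ I, a i ≤ 1) : 1 - ∑ i ∈ I, a i ≤ ∏ i ∈ I, (1 - a i) := by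
  classical
  induction I using Finset.induction_on with
  | empty => simp
  | insert j I hj ih =>
    rw [sum_insert hj, prod_insert hj]
    have ih' := ih (fun i hi => h0 i (by simp [hi])) (fun i hi => h1 i (by simp [hi]))
    have hs : 0 ≤ ∑ i ∈ I, a i := sum_nonneg fun i hi => h0 i (by simp [hi])
    have hj0 := h0 j (by simp)
    have hj1 := h1 j (by simp)
    nlinarith [mul_le_mul_of_nonneg_left ih' (sub_nonneg.2 hj1), mul_nonneg hj0 hs]

/-- This is the usual bound `2Q` on the probability of one event given that others fail, multiplied
out so that no conditional probability or positivity is needed. The induction is on the number of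
conditioning events; those with disjoint support factor out, the others are at most `d`. -/
theorem bernExp_mul_prod_one_sub_le [DecidableEq ι] (h0 : 0 ≤ p) (h1 : p ≤ 1) (I : Finset ι)
    {a : ι → Finset α → ℝ} {D : ι → Finset α} (hdep : ∀ i ∈ I, DependsOnFinset (a i) (D i))
    (ha0 : ∀ i S, 0 ≤ a i S) (ha1 : ∀ i S, a i S ≤ 1) {Q : ℝ} {d : ℕ} (hQ0 : 0 ≤ Q)
    (hQ : ∀ i ∈ I, bernExp p E (a i) ≤ Q)
    (hd : ∀ i ∈ I, #{j ∈ I | ¬ Disjoint (D i) (D j)} ≤ d) (hQd : 4 * Q * (d + 1) ≤ 1)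
    {i : ι} (hi : i ∈ I) {J : Finset ι} (hJ : J ⊆ I) :
    bernExp p E (fun S => a i S * ∏ j ∈ J, (1 - a j S)) ≤
      2 * Q * bernExp p E (fun S => ∏ j ∈ J, (1 - a j S)) := by
  induction hn : #J using Nat.strong_induction_on generalizing i J with
  | _ n ih =>
  subst hn
  set J1 := {j ∈ J | ¬ Disjoint (D i) (D j)} with hJ1
  set J2 := {j ∈ J | Disjoint (D i) (D j)} with hJ2
  have hsplit : ∀ S, ∏ j ∈ J, (1 - a j S) = (∏ j ∈ J2, (1 - a j S)) * ∏ j ∈ J1, (1 - a j S) :=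
    fun S => (prod_filter_mul_prod_filter_not J _ _).symm
  have hnn : ∀ (K : Finset ι) S, 0 ≤ ∏ j ∈ K, (1 - a j S) :=
    fun K S => prod_nonneg fun j _ => sub_nonneg.2 (ha1 j S)
  have hle1 : ∀ (K : Finset ι) S, ∏ j ∈ K, (1 - a j S) ≤ 1 :=
    fun K S => prod_le_one (fun j _ => sub_nonneg.2 (ha1 j S)) fun j _ => by linarith [ha0 j S]
  have hJ2I : J2 ⊆ I := (filter_subset _ _).trans hJ
  have hJ1I : J1 ⊆ I := (filter_subset _ _).trans hJ
  have hE2 : 0 ≤ bernExp p E (fun S => ∏ j ∈ J2, (1 - a j S)) :=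
    bernExp_nonneg h0 h1 fun S _ => hnn J2 S
  have step1 : bernExp p E (fun S => a i S * ∏ j ∈ J, (1 - a j S)) ≤
      Q * bernExp p E (fun S => ∏ j ∈ J2, (1 - a j S)) := by
    calc _ ≤ bernExp p E (fun S => a i S * ∏ j ∈ J2, (1 - a j S)) := by
          refine bernExp_mono h0 h1 fun S _ => mul_le_mul_of_nonneg_left ?_ (ha0 i S)
          rw [hsplit]
          exact mul_le_of_le_one_right (hnn J2 S) (hle1 J1 S)
      _ = bernExp p E (a i) * bernExp p E (fun S => ∏ j ∈ J2, (1 - a j S)) := by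
          refine bernExp_mul (D' := J2.biUnion D) (hdep i hi) ?_ ?_
          · refine DependsOnFinset.prod (F := fun j S => 1 - a j S) J2 fun j hj => ?_
            have := (hdep j (hJ2I hj)).mono (subset_biUnion_of_mem D hj)
            intro S
            simp only
            rw [this S]
          · rw [disjoint_biUnion_right]
            exact fun j hj => (mem_filter.1 hj).2
      _ ≤ _ := mul_le_mul_of_nonneg_right (hQ i hi) hE2
  -- Restoring the factors in `J1` loses at most half: by a union bound and the induction hypothesis
  -- the loss is at most a fraction `d * 2Q ≤ 1/2`. The induction applies since `J2` is strictly
  -- smaller than `J` as soon as `J1` has an element.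
  have step2 : bernExp p E (fun S => ∏ j ∈ J2, (1 - a j S)) ≤
      2 * bernExp p E (fun S => ∏ j ∈ J, (1 - a j S)) := by
    have hlow : bernExp p E (fun S => ∏ j ∈ J2, (1 - a j S)) -
        ∑ k ∈ J1, bernExp p E (fun S => a k S * ∏ j ∈ J2, (1 - a j S)) ≤
        bernExp p E (fun S => ∏ j ∈ J, (1 - a j S)) := by
      rw [← bernExp_sum, ← bernExp_sub]
      refine bernExp_mono h0 h1 fun S _ => ?_
      rw [hsplit, ← sum_mul]
      have := one_sub_sum_le_prod (I := J1) (a := fun j => a j S) (fun j _ => ha0 j S)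
        (fun j _ => ha1 j S)
      nlinarith [mul_le_mul_of_nonneg_left this (hnn J2 S)]
    have hsum : ∑ k ∈ J1, bernExp p E (fun S => a k S * ∏ j ∈ J2, (1 - a j S)) ≤
        d * (2 * Q * bernExp p E (fun S => ∏ j ∈ J2, (1 - a j S))) := by
      have hcard : #J1 ≤ d := (card_le_card (filter_subset_filter _ hJ)).trans (hd i hi)
      calc _ ≤ ∑ k ∈ J1, 2 * Q * bernExp p E (fun S => ∏ j ∈ J2, (1 - a j S)) := by
            refine sum_le_sum fun k hk => ih _ ?_ (hJ1I hk) hJ2I rfl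
            refine card_lt_card (filter_ssubset.2 ⟨k, (mem_filter.1 hk).1, (mem_filter.1 hk).2⟩)
        _ = #J1 * (2 * Q * bernExp p E (fun S => ∏ j ∈ J2, (1 - a j S))) := by
            rw [sum_const, nsmul_eq_mul]
        _ ≤ _ := by gcongr
    nlinarith [mul_le_mul_of_nonneg_right hQd hE2, mul_nonneg hQ0 hE2]
  nlinarith [mul_le_mul_of_nonneg_left step2 hQ0]

/-- The symmetric Lovász local lemma for events determined by disjoint parts of a random subset. -/
theorem exists_forall_not_of_local_lemma [DecidableEq ι] (h0 : 0 ≤ p) (h1 : p ≤ 1) (I : Finset ι)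
    {A : ι → Finset α → Prop} {D : ι → Finset α} (hdep : ∀ i ∈ I, ∀ S, A i S ↔ A i (S ∩ D i))
    {Q : ℝ} {d : ℕ} (hQ0 : 0 ≤ Q)
    (hQ : ∀ i ∈ I, bernExp p E (Set.indicator {S | A i S} 1) ≤ Q)
    (hd : ∀ i ∈ I, #{j ∈ I | ¬ Disjoint (D i) (D j)} ≤ d) (hQd : 4 * Q * (d + 1) ≤ 1) :
    ∃ S ⊆ E, ∀ i ∈ I, ¬ A i S := by
  classical
  set a : ι → Finset α → ℝ := fun i => Set.indicator {S | A i S} 1 with ha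
  have haif : ∀ i S, a i S = if A i S then 1 else 0 := fun i S => by
    simp [ha, Set.indicator_apply]
  have ha0 : ∀ i S, 0 ≤ a i S := fun i S => by rw [haif]; split_ifs <;> norm_num
  have ha1 : ∀ i S, a i S ≤ 1 := fun i S => by rw [haif]; split_ifs <;> norm_num
  have hadep : ∀ i ∈ I, DependsOnFinset (a i) (D i) := fun i hi S => by
    rw [haif, haif]
    exact if_congr (hdep i hi S) rfl rfl
  have hpos : ∀ J ⊆ I, 0 < bernExp p E (fun S => ∏ j ∈ J, (1 - a j S)) := by
    intro J
    induction J using Finset.induction_on with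
    | empty => intro _; simp [bernExp_const]
    | insert j J hj ih =>
      intro hJ
      have hJ' : J ⊆ I := (subset_insert _ _).trans hJ
      have key := bernExp_mul_prod_one_sub_le h0 h1 I hadep ha0 ha1 hQ0 hQ hd hQd
        (hJ (mem_insert_self j J)) hJ'
      have : bernExp p E (fun S => ∏ k ∈ insert j J, (1 - a k S)) =
          bernExp p E (fun S => ∏ k ∈ J, (1 - a k S)) -
          bernExp p E (fun S => a j S * ∏ k ∈ J, (1 - a k S)) := by
        rw [← bernExp_sub]
        exact bernExp_congr fun S _ => by rw [prod_insert hj]; ring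
      rw [this]
      have hd0 : (0 : ℝ) ≤ d := Nat.cast_nonneg d
      nlinarith [ih hJ', mul_nonneg hQ0 hd0]
  by_contra hcon
  push Not at hcon
  refine (hpos I subset_rfl).ne' ?_
  rw [bernExp_congr (g := fun _ => 0), bernExp_const]
  intro S hS
  obtain ⟨i, hi, hAi⟩ := hcon S hS
  exact prod_eq_zero hi (by rw [haif, if_pos hAi]; simp)

end LocalLemma

/-! ### Two-colouring: light pairs by hand, heavy pairs by the local lemma -/

namespace SimpleGraph
open Finset
open scoped Classical

variable {V : Type*}

/-- `S` contains both or none of the edges from `y` to the pair `i`. -/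
def IsMono (S : Finset (Sym2 V)) (y : V) (i : Sym2 V) : Prop :=
  ∀ a ∈ i, ∀ b ∈ i, (s(y, a) ∈ S ↔ s(y, b) ∈ S)

theorem isMono_mk {S : Finset (Sym2 V)} {y u v : V} :
    IsMono S y s(u, v) ↔ (s(y, u) ∈ S ↔ s(y, v) ∈ S) := by
  simp only [IsMono, Sym2.mem_iff]
  constructor
  · intro h
    exact h u (by simp) v (by simp)
  · rintro h a (rfl | rfl) b (rfl | rfl) <;> tauto

variable [Fintype V]

/-- The common neighbours of the two elements of a pair. -/
noncomputable def pairNbrs (G : SimpleGraph V) (i : Sym2 V) : Finset V := {y | ∀ a ∈ i, G.Adj y a}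

/-- The two edges that join `y` to the elements of the pair `i`. -/
noncomputable def cherry (y : V) (i : Sym2 V) : Finset (Sym2 V) := {e | ∃ a ∈ i, e = s(y, a)}

/-- Non-adjacent pairs with at least one but at most `L` common neighbours. -/
def IsLight (G : SimpleGraph V) (L : ℕ) (i : Sym2 V) : Prop :=
  ¬ i.IsDiag ∧ i ∉ G.edgeSet ∧ (G.pairNbrs i).Nonempty ∧ #(G.pairNbrs i) ≤ L

/-- The common neighbour `y` of the pair `i` is dangerous if an edge from `y` to `i` also lies on
a path of length two joining another light pair. -/
def IsDangerous (G : SimpleGraph V) (L : ℕ) (i : Sym2 V) (y : V) : Prop :=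
  ∃ j, G.IsLight L j ∧ j ≠ i ∧ ∃ w ∈ G.pairNbrs j, ¬ Disjoint (cherry y i) (cherry w j)

/-- The common neighbours of a pair that are not dangerous. -/
noncomputable def safeNbrs (G : SimpleGraph V) (L : ℕ) (i : Sym2 V) : Finset V :=
  {y ∈ G.pairNbrs i | ¬ G.IsDangerous L i y}

variable {G : SimpleGraph V} {L : ℕ} {i : Sym2 V} {y : V}

theorem mem_pairNbrs : y ∈ G.pairNbrs i ↔ ∀ a ∈ i, G.Adj y a := by simp [pairNbrs]

theorem mem_pairNbrs_mk {u v : V} : y ∈ G.pairNbrs s(u, v) ↔ G.Adj y u ∧ G.Adj y v := by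
  simp [pairNbrs]

theorem mem_cherry {e : Sym2 V} : e ∈ cherry y i ↔ ∃ a ∈ i, e = s(y, a) := by simp [cherry]

theorem mem_cherry_mk {e : Sym2 V} {u v : V} :
    e ∈ cherry y s(u, v) ↔ e = s(y, u) ∨ e = s(y, v) := by simp [cherry]

theorem cherry_mk (y u v : V) : cherry y s(u, v) = {s(y, u), s(y, v)} := by
  ext e; simp [mem_cherry_mk]

/-- An edge shared by the cherries of distinct `y`, `y'` would put `y` itself into `i`, making `y`
its own neighbour. The disjointness makes the events `IsMono` at different common neighbours
independent. -/
theorem pairwiseDisjoint_cherry (G : SimpleGraph V) (i : Sym2 V) :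
    ((G.pairNbrs i : Finset V) : Set V).PairwiseDisjoint (fun y => cherry y i) := by
  intro y hy y' hy' hne
  simp only [Function.onFun]
  rw [Finset.disjoint_left]
  intro e he he'
  obtain ⟨a, ha, rfl⟩ := mem_cherry.1 he
  obtain ⟨b, hb, hab⟩ := mem_cherry.1 he'
  rcases Sym2.eq_iff.1 hab with h | h
  · exact hne h.1
  · have := mem_pairNbrs.1 hy b hb
    rw [h.1] at this
    exact this.ne rfl

theorem isMono_inter_iff {S D : Finset (Sym2 V)} (h : cherry y i ⊆ D) :
    IsMono (S ∩ D) y i ↔ IsMono S y i := by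
  have : ∀ a ∈ i, (s(y, a) ∈ S ∩ D ↔ s(y, a) ∈ S) := fun a ha => by
    have := h (mem_cherry.2 ⟨a, ha, rfl⟩)
    simp [this]
  refine forall₂_congr fun a ha => forall₂_congr fun b hb => ?_
  rw [this a ha, this b hb]

theorem bernExp_isMono (hi : ¬ i.IsDiag) :
    bernExp (1 / 2) univ (fun S => if IsMono S y i then 1 else 0) = 1 / 2 := by
  induction i with
  | _ u v =>
  have huv : u ≠ v := by simpa using hi
  have hne : s(y, u) ≠ s(y, v) := by
    intro h
    rcases Sym2.eq_iff.1 h with h | h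
    · exact huv h.2
    · exact huv (h.2.trans h.1)
  have h : (fun S : Finset (Sym2 V) => if IsMono S y s(u, v) then (1 : ℝ) else 0) =
      fun S => (if {s(y, u), s(y, v)} ⊆ S then 1 else 0) +
        (if Disjoint {s(y, u), s(y, v)} S then 1 else 0) := by
    ext S
    by_cases h1 : s(y, u) ∈ S <;> by_cases h2 : s(y, v) ∈ S <;>
      simp [isMono_mk, h1, h2, insert_subset_iff]
  rw [h, bernExp_add, bernExp_subset (subset_univ _), bernExp_disjoint (subset_univ _),
    card_pair hne]
  norm_num

theorem bernExp_forall_isMono (hi : ¬ i.IsDiag) {W : Finset V} (hW : W ⊆ G.pairNbrs i) :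
    bernExp (1 / 2) univ (Set.indicator {S | ∀ y ∈ W, IsMono S y i} 1) = (1 / 2) ^ #W := by
  have h : (Set.indicator {S : Finset (Sym2 V) | ∀ y ∈ W, IsMono S y i} 1 : _ → ℝ) =
      fun S => ∏ y ∈ W, if IsMono S y i then (1 : ℝ) else 0 := by
    ext S
    rw [prod_ite_zero]
    simp [Set.indicator_apply]
  rw [h, bernExp_prod W (F := fun y S => if IsMono S y i then (1 : ℝ) else 0)
    (D := fun y => cherry y i)]
  · rw [prod_congr rfl fun y _ => bernExp_isMono hi, prod_const]
  · intro y _ S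
    simp only [isMono_inter_iff subset_rfl]
  · exact (pairwiseDisjoint_cherry G i).subset hW

/-- The dependency degree. A shared edge is one of the `2q` edges `{y, a}` of the cherries at `i`.
The other pair then has one end in `{y, a}` and its second end among the at most `Δ` neighbours of
the other vertex of that edge. -/
theorem card_filter_not_disjoint_le {I : Finset (Sym2 V)} {W : Sym2 V → Finset V} {q Δ : ℕ}
    (hW : ∀ i ∈ I, W i ⊆ G.pairNbrs i) (hq : ∀ i ∈ I, #(W i) = q)
    (hΔ : ∀ v, #{w | G.Adj v w} ≤ Δ) (hi : i ∈ I) :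
    #{j ∈ I | ¬ Disjoint ((W i).biUnion fun y => cherry y i) ((W j).biUnion fun y => cherry y j)}
      ≤ 4 * q * Δ := by
  set B : V → V → Finset (Sym2 V) := fun y a =>
    Finset.image (fun x => s(a, x)) {x | G.Adj y x} ∪ Finset.image (fun x => s(y, x)) {x | G.Adj a x}
    with hB
  have hBc : ∀ y a, #(B y a) ≤ 2 * Δ := fun y a => by
    refine (card_union_le _ _).trans ?_
    have h1 := (card_image_le (f := fun x => s(a, x))).trans (hΔ y)
    have h2 := (card_image_le (f := fun x => s(y, x))).trans (hΔ a)
    omega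
  induction i with
  | _ u v =>
  have hsub : {j ∈ I | ¬ Disjoint ((W s(u, v)).biUnion fun y => cherry y s(u, v))
      ((W j).biUnion fun y => cherry y j)} ⊆ (W s(u, v)).biUnion fun y => B y u ∪ B y v := by
    intro j hj
    obtain ⟨hjI, hj⟩ := mem_filter.1 hj
    rw [not_disjoint_iff] at hj
    obtain ⟨e, he, he'⟩ := hj
    obtain ⟨y, hy, he⟩ := mem_biUnion.1 he
    obtain ⟨y', hy', he'⟩ := mem_biUnion.1 he'
    obtain ⟨b, hb, hbe⟩ := mem_cherry.1 he'
    have hyj := mem_pairNbrs.1 (hW j hjI hy')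
    have key : ∀ a, e = s(y, a) → j ∈ B y a := by
      intro a ha
      obtain ⟨x, rfl⟩ := hb
      have hx := hyj x (by simp)
      rw [ha] at hbe
      rw [hB, mem_union, mem_image, mem_image]
      rcases Sym2.eq_iff.1 hbe with ⟨rfl, rfl⟩ | ⟨rfl, rfl⟩
      · exact Or.inl ⟨x, by simpa using hx, rfl⟩
      · exact Or.inr ⟨x, by simpa using hx, rfl⟩
    rw [mem_biUnion]
    refine ⟨y, hy, mem_union.2 ?_⟩
    rcases mem_cherry_mk.1 he with h | h
    · exact Or.inl (key _ h)
    · exact Or.inr (key _ h)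
  calc _ ≤ _ := card_le_card hsub
    _ ≤ #(W s(u, v)) * (4 * Δ) := card_biUnion_le_card_mul _ _ _ fun y _ =>
        (card_union_le _ _).trans (by have := hBc y u; have := hBc y v; omega)
    _ = 4 * q * Δ := by rw [hq _ hi]; ring

/-- If every light pair has a safe common neighbour and every non-adjacent pair with more than `L`
common neighbours has many safe ones, then there is a two-colouring for which every non-adjacent
pair with a common neighbour is joined by a two-coloured path of length two. -/
theorem exists_two_colouring {q Δ : ℕ} (hΔ : ∀ v, #{w | G.Adj v w} ≤ Δ)
    (hlight : ∀ i, G.IsLight L i → (G.safeNbrs L i).Nonempty)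
    (hheavy : ∀ i : Sym2 V, ¬ i.IsDiag → i ∉ G.edgeSet → L < #(G.pairNbrs i) →
      q ≤ #(G.safeNbrs L i))
    (hq : 4 * (1 / 2 : ℝ) ^ q * ((4 * q * Δ : ℕ) + 1) ≤ 1) :
    ∃ χ : Sym2 V → Bool, ∀ u v, u ≠ v → ¬ G.Adj u v → (∃ y, G.Adj y u ∧ G.Adj y v) →
      ∃ y, G.Adj y u ∧ G.Adj y v ∧ χ s(y, u) ≠ χ s(y, v) := by
  set I : Finset (Sym2 V) := {i | ¬ i.IsDiag ∧ i ∉ G.edgeSet ∧ L < #(G.pairNbrs i)} with hI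
  have hIm : ∀ i ∈ I, ¬ i.IsDiag ∧ i ∉ G.edgeSet ∧ L < #(G.pairNbrs i) := fun i hi => by
    simpa [hI] using hi
  have hex : ∀ i ∈ I, ∃ W ⊆ G.safeNbrs L i, #W = q := fun i hi =>
    exists_subset_card_eq (hheavy i (hIm i hi).1 (hIm i hi).2.1 (hIm i hi).2.2)
  choose! W hWs hWq using hex
  have hWn : ∀ i ∈ I, W i ⊆ G.pairNbrs i := fun i hi => (hWs i hi).trans (filter_subset _ _)
  obtain ⟨S, -, hS⟩ := exists_forall_not_of_local_lemma (p := 1 / 2) (E := univ)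
    (A := fun i S => ∀ y ∈ W i, IsMono S y i) (D := fun i => (W i).biUnion fun y => cherry y i)
    (Q := (1 / 2) ^ q) (d := 4 * q * Δ) (by norm_num) (by norm_num) I
    (fun i _ S => forall₂_congr fun y hy => (isMono_inter_iff
      (subset_biUnion_of_mem (fun y => cherry y i) hy)).symm) (by positivity)
    (fun i hi => by rw [bernExp_forall_isMono (hIm i hi).1 (hWn i hi), hWq i hi])
    (fun i hi => card_filter_not_disjoint_le hWn hWq hΔ hi) (by exact_mod_cast hq)
  -- For pairs that are not light the chosen vertex is an arbitrary default, never used.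
  have hlight' : ∀ i, ∃ y, G.IsLight L i → y ∈ G.safeNbrs L i := fun i => by
    by_cases hi : G.IsLight L i
    · exact (hlight i hi).imp fun y hy _ => hy
    · exact ⟨(Quot.out i).1, fun h => absurd h hi⟩
  choose c hc using hlight'
  -- `T` collects the edges whose colour is prescribed by light pairs. `T₁` contains, for each light
  -- pair, the edge to the chosen representative end; within `T` the colour records membership in
  -- `T₁`, so the two edges of a cherry should differ.
  set T : Set (Sym2 V) := {e | ∃ i, G.IsLight L i ∧ e ∈ cherry (c i) i} with hT
  set T₁ : Set (Sym2 V) := {e | ∃ i, G.IsLight L i ∧ e = s(c i, (Quot.out i).1)} with hT₁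
  have hcn : ∀ i, G.IsLight L i → c i ∈ G.pairNbrs i := fun i hi => (mem_filter.1 (hc i hi)).1
  have hcd : ∀ i, G.IsLight L i → ¬ G.IsDangerous L i (c i) := fun i hi =>
    (mem_filter.1 (hc i hi)).2
  refine ⟨fun e => if e ∈ T then decide (e ∈ T₁) else decide (e ∈ S), fun u v huv hadj hy => ?_⟩
  have hne : (G.pairNbrs s(u, v)).Nonempty := by
    obtain ⟨y, hy⟩ := hy
    exact ⟨y, mem_pairNbrs_mk.2 hy⟩
  by_cases hL : #(G.pairNbrs s(u, v)) ≤ L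
  · have hl : G.IsLight L s(u, v) := ⟨by simpa using huv, by simpa using hadj, hne, hL⟩
    have huT : s(c s(u, v), u) ∈ T := ⟨_, hl, mem_cherry_mk.2 (Or.inl rfl)⟩
    have hvT : s(c s(u, v), v) ∈ T := ⟨_, hl, mem_cherry_mk.2 (Or.inr rfl)⟩
    -- Prescriptions do not collide: an edge of this cherry that was put into `T₁` by another light
    -- pair would make the chosen neighbour dangerous.
    have key : ∀ x ∈ s(u, v), (s(c s(u, v), x) ∈ T₁ ↔ x = (Quot.out s(u, v)).1) := by
      intro x hx
      constructor
      · rintro ⟨j, hj, hjx⟩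
        by_cases hji : j = s(u, v)
        · rw [hji] at hjx
          rcases Sym2.eq_iff.1 hjx with h | h
          · exact h.2
          · rw [h.2, h.1]
        · refine absurd ⟨j, hj, hji, c j, hcn j hj, ?_⟩ (hcd _ hl)
          rw [not_disjoint_iff]
          exact ⟨_, mem_cherry.2 ⟨x, hx, rfl⟩, mem_cherry.2 ⟨_, Sym2.out_fst_mem j, hjx⟩⟩
      · rintro rfl
        exact ⟨_, hl, rfl⟩
    refine ⟨c s(u, v), (mem_pairNbrs_mk.1 (hcn _ hl)).1, (mem_pairNbrs_mk.1 (hcn _ hl)).2, ?_⟩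
    simp only [if_pos huT, if_pos hvT, ne_eq, decide_eq_decide]
    rw [key u (by simp), key v (by simp)]
    rcases Sym2.mem_iff.1 (Sym2.out_fst_mem s(u, v)) with h | h
    · rw [h]; tauto
    · rw [h]; tauto
  · have hi : s(u, v) ∈ I := by
      simp only [hI, mem_filter, mem_univ, true_and]
      exact ⟨by simpa using huv, by simpa using hadj, not_le.1 hL⟩
    have := hS _ hi
    push Not at this
    obtain ⟨y, hy, hmono⟩ := this
    have hyn := mem_pairNbrs_mk.1 (hWn _ hi hy)
    have hyd := (mem_filter.1 (hWs _ hi hy)).2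
    -- The vertices of `W` are safe for this heavy pair, so their edges avoid `T` and keep the
    -- colours from the local lemma.
    have hnT : ∀ x ∈ s(u, v), s(y, x) ∉ T := by
      rintro x hx ⟨j, hj, hjx⟩
      refine hyd ⟨j, hj, ?_, c j, hcn j hj, ?_⟩
      · rintro rfl
        exact hL hj.2.2.2
      · rw [not_disjoint_iff]
        exact ⟨_, mem_cherry.2 ⟨x, hx, rfl⟩, hjx⟩
    refine ⟨y, hyn.1, hyn.2, ?_⟩
    simp only [if_neg (hnT u (by simp)), if_neg (hnT v (by simp)), ne_eq, decide_eq_decide]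
    rwa [isMono_mk] at hmono

end SimpleGraph

/-! ### Rainbow paths and the rainbow connection number -/

namespace SimpleGraph
open Finset

section Rainbow
variable {V K : Type*} {G : SimpleGraph V}

/-- The edges of a rainbow path inject into the colours. -/
theorem EdgeLabeling.IsRainbow.exists_length_le {k : ℕ} {C : G.EdgeLabeling (Fin k)}
    (hC : C.IsRainbow) (u v : V) : ∃ w : G.Walk u v, w.length ≤ k := by
  obtain ⟨w, hw, hinj⟩ := hC u v
  refine ⟨w, ?_⟩
  have hcard : #(univ : Finset (Fin w.length)) ≤ #(univ : Finset (Fin k)) := by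
    have hm : ∀ j : Fin w.length, w.edges[j]'(by simp) ∈ w.edges := fun j => List.getElem_mem _
    refine card_le_card_of_injOn
      (fun j => C ⟨w.edges[j]'(by simp), w.edges_subset_edgeSet (hm j)⟩) (by simp) ?_
    intro a _ b _ hab
    have := hinj _ _ (hm a) (hm b) hab
    simp only [Subtype.mk.injEq] at this
    exact Fin.ext ((List.Nodup.getElem_inj_iff hw.isTrail.edges_nodup).1 this)
  simpa using hcard

theorem exists_isRainbow_of_rainbowConnectionNumber_le {k : ℕ}
    (h : G.rainbowConnectionNumber ≤ k) :
    ∃ j ≤ k, ∃ C : G.EdgeLabeling (Fin j), C.IsRainbow := by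
  have hne : {m : ℕ∞ | ∃ k : ℕ, m = k ∧ ∃ C : G.EdgeLabeling (Fin k), C.IsRainbow}.Nonempty := by
    rw [Set.nonempty_iff_ne_empty]
    intro he
    rw [rainbowConnectionNumber, he, sInf_empty] at h
    exact (ENat.natCast_lt_top k).not_ge h
  obtain ⟨j, hj, C, hC⟩ := csInf_mem hne
  refine ⟨j, ?_, C, hC⟩
  rw [rainbowConnectionNumber, hj] at h
  exact_mod_cast h

theorem two_le_rainbowConnectionNumber {u v : V} (huv : u ≠ v) (h : ¬ G.Adj u v) :
    2 ≤ G.rainbowConnectionNumber := by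
  by_contra hlt
  have hle : G.rainbowConnectionNumber ≤ (1 : ℕ) := by
    rw [not_le] at hlt
    exact Order.le_of_lt_add_one (by simpa [one_add_one_eq_two] using hlt)
  obtain ⟨j, hj, C, hC⟩ := exists_isRainbow_of_rainbowConnectionNumber_le hle
  obtain ⟨w, hw⟩ := hC.exists_length_le u v
  have h0 : w.length ≠ 0 := fun h0 => huv (Walk.eq_of_length_eq_zero h0)
  exact h (Walk.adj_of_length_eq_one (p := w) (by omega))

theorem exists_common_nbr_of_rainbowConnectionNumber_le_two
    (h2 : G.rainbowConnectionNumber ≤ (2 : ℕ)) {u v : V} (huv : u ≠ v) (h : ¬ G.Adj u v) :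
    ∃ y, G.Adj y u ∧ G.Adj y v := by
  obtain ⟨j, hj, C, hC⟩ := exists_isRainbow_of_rainbowConnectionNumber_le h2
  obtain ⟨w, hw⟩ := hC.exists_length_le u v
  cases w with
  | nil => exact absurd rfl huv
  | cons h1 w =>
    cases w with
    | nil => exact absurd h1 h
    | cons h2 w =>
      cases w with
      | nil => exact ⟨_, h1.symm, h2⟩
      | cons h3 w => simp at hw; omega

theorem rainbowConnectionNumber_le {k : ℕ} (χ : Sym2 V → Fin k)
    (h : ∀ u v, u ≠ v → ¬ G.Adj u v → ∃ w : G.Walk u v, w.IsPath ∧ (w.edges.map χ).Nodup) :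
    G.rainbowConnectionNumber ≤ k := by
  refine sInf_le ⟨k, rfl, fun e => χ e, fun u v => ?_⟩
  have key : ∀ w : G.Walk u v, w.IsPath → (w.edges.map χ).Nodup →
      w.IsRainbowPath (K := Fin k) (fun e : G.edgeSet => χ e) := fun w hw hn =>
    ⟨hw, fun e f he hf hef => Subtype.ext (List.inj_on_of_nodup_map hn he hf hef)⟩
  by_cases huv : u = v
  · subst huv
    exact ⟨.nil, key _ (by simp) (by simp)⟩
  by_cases hadj : G.Adj u v
  · exact ⟨hadj.toWalk, key _ (by simp [hadj.ne]) (by simp)⟩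
  · obtain ⟨w, hw, hn⟩ := h u v huv hadj
    exact ⟨w, key w hw hn⟩

theorem exists_rainbow_of_two_path {χ : Sym2 V → K} {u v y : V} (huv : u ≠ v) (hu : G.Adj y u)
    (hv : G.Adj y v) (hχ : χ s(y, u) ≠ χ s(y, v)) :
    ∃ w : G.Walk u v, w.IsPath ∧ (w.edges.map χ).Nodup := by
  refine ⟨.cons hu.symm (.cons hv .nil), ?_, ?_⟩
  · simp [hu.ne', hv.ne, huv]
  · simpa [Sym2.eq_swap (a := u)] using hχ

theorem exists_rainbow_of_three_path {χ : Sym2 V → K} {u a b v : V} (huv : u ≠ v)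
    (hub : u ≠ b) (hav : a ≠ v) (h1 : G.Adj u a) (h2 : G.Adj a b)
    (h3 : G.Adj b v) (h12 : χ s(u, a) ≠ χ s(b, a)) (h13 : χ s(u, a) ≠ χ s(b, v))
    (h23 : χ s(b, a) ≠ χ s(b, v)) :
    ∃ w : G.Walk u v, w.IsPath ∧ (w.edges.map χ).Nodup := by
  refine ⟨.cons h1 (.cons h2 (.cons h3 .nil)), ?_, ?_⟩
  · simp [h1.ne, h2.ne, h3.ne, huv, hub, hav]
  · simp [Sym2.eq_swap (a := a), h12, h13, h23]

theorem exists_rainbow_reverse {χ : Sym2 V → K} {u v : V}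
    (h : ∃ w : G.Walk u v, w.IsPath ∧ (w.edges.map χ).Nodup) :
    ∃ w : G.Walk v u, w.IsPath ∧ (w.edges.map χ).Nodup := by
  obtain ⟨w, hw, hn⟩ := h
  refine ⟨w.reverse, hw.reverse, ?_⟩
  rw [Walk.edges_reverse, List.map_reverse]
  exact List.nodup_reverse.2 hn

end Rainbow

/-! ### Bad pairs, and the passage from two to three colours -/

section Bad
open scoped Classical
variable {V : Type*} [Fintype V] {G : SimpleGraph V}

/-- A pair is bad if it is non-adjacent and has no common neighbours. -/
def IsBad (G : SimpleGraph V) (i : Sym2 V) : Prop :=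
  ¬ i.IsDiag ∧ i ∉ G.edgeSet ∧ G.pairNbrs i = ∅

/-- The set of bad pairs. -/
noncomputable def badPairs (G : SimpleGraph V) : Finset (Sym2 V) := {i | G.IsBad i}

theorem mem_badPairs {i : Sym2 V} : i ∈ G.badPairs ↔ G.IsBad i := by simp [badPairs]

theorem isBad_mk {u v : V} :
    G.IsBad s(u, v) ↔ u ≠ v ∧ ¬ G.Adj u v ∧ ∀ y, G.Adj y u → ¬ G.Adj y v := by
  simp [IsBad, Finset.eq_empty_iff_forall_notMem, mem_pairNbrs_mk]

theorem badPairs_eq_empty_of_rainbowConnectionNumber_le_two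
    (h2 : G.rainbowConnectionNumber ≤ (2 : ℕ)) : G.badPairs = ∅ := by
  rw [Finset.eq_empty_iff_forall_notMem]
  intro i
  induction i with
  | _ u v =>
  intro h
  obtain ⟨h1, h3, h4⟩ := isBad_mk.1 (mem_badPairs.1 h)
  obtain ⟨y, hyu, hyv⟩ := exists_common_nbr_of_rainbowConnectionNumber_le_two h2 h1 h3
  exact h4 y hyu hyv

theorem rainbowConnectionNumber_le_two_of_colouring (χ : Sym2 V → Bool)
    (hχ : ∀ u v, u ≠ v → ¬ G.Adj u v → (∃ y, G.Adj y u ∧ G.Adj y v) →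
      ∃ y, G.Adj y u ∧ G.Adj y v ∧ χ s(y, u) ≠ χ s(y, v)) (hb : G.badPairs = ∅) :
    G.rainbowConnectionNumber ≤ (2 : ℕ) := by
  refine rainbowConnectionNumber_le (fun e => if χ e then 0 else 1) fun u v huv hadj => ?_
  have hnb : ¬ G.IsBad s(u, v) := by rw [← mem_badPairs, hb]; simp
  obtain ⟨y, hyu, hyv, hy⟩ := hχ u v huv hadj (by
    by_contra hcon
    push Not at hcon
    exact hnb (isBad_mk.2 ⟨huv, hadj, hcon⟩))
  refine exists_rainbow_of_two_path huv hyu hyv ?_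
  cases h1 : χ s(y, u) <;> cases h2 : χ s(y, v) <;> simp_all

/-- A vertex `u` lies in at most one bad pair, so all vertices but `u` and one more are within
distance two of `u`. This turns the upper bound on degrees into a lower bound, so no lower tail
estimate for degrees is needed. -/
theorem card_le_of_badPairs_disjoint {Δ : ℕ} (hΔ : ∀ v, #{w | G.Adj v w} ≤ Δ)
    (hdisj : ∀ i ∈ G.badPairs, ∀ j ∈ G.badPairs, ∀ a, a ∈ i → a ∈ j → i = j) (u : V) :
    Fintype.card V ≤ 2 + #{w | G.Adj u w} * (1 + Δ) := by
  have hsub : (univ : Finset V) ⊆ {u} ∪ ({x | G.IsBad s(u, x)} : Finset V) ∪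
      (({w | G.Adj u w} : Finset V) ∪
        ({w | G.Adj u w} : Finset V).biUnion fun w => {x | G.Adj w x}) := by
    intro x _
    by_contra hx
    simp only [mem_union, mem_singleton, mem_filter, mem_univ, true_and, mem_biUnion] at hx
    push Not at hx
    exact hx.1.2 (isBad_mk.2 ⟨Ne.symm hx.1.1, hx.2.1, fun y hy hy' => hx.2.2 y hy.symm hy'⟩)
  have h1 : #({x | G.IsBad s(u, x)} : Finset V) ≤ 1 := by
    rw [card_le_one]
    intro a ha b hb
    simp only [mem_filter, mem_univ, true_and] at ha hb
    have := hdisj _ (mem_badPairs.2 ha) _ (mem_badPairs.2 hb) u (by simp) (by simp)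
    rcases Sym2.eq_iff.1 this with h | h
    · exact h.2
    · exact h.2.trans h.1
  have h2 : #(({w | G.Adj u w} : Finset V).biUnion fun w => ({x | G.Adj w x} : Finset V)) ≤
      #{w | G.Adj u w} * Δ := card_biUnion_le_card_mul _ _ _ fun w _ => hΔ w
  have h3 := (card_le_card hsub).trans ((card_union_le _ _).trans
    (add_le_add (card_union_le _ _) (card_union_le _ _)))
  rw [card_univ, card_singleton] at h3
  rw [mul_add, mul_one]
  omega

/-- For a bad pair `{f, v}` take a neighbour `a` of `f` outside all bad pairs. Then `{a, v}` is
non-adjacent but not bad, so it has a two-coloured path `a b v`; giving `fa` the third colour makes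
`f a b v` rainbow. Choosing the vertices `a` distinct makes the recoloured edges a matching. -/
theorem rainbowConnectionNumber_le_three_of_colouring (χ : Sym2 V → Bool)
    (hχ : ∀ u v, u ≠ v → ¬ G.Adj u v → (∃ y, G.Adj y u ∧ G.Adj y v) →
      ∃ y, G.Adj y u ∧ G.Adj y v ∧ χ s(y, u) ≠ χ s(y, v))
    (hdisj : ∀ i ∈ G.badPairs, ∀ j ∈ G.badPairs, ∀ a, a ∈ i → a ∈ j → i = j)
    (hdeg : ∀ u, 3 * #G.badPairs ≤ #{w | G.Adj u w}) :
    G.rainbowConnectionNumber ≤ (3 : ℕ) := by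
  set f : Sym2 V → V := fun i => (Quot.out i).1 with hf
  have hfm : ∀ i, f i ∈ i := Sym2.out_fst_mem
  set B : Finset V := G.badPairs.biUnion fun i => i.toFinset with hB
  have hBm : ∀ x, x ∈ B ↔ ∃ i ∈ G.badPairs, x ∈ i := fun x => by simp [hB]
  have hBc : #B ≤ #G.badPairs * 2 := card_biUnion_le_card_mul _ _ _ fun i _ => by
    by_cases h : i.IsDiag
    · rw [Sym2.card_toFinset_of_isDiag _ h]; norm_num
    · rw [Sym2.card_toFinset_of_not_isDiag _ h]
  -- Hall's condition is trivial here: removing the at most `2 * #G.badPairs` vertices of bad pairs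
  -- from a neighbourhood still leaves at least as many vertices as there are bad pairs.
  obtain ⟨a, hainj, ha⟩ := (Finset.all_card_le_biUnion_card_iff_exists_injective
    (fun i : G.badPairs => ({w | G.Adj (f i) w} : Finset V) \ B)).1 (by
      intro s
      rcases s.eq_empty_or_nonempty with rfl | ⟨i, hi⟩
      · simp
      refine le_trans ?_ (card_le_card (subset_biUnion_of_mem
        (fun i : G.badPairs => ({w | G.Adj (f i) w} : Finset V) \ B) hi))
      have h1 : #s ≤ #G.badPairs := by simpa using card_le_univ s
      have h2 := hdeg (f i)
      have h3 := le_card_sdiff B ({w | G.Adj (f i) w} : Finset V)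
      omega)
  have haadj : ∀ i : G.badPairs, G.Adj (f i) (a i) := fun i => by
    have := ha i
    simp only [mem_sdiff, mem_filter, mem_univ, true_and] at this
    exact this.1
  have haB : ∀ i : G.badPairs, a i ∉ B := fun i => (mem_sdiff.1 (ha i)).2
  have hfB : ∀ i : G.badPairs, f i ∈ B := fun i => (hBm _).2 ⟨i, i.2, hfm i⟩
  set M : Set (Sym2 V) := {e | ∃ i : G.badPairs, e = s(f i, a i)} with hM
  have hMatch : ∀ i j : G.badPairs, ∀ y, y ∈ s(f i, a i) → y ∈ s(f j, a j) → i = j := by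
    intro i j y hy hy'
    rcases Sym2.mem_iff.1 hy with rfl | rfl <;> rcases Sym2.mem_iff.1 hy' with h | h
    · exact Subtype.ext (hdisj i i.2 j j.2 _ (hfm i) (h ▸ hfm j))
    · exact absurd (h ▸ hfB i) (haB j)
    · exact absurd (h ▸ hfB j) (haB i)
    · exact hainj h
  obtain ⟨χ', hχM, hχn, hχne⟩ : ∃ χ' : Sym2 V → Fin 3, (∀ e ∈ M, χ' e = 2) ∧
      (∀ e ∉ M, χ' e ≠ 2) ∧ ∀ e e', e ∉ M → e' ∉ M → χ e ≠ χ e' → χ' e ≠ χ' e' := by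
    refine ⟨fun e => if e ∈ M then 2 else if χ e then 0 else 1, fun e he => if_pos he,
      fun e he => ?_, fun e e' he he' h => ?_⟩
    · beta_reduce
      rw [if_neg he]
      exact (by decide : ∀ b : Bool, (if b then (0 : Fin 3) else 1) ≠ 2) _
    · beta_reduce
      rw [if_neg he, if_neg he']
      exact (by decide : ∀ b b' : Bool, b ≠ b' →
        (if b then (0 : Fin 3) else 1) ≠ if b' then 0 else 1) _ _ h
  have hbad : ∀ i : G.badPairs, ∀ v, (i : Sym2 V) = s(f i, v) →
      ∃ w : G.Walk (f i) v, w.IsPath ∧ (w.edges.map χ').Nodup := by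
    intro i v hv
    have hib := mem_badPairs.1 i.2
    rw [hv, isBad_mk] at hib
    obtain ⟨hne, hnadj, hno⟩ := hib
    have hvB : v ∈ B := (hBm v).2 ⟨i, i.2, by rw [hv]; simp⟩
    have hav : a i ≠ v := fun h => haB i (h ▸ hvB)
    have hnadj' : ¬ G.Adj (a i) v := hno _ (haadj i).symm
    obtain ⟨b, hba, hbv, hb⟩ := hχ (a i) v hav hnadj' (by
      by_contra hcon
      push Not at hcon
      exact haB i ((hBm _).2
        ⟨s(a i, v), mem_badPairs.2 (isBad_mk.2 ⟨hav, hnadj', hcon⟩), by simp⟩))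
    have hfb : f i ≠ b := by
      rintro h
      exact hnadj (h ▸ hbv)
    have h1 : s(f i, a i) ∈ M := ⟨i, rfl⟩
    have h2 : s(b, a i) ∉ M := by
      rintro ⟨j, hj⟩
      have hij := hMatch i j (a i) (by simp) (by rw [← hj]; simp)
      subst hij
      rcases Sym2.eq_iff.1 hj with h | h
      · exact hfb h.1.symm
      · exact hba.ne h.1
    have h3 : s(b, v) ∉ M := by
      rintro ⟨j, hj⟩
      have hvj : v ∈ s(f j, a j) := by rw [← hj]; simp
      rcases Sym2.mem_iff.1 hvj with h | h
      · have hij : i = j := Subtype.ext (hdisj i i.2 j j.2 v (by rw [hv]; simp) (h ▸ hfm j))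
        subst hij
        exact hne h.symm
      · exact haB j (h ▸ hvB)
    refine exists_rainbow_of_three_path hne hfb hav (haadj i) hba.symm hbv ?_ ?_
      (hχne _ _ h2 h3 hb)
    · rw [hχM _ h1]; exact (hχn _ h2).symm
    · rw [hχM _ h1]; exact (hχn _ h3).symm
  refine rainbowConnectionNumber_le χ' fun u v huv hadj => ?_
  by_cases hcn : ∃ y, G.Adj y u ∧ G.Adj y v
  · obtain ⟨y, hyu, hyv, hy⟩ := hχ u v huv hadj hcn
    refine exists_rainbow_of_two_path huv hyu hyv ?_
    -- Both edges of the two-path meet at `y`, so the matching contains at most one of them. One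
    -- recoloured edge still leaves two distinct colours.
    by_cases h1 : s(y, u) ∈ M <;> by_cases h2 : s(y, v) ∈ M
    · obtain ⟨i, hi⟩ := h1
      obtain ⟨j, hj⟩ := h2
      have hij := hMatch i j y (by rw [← hi]; simp) (by rw [← hj]; simp)
      subst hij
      rw [← hi] at hj
      rcases Sym2.eq_iff.1 hj with h | h
      · exact absurd h.2.symm huv
      · exact absurd (h.2.trans h.1).symm huv
    · rw [hχM _ h1]; exact (hχn _ h2).symm
    · rw [hχM _ h2]; exact hχn _ h1
    · exact hχne _ _ h1 h2 hy
  · push Not at hcn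
    have hi : s(u, v) ∈ G.badPairs := mem_badPairs.2 (isBad_mk.2 ⟨huv, hadj, hcn⟩)
    rcases Sym2.mem_iff.1 (hfm s(u, v)) with h | h
    · have := hbad ⟨_, hi⟩ v (by simp [h])
      rwa [h] at this
    · have := hbad ⟨_, hi⟩ u (by simp [h, Sym2.eq_swap])
      rw [h] at this
      exact exists_rainbow_reverse this

end Bad

end SimpleGraph

/-! ### The binomial random graph as a Bernoulli subset of the potential edges -/

namespace SimpleGraph
open Finset
open scoped Classical

section RandomGraph
variable {V : Type*} [Fintype V]

/-- The potential edges of a graph on `V`. -/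
noncomputable def nonDiag (V : Type*) [Fintype V] : Finset (Sym2 V) := {e | ¬ e.IsDiag}

theorem mem_nonDiag {e : Sym2 V} : e ∈ nonDiag V ↔ ¬ e.IsDiag := by simp [nonDiag]

theorem card_nonDiag : #(nonDiag V) = (Fintype.card V).choose 2 := by
  rw [← Sym2.card_subtype_not_diag, Fintype.card_subtype, nonDiag]

theorem mem_edgeSet_fromEdgeSet {S : Finset (Sym2 V)} (hS : S ⊆ nonDiag V) {e : Sym2 V} :
    e ∈ (fromEdgeSet (S : Set (Sym2 V))).edgeSet ↔ e ∈ S := by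
  simp only [edgeSet_fromEdgeSet, Set.mem_sdiff, mem_coe]
  exact ⟨fun h => h.1, fun h => ⟨h, by simpa using mem_nonDiag.1 (hS h)⟩⟩

theorem adj_fromEdgeSet {S : Finset (Sym2 V)} (hS : S ⊆ nonDiag V) {a b : V} :
    (fromEdgeSet (S : Set (Sym2 V))).Adj a b ↔ s(a, b) ∈ S := by
  rw [← mem_edgeSet, mem_edgeSet_fromEdgeSet hS]

theorem mem_pairNbrs_fromEdgeSet {S : Finset (Sym2 V)} (hS : S ⊆ nonDiag V) {i : Sym2 V} {y : V} :
    y ∈ (fromEdgeSet (S : Set (Sym2 V))).pairNbrs i ↔ cherry y i ⊆ S := by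
  simp only [mem_pairNbrs, subset_iff, mem_cherry, adj_fromEdgeSet hS]
  constructor
  · rintro h e ⟨a, ha, rfl⟩
    exact h a ha
  · exact fun h a ha => h ⟨a, ha, rfl⟩

theorem binomialRandom_real_singleton (p : unitInterval) {S : Finset (Sym2 V)}
    (hS : S ⊆ nonDiag V) :
    (binomialRandom V p).real {fromEdgeSet (S : Set (Sym2 V))} =
      (p : ℝ) ^ #S * (1 - p) ^ #(nonDiag V \ S) := by
  have h : (fromEdgeSet (S : Set (Sym2 V))).edgeSet = S := by
    ext e
    simp [mem_edgeSet_fromEdgeSet hS, -edgeSet_fromEdgeSet]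
  rw [MeasureTheory.measureReal_def, binomialRandom_singleton, h, Set.ncard_coe_finset,
    card_sdiff_of_subset hS, card_nonDiag, Nat.card_eq_fintype_card]
  simp

theorem binomialRandom_real_eq_bernExp (p : unitInterval) (A : Set (SimpleGraph V)) :
    (binomialRandom V p).real A =
      bernExp p (nonDiag V) (fun S => A.indicator 1 (fromEdgeSet (S : Set (Sym2 V)))) := by
  have hA : A = ⋃ S ∈ ({S ∈ (nonDiag V).powerset | fromEdgeSet (S : Set (Sym2 V)) ∈ A} :
      Finset (Finset (Sym2 V))), {fromEdgeSet (S : Set (Sym2 V))} := by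
    ext G
    simp only [mem_filter, mem_powerset, Set.mem_iUnion, Set.mem_singleton_iff, exists_prop]
    constructor
    · intro hG
      have : fromEdgeSet ((G.edgeSet.toFinset : Finset (Sym2 V)) : Set (Sym2 V)) = G := by simp
      refine ⟨G.edgeSet.toFinset, ⟨fun e he => ?_, by rwa [this]⟩, this.symm⟩
      exact mem_nonDiag.2 (G.not_isDiag_of_mem_edgeSet (by simpa using he))
    · rintro ⟨S, ⟨_, hS⟩, rfl⟩
      exact hS
  rw [bernExp]
  conv_lhs => rw [hA]
  rw [MeasureTheory.measureReal_biUnion_finset, sum_filter]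
  · refine sum_congr rfl fun S hS => ?_
    rw [Set.indicator_apply]
    split_ifs
    · rw [binomialRandom_real_singleton p (mem_powerset.1 hS)]
      simp
    · simp
  · intro S hS T hT hne
    simp only [coe_filter, mem_powerset, Set.mem_ofPred_eq] at hS hT
    simp only [Function.onFun, Set.disjoint_singleton]
    intro h
    apply hne
    ext e
    rw [← mem_edgeSet_fromEdgeSet hS.1, h, mem_edgeSet_fromEdgeSet hT.1]
  · intro S _
    have := measurableEmbedding_edgeSet.measurable (measurableSet_singleton
      (fromEdgeSet (S : Set (Sym2 V))).edgeSet)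
    convert this using 1
    ext G
    simp [-edgeSet_fromEdgeSet]

end RandomGraph

/-! ### Independence of the edges inside a vertex set and of the stars from outside vertices -/

section Exposure
variable {V : Type*} [Fintype V]

/-- The edges inside `R`. -/
noncomputable def insideEdges (R : Finset V) : Finset (Sym2 V) := {e | ∀ a ∈ e, a ∈ R}

/-- The edges from `y` to `R`. -/
noncomputable def starEdges (y : V) (R : Finset V) : Finset (Sym2 V) := {e | ∃ a ∈ R, e = s(y, a)}

theorem mem_insideEdges {R : Finset V} {e : Sym2 V} : e ∈ insideEdges R ↔ ∀ a ∈ e, a ∈ R := by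
  simp [insideEdges]

theorem mem_starEdges {R : Finset V} {y : V} {e : Sym2 V} :
    e ∈ starEdges y R ↔ ∃ a ∈ R, e = s(y, a) := by
  simp [starEdges]

theorem cherry_subset_starEdges {R : Finset V} {i : Sym2 V} (hi : i ∈ insideEdges R) (y : V) :
    cherry y i ⊆ starEdges y R := fun e he => by
  obtain ⟨a, ha, rfl⟩ := mem_cherry.1 he
  exact mem_starEdges.2 ⟨a, mem_insideEdges.1 hi a ha, rfl⟩

theorem pairwiseDisjoint_starEdges (R : Finset V) :
    ((Rᶜ : Finset V) : Set V).PairwiseDisjoint fun y => starEdges y R := by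
  intro y hy y' hy' hne
  simp only [coe_compl, Set.mem_compl_iff, mem_coe] at hy hy'
  simp only [Function.onFun]
  rw [Finset.disjoint_left]
  intro e he he'
  obtain ⟨a, ha, rfl⟩ := mem_starEdges.1 he
  obtain ⟨b, hb, hab⟩ := mem_starEdges.1 he'
  rcases Sym2.eq_iff.1 hab with h | h
  · exact hne h.1
  · exact hy (h.1 ▸ hb)

theorem disjoint_insideEdges_starEdges {R : Finset V} {y : V} (hy : y ∉ R) :
    Disjoint (insideEdges R) (starEdges y R) := by
  rw [Finset.disjoint_left]
  intro e he he'
  obtain ⟨a, -, rfl⟩ := mem_starEdges.1 he'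
  exact hy (mem_insideEdges.1 he y (by simp))

theorem card_cherry {i : Sym2 V} (hi : ¬ i.IsDiag) (y : V) : #(cherry y i) = 2 := by
  induction i with
  | _ u v =>
  rw [cherry_mk, card_pair]
  intro h
  have huv : u ≠ v := by simpa using hi
  rcases Sym2.eq_iff.1 h with h | h
  · exact huv h.2
  · exact huv (h.2.trans h.1)

theorem cherry_injective (y : V) : Function.Injective (cherry y : Sym2 V → Finset (Sym2 V)) := by
  have h : ∀ (i : Sym2 V) a, s(y, a) ∈ cherry y i ↔ a ∈ i := fun i a => by
    rw [mem_cherry]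
    constructor
    · rintro ⟨b, hb, hab⟩
      have : a = b := by
        rcases Sym2.eq_iff.1 hab with h | h
        · exact h.2
        · exact h.2.trans h.1
      exact this ▸ hb
    · exact fun ha => ⟨a, ha, rfl⟩
  intro i j hij
  refine Sym2.ext fun a => ?_
  rw [← h, hij, h]

theorem three_le_card_cherry_union {i j : Sym2 V} (hi : ¬ i.IsDiag) (hj : ¬ j.IsDiag)
    (hij : i ≠ j) (y : V) : 3 ≤ #(cherry y i ∪ cherry y j) := by
  by_contra hlt
  have h1 : cherry y i = cherry y i ∪ cherry y j :=
    eq_of_subset_of_card_le subset_union_left (by rw [card_cherry hi]; omega)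
  have h2 : cherry y j = cherry y i ∪ cherry y j :=
    eq_of_subset_of_card_le subset_union_right (by rw [card_cherry hj]; omega)
  exact hij (cherry_injective y (h1.trans h2.symm))

/-- The second Bonferroni inequality for weights in `[0, 1]`; the double sum runs over ordered
pairs, which only weakens it. -/
theorem prod_one_sub_le {κ : Type*} (H : Finset κ) {z : κ → ℝ} (h0 : ∀ i ∈ H, 0 ≤ z i)
    (h1 : ∀ i ∈ H, z i ≤ 1) :
    ∏ i ∈ H, (1 - z i) ≤ 1 - ∑ i ∈ H, z i + ∑ i ∈ H, ∑ j ∈ H.erase i, z i * z j := by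
  induction H using Finset.induction_on with
  | empty => simp
  | insert a H ha ih =>
    have h0' : ∀ i ∈ H, 0 ≤ z i := fun i hi => h0 i (by simp [hi])
    have h1' : ∀ i ∈ H, z i ≤ 1 := fun i hi => h1 i (by simp [hi])
    have ih' := ih h0' h1'
    have hlow := one_sub_sum_le_prod h0' h1'
    have hz0 := h0 a (by simp)
    rw [prod_insert ha, sum_insert ha, sum_insert ha, erase_insert ha]
    have hs : ∀ i ∈ H, ∑ j ∈ H.erase i, z i * z j ≤ ∑ j ∈ (insert a H).erase i, z i * z j := by
      intro i hi
      refine sum_le_sum_of_subset_of_nonneg (erase_subset_erase _ (subset_insert _ _)) ?_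
      intro j hj _
      exact mul_nonneg (h0' i hi) (h0 j (mem_of_mem_erase hj))
    have hs' := sum_le_sum hs
    rw [← mul_sum]
    nlinarith [mul_le_mul_of_nonneg_left hlow hz0]

variable {p : ℝ}

theorem cherry_subset_nonDiag {R : Finset V} {i : Sym2 V} (hi : i ∈ insideEdges R) {y : V}
    (hy : y ∉ R) : cherry y i ⊆ nonDiag V := fun e he => by
  obtain ⟨a, ha, rfl⟩ := mem_cherry.1 he
  rw [mem_nonDiag, Sym2.mk_isDiag_iff]
  rintro rfl
  exact hy (mem_insideEdges.1 hi _ ha)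

/-- The contribution of one outside vertex. Each cherry is present with probability `p²`, while two
different cherries at `y` use at least three edges, so second-order terms are at most `p³`. This
holds even if the pairs share vertices. -/
theorem bernExp_prod_cherry_le {κ : Type*} (hp0 : 0 ≤ p) (hp1 : p ≤ 1) {R : Finset V}
    (H : Finset κ) {P : κ → Sym2 V} (hP : Set.InjOn P H) (hPd : ∀ h ∈ H, ¬ (P h).IsDiag)
    (hPR : ∀ h ∈ H, P h ∈ insideEdges R) {s : κ → ℝ} (hs0 : ∀ h ∈ H, 0 ≤ s h)
    (hs1 : ∀ h ∈ H, s h ≤ 1) {y : V} (hy : y ∉ R) :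
    bernExp p (nonDiag V) (fun S => ∏ h ∈ H, if cherry y (P h) ⊆ S then s h else 1) ≤
      Real.exp (-(∑ h ∈ H, (1 - s h)) * p ^ 2 + #H ^ 2 * p ^ 3) := by
  set z : κ → Finset (Sym2 V) → ℝ := fun h S => (1 - s h) * if cherry y (P h) ⊆ S then 1 else 0
    with hz
  have hz0 : ∀ S, ∀ h ∈ H, 0 ≤ z h S := fun S h hh =>
    mul_nonneg (by linarith [hs1 h hh]) (by split_ifs <;> norm_num)
  have hz1 : ∀ S, ∀ h ∈ H, z h S ≤ 1 := fun S h hh =>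
    mul_le_one₀ (by linarith [hs0 h hh]) (by split_ifs <;> norm_num) (by split_ifs <;> norm_num)
  have hsub : ∀ h ∈ H, cherry y (P h) ⊆ nonDiag V := fun h hh => cherry_subset_nonDiag (hPR h hh) hy
  have hEz : ∀ h ∈ H, bernExp p (nonDiag V) (z h) = (1 - s h) * p ^ 2 := fun h hh => by
    rw [hz, bernExp_const_mul, bernExp_subset (hsub h hh), card_cherry (hPd h hh)]
  have hEzz : ∀ h ∈ H, ∀ k ∈ H.erase h, bernExp p (nonDiag V) (fun S => z h S * z k S) ≤ p ^ 3 := by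
    intro h hh k hk
    have hk' := mem_of_mem_erase hk
    have hne : P h ≠ P k := fun heq => (mem_erase.1 hk).1 (hP hk' hh heq.symm)
    calc _ ≤ bernExp p (nonDiag V)
          (fun S => if cherry y (P h) ∪ cherry y (P k) ⊆ S then 1 else 0) := by
          refine bernExp_mono hp0 hp1 fun S _ => ?_
          by_cases h1 : cherry y (P h) ⊆ S
          · by_cases h2 : cherry y (P k) ⊆ S
            · rw [if_pos (union_subset h1 h2)]
              exact mul_le_one₀ (hz1 S h hh) (hz0 S k hk') (hz1 S k hk')
            · have : z k S = 0 := by simp [hz, h2]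
              rw [this, mul_zero]
              split_ifs <;> norm_num
          · have : z h S = 0 := by simp [hz, h1]
            rw [this, zero_mul]
            split_ifs <;> norm_num
      _ = p ^ #(cherry y (P h) ∪ cherry y (P k)) :=
          bernExp_subset (union_subset (hsub h hh) (hsub k hk'))
      _ ≤ p ^ 3 := pow_le_pow_of_le_one hp0 hp1
          (three_le_card_cherry_union (hPd h hh) (hPd k hk') hne y)
  calc _ ≤ bernExp p (nonDiag V) (fun S => 1 - ∑ h ∈ H, z h S +
          ∑ h ∈ H, ∑ k ∈ H.erase h, z h S * z k S) := by
        refine bernExp_mono hp0 hp1 fun S _ => ?_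
        refine le_trans (le_of_eq ?_) (prod_one_sub_le H (hz0 S) (hz1 S))
        refine prod_congr rfl fun h _ => ?_
        simp only [hz]
        split_ifs <;> ring
    _ = 1 - ∑ h ∈ H, (1 - s h) * p ^ 2 +
          ∑ h ∈ H, ∑ k ∈ H.erase h, bernExp p (nonDiag V) (fun S => z h S * z k S) := by
        rw [bernExp_add, bernExp_sub, bernExp_const, bernExp_sum, bernExp_sum, sum_congr rfl hEz]
        simp only [bernExp_sum]
    _ ≤ 1 - ∑ h ∈ H, (1 - s h) * p ^ 2 + ∑ h ∈ H, ∑ k ∈ H.erase h, p ^ 3 := by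
        gcongr with h hh k hk
        exact hEzz h hh k hk
    _ ≤ 1 - ∑ h ∈ H, (1 - s h) * p ^ 2 + #H ^ 2 * p ^ 3 := by
        gcongr
        calc _ ≤ ∑ h ∈ H, #H * p ^ 3 := by
              refine sum_le_sum fun h _ => ?_
              rw [sum_const, nsmul_eq_mul]
              gcongr
              exact erase_subset _ _
          _ = _ := by rw [sum_const, nsmul_eq_mul]; ring
    _ ≤ _ := by
        rw [← sum_mul]
        have := Real.add_one_le_exp (-(∑ h ∈ H, (1 - s h)) * p ^ 2 + #H ^ 2 * p ^ 3)
        linarith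

theorem dependsOnFinset_prod_cherry {κ : Type*} {R : Finset V}
    (H : Finset κ) {P : κ → Sym2 V} (hPR : ∀ h ∈ H, P h ∈ insideEdges R) (s t : κ → ℝ) (y : V) :
    DependsOnFinset (fun S => ∏ h ∈ H, if cherry y (P h) ⊆ S then s h else t h)
      (starEdges y R) := by
  refine DependsOnFinset.prod (F := fun h S => if cherry y (P h) ⊆ S then s h else t h) H
    fun h hh S => ?_
  have := cherry_subset_starEdges (hPR h hh) y
  simp only [subset_inter_iff, this, and_true]

/-- The basic factorisation: the edges inside `R` and the stars from the vertices outside `R` are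
pairwise disjoint edge sets, hence independent. -/
theorem bernExp_inside_mul_prod {R : Finset V} {f : Finset (Sym2 V) → ℝ}
    (hf : DependsOnFinset f (insideEdges R)) {g : V → Finset (Sym2 V) → ℝ}
    (hg : ∀ y ∈ Rᶜ, DependsOnFinset (g y) (starEdges y R)) :
    bernExp p (nonDiag V) (fun S => f S * ∏ y ∈ Rᶜ, g y S) =
      bernExp p (nonDiag V) f * ∏ y ∈ Rᶜ, bernExp p (nonDiag V) (g y) := by
  rw [bernExp_mul (D' := (Rᶜ).biUnion fun y => starEdges y R) hf, bernExp_prod _ hg]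
  · exact pairwiseDisjoint_starEdges R
  · exact DependsOnFinset.prod (F := g) _ fun y hy =>
      (hg y hy).mono (subset_biUnion_of_mem (fun y => starEdges y R) hy)
  · rw [disjoint_biUnion_right]
    exact fun y hy => disjoint_insideEdges_starEdges (by simpa using hy)

theorem bernExp_subset_mul_prod_cherry_le {κ : Type*} (hp0 : 0 ≤ p) (hp1 : p ≤ 1) {R : Finset V}
    {F : Finset (Sym2 V)} (hFd : F ⊆ nonDiag V) (hFR : F ⊆ insideEdges R)
    (H : Finset κ) {P : κ → Sym2 V} (hP : Set.InjOn P H) (hPd : ∀ h ∈ H, ¬ (P h).IsDiag)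
    (hPR : ∀ h ∈ H, P h ∈ insideEdges R) {s : κ → ℝ} (hs0 : ∀ h ∈ H, 0 ≤ s h)
    (hs1 : ∀ h ∈ H, s h ≤ 1) :
    bernExp p (nonDiag V) (fun S => (if F ⊆ S then 1 else 0) *
        ∏ y ∈ Rᶜ, ∏ h ∈ H, if cherry y (P h) ⊆ S then s h else 1) ≤
      p ^ #F * Real.exp (-(∑ h ∈ H, (1 - s h)) * p ^ 2 + #H ^ 2 * p ^ 3) ^ #Rᶜ := by
  rw [bernExp_inside_mul_prod (R := R) (f := fun S => if F ⊆ S then 1 else 0)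
    (g := fun y S => ∏ h ∈ H, if cherry y (P h) ⊆ S then s h else 1), bernExp_subset hFd,
    ← prod_const (Real.exp _)]
  · refine mul_le_mul_of_nonneg_left ?_ (pow_nonneg hp0 _)
    refine prod_le_prod (fun y _ => ?_) fun y hy => ?_
    · refine bernExp_nonneg hp0 hp1 fun S _ => prod_nonneg fun h hh => ?_
      split_ifs
      · exact hs0 h hh
      · norm_num
    · exact bernExp_prod_cherry_le hp0 hp1 H hP hPd hPR hs0 hs1 (by simpa using hy)
  · intro S
    simp only [subset_inter_iff, hFR, and_true]
  · exact fun y _ => dependsOnFinset_prod_cherry H hPR s _ y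

end Exposure

end SimpleGraph

/-! ### First moment bound for patterns with few common neighbours -/

namespace SimpleGraph
open Finset
open scoped Classical

variable {V : Type*}

/-- The vertices of a set of pairs. -/
noncomputable def pairsVerts (H : Finset (Sym2 V)) : Finset V := H.biUnion fun i => i.toFinset

theorem card_pairsVerts_le (H : Finset (Sym2 V)) : #(pairsVerts H) ≤ 2 * #H := by
  rw [mul_comm]
  refine card_biUnion_le_card_mul _ _ _ fun i _ => ?_
  by_cases h : i.IsDiag
  · rw [Sym2.card_toFinset_of_isDiag _ h]; norm_num
  · rw [Sym2.card_toFinset_of_not_isDiag _ h]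

variable [Fintype V]

section Pattern
variable {ι : Type*}

/-- `G` contains distinct vertices indexed by `ι` such that the pairs in `F` are adjacent and each
pair `h` in `H` has at most `l h` common neighbours. -/
def ContainsPattern (G : SimpleGraph V) (F H : Finset (Sym2 ι)) (l : Sym2 ι → ℕ) : Prop :=
  ∃ φ : ι ↪ V, (∀ e ∈ F, e.map φ ∈ G.edgeSet) ∧ ∀ h ∈ H, #(G.pairNbrs (h.map φ)) ≤ l h

/-- Exponential Markov bound for the lower tail: if a pair has at most `l` common neighbours, then
`s` raised to their number is at least `s ^ l`. Only common neighbours outside `R` are counted,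
which keeps the inequality. -/
theorem indicator_pattern_le {F H : Finset (Sym2 ι)} {l : Sym2 ι → ℕ} {s : Sym2 ι → ℝ}
    (hs0 : ∀ h ∈ H, 0 < s h) (hs1 : ∀ h ∈ H, s h ≤ 1) (φ : ι ↪ V) (R : Finset V)
    {S : Finset (Sym2 V)} (hS : S ⊆ nonDiag V) :
    Set.indicator {G : SimpleGraph V | (∀ e ∈ F, e.map φ ∈ G.edgeSet) ∧
        ∀ h ∈ H, #(G.pairNbrs (h.map φ)) ≤ l h} 1 (fromEdgeSet (S : Set (Sym2 V))) ≤
      (∏ h ∈ H, (s h ^ l h)⁻¹) * ((if F.image (Sym2.map φ) ⊆ S then 1 else 0) *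
        ∏ y ∈ Rᶜ, ∏ h ∈ H, if cherry y (h.map φ) ⊆ S then s h else 1) := by
  have hnn : 0 ≤ (∏ h ∈ H, (s h ^ l h)⁻¹) * ((if F.image (Sym2.map φ) ⊆ S then 1 else 0) *
        ∏ y ∈ Rᶜ, ∏ h ∈ H, if cherry y (h.map φ) ⊆ S then s h else 1) := by
    refine mul_nonneg (prod_nonneg fun h hh => ?_) (mul_nonneg ?_
      (prod_nonneg fun y _ => prod_nonneg fun h hh => ?_))
    · have := hs0 h hh; positivity
    · split_ifs <;> norm_num
    · split_ifs
      · exact (hs0 h hh).le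
      · norm_num
  rw [Set.indicator_apply]
  by_cases hmem : fromEdgeSet (S : Set (Sym2 V)) ∈ {G : SimpleGraph V |
      (∀ e ∈ F, e.map φ ∈ G.edgeSet) ∧ ∀ h ∈ H, #(G.pairNbrs (h.map φ)) ≤ l h}
  swap
  · rwa [if_neg hmem]
  rw [if_pos hmem]
  obtain ⟨hF, hH⟩ := hmem
  have hFS : F.image (Sym2.map φ) ⊆ S := by
    intro e he
    obtain ⟨f, hf, rfl⟩ := mem_image.1 he
    exact (mem_edgeSet_fromEdgeSet hS).1 (hF f hf)
  rw [if_pos hFS, one_mul, prod_comm, ← prod_mul_distrib, Pi.one_apply]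
  refine one_le_prod fun h hh => ?_
  have h0 := hs0 h hh
  have : s h ^ l h ≤ ∏ y ∈ Rᶜ, if cherry y (h.map φ) ⊆ S then s h else 1 := by
    rw [prod_ite, prod_const, prod_const_one, mul_one]
    refine pow_le_pow_of_le_one h0.le (hs1 h hh) (le_trans (card_le_card ?_) (hH h hh))
    intro y hy
    rw [mem_pairNbrs_fromEdgeSet hS]
    exact (mem_filter.1 hy).2
  rw [inv_mul_eq_div, one_le_div (by positivity)]
  exact this

/-- Union bound over the embeddings of `ι`. For each, `R` is its image, which leaves `Fintype.card V
- Fintype.card ι` independent outside vertices. -/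
theorem binomialRandom_containsPattern_le [Fintype ι] (p : unitInterval) {F H : Finset (Sym2 ι)}
    (hF : ∀ e ∈ F, ¬ e.IsDiag) (hH : ∀ h ∈ H, ¬ h.IsDiag) (l : Sym2 ι → ℕ) {s : Sym2 ι → ℝ}
    (hs0 : ∀ h ∈ H, 0 < s h) (hs1 : ∀ h ∈ H, s h ≤ 1) :
    (binomialRandom V p).real {G | G.ContainsPattern F H l} ≤
      (Fintype.card V : ℝ) ^ Fintype.card ι * ((∏ h ∈ H, (s h ^ l h)⁻¹) * ((p : ℝ) ^ #F *
        Real.exp (-(∑ h ∈ H, (1 - s h)) * (p : ℝ) ^ 2 + #H ^ 2 * (p : ℝ) ^ 3) ^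
          (Fintype.card V - Fintype.card ι))) := by
  have hp0 : (0 : ℝ) ≤ p := p.2.1
  have hp1 : (p : ℝ) ≤ 1 := p.2.2
  have hset : {G : SimpleGraph V | G.ContainsPattern F H l} ⊆
      ⋃ φ ∈ (univ : Finset (ι ↪ V)), {G : SimpleGraph V | (∀ e ∈ F, e.map φ ∈ G.edgeSet) ∧
        ∀ h ∈ H, #(G.pairNbrs (h.map φ)) ≤ l h} := by
    rintro G ⟨φ, hφ⟩
    simp only [mem_univ, Set.iUnion_true, Set.mem_iUnion]
    exact ⟨φ, hφ⟩
  have hcard : (Fintype.card (ι ↪ V) : ℝ) ≤ (Fintype.card V : ℝ) ^ Fintype.card ι := by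
    rw [Fintype.card_embedding_eq]
    exact_mod_cast Nat.descFactorial_le_pow _ _
  refine (MeasureTheory.measureReal_mono hset (MeasureTheory.measure_ne_top _ _)).trans
    ((MeasureTheory.measureReal_biUnion_finset_le _ _).trans ?_)
  refine (sum_le_card_nsmul _ _ ((∏ h ∈ H, (s h ^ l h)⁻¹) * ((p : ℝ) ^ #F *
        Real.exp (-(∑ h ∈ H, (1 - s h)) * (p : ℝ) ^ 2 + #H ^ 2 * (p : ℝ) ^ 3) ^
          (Fintype.card V - Fintype.card ι))) fun φ _ => ?_).trans ?_
  · have hnd : ∀ e : Sym2 ι, ¬ e.IsDiag → ¬ (e.map φ).IsDiag := fun e he => by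
      rwa [Sym2.isDiag_map φ.injective]
    have hin : ∀ e : Sym2 ι, e.map φ ∈ insideEdges (univ.map φ) := fun e => by
      rw [mem_insideEdges]
      intro a ha
      obtain ⟨b, -, rfl⟩ := Sym2.mem_map.1 ha
      simp
    rw [binomialRandom_real_eq_bernExp]
    refine (bernExp_mono hp0 hp1 fun S hS =>
      indicator_pattern_le hs0 hs1 φ (univ.map φ) hS).trans ?_
    rw [bernExp_const_mul]
    refine mul_le_mul_of_nonneg_left ?_ (prod_nonneg fun h hh => by have := hs0 h hh; positivity)
    refine (bernExp_subset_mul_prod_cherry_le hp0 hp1 (R := univ.map φ)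
      (F := F.image (Sym2.map φ)) ?_ ?_ H (P := Sym2.map φ)
      (Sym2.map.injective φ.injective).injOn (fun h hh => hnd h (hH h hh)) (fun h _ => hin h)
      (fun h hh => (hs0 h hh).le) hs1).trans ?_
    · intro e he
      obtain ⟨f, hf, rfl⟩ := mem_image.1 he
      exact mem_nonDiag.2 (hnd f (hF f hf))
    · intro e he
      obtain ⟨f, hf, rfl⟩ := mem_image.1 he
      exact hin f
    · rw [card_image_of_injective _ (Sym2.map.injective φ.injective), card_compl, card_map,
        card_univ]
  · rw [nsmul_eq_mul, card_univ]
    refine mul_le_mul_of_nonneg_right hcard (mul_nonneg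
      (prod_nonneg fun h hh => by have := hs0 h hh; positivity) (by positivity))

end Pattern

/-! ### Probability that given pairs are all bad -/

section BadPairs
variable {p : ℝ}

theorem subset_insideEdges_pairsVerts (H : Finset (Sym2 V)) : H ⊆ insideEdges (pairsVerts H) :=
  fun i hi => mem_insideEdges.2 fun a ha => mem_biUnion.2 ⟨i, hi, by simpa using ha⟩

theorem card_insideEdges_le (R : Finset V) : #(insideEdges R) ≤ #R ^ 2 := by
  have : insideEdges R ⊆ (R ×ˢ R).image fun x => s(x.1, x.2) := by
    intro e he
    induction e with
    | _ u v =>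
    rw [mem_insideEdges] at he
    exact mem_image.2 ⟨(u, v), by simp [he u (by simp), he v (by simp)], rfl⟩
  refine (card_le_card this).trans (card_image_le.trans ?_)
  rw [card_product, sq]

theorem isBad_fromEdgeSet {S : Finset (Sym2 V)} (hS : S ⊆ nonDiag V) {i : Sym2 V}
    (hi : ¬ i.IsDiag) : (fromEdgeSet (S : Set (Sym2 V))).IsBad i ↔
      i ∉ S ∧ ∀ y, ¬ cherry y i ⊆ S := by
  simp [IsBad, hi, mem_edgeSet_fromEdgeSet hS, -edgeSet_fromEdgeSet,
    Finset.eq_empty_iff_forall_notMem, mem_pairNbrs_fromEdgeSet hS]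

/-- Non-adjacency and common neighbours inside the vertex set of `H` are ignored; this is the cherry
bound with all weights `s = 0`. The condition `#H * p ≤ 1` makes the base at most 1, so the exponent
may be lowered from the number of outside vertices. -/
theorem bernExp_forall_isBad_le (hp0 : 0 ≤ p) (hp1 : p ≤ 1) {H : Finset (Sym2 V)}
    (hH : H ⊆ nonDiag V) (hp : #H * p ≤ 1) :
    bernExp p (nonDiag V) (fun S => if ∀ i ∈ H, (fromEdgeSet (S : Set (Sym2 V))).IsBad i
      then 1 else 0) ≤
      Real.exp (-#H * p ^ 2 + #H ^ 2 * p ^ 3) ^ (Fintype.card V - 2 * #H) := by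
  calc _ ≤ bernExp p (nonDiag V) (fun S => (if ∅ ⊆ S then 1 else 0) *
        ∏ y ∈ (pairsVerts H)ᶜ, ∏ h ∈ H, if cherry y h ⊆ S then 0 else 1) := by
        refine bernExp_mono hp0 hp1 fun S hS => ?_
        rw [if_pos (empty_subset S), one_mul]
        split_ifs with h
        · refine one_le_prod fun y _ => one_le_prod fun i hi => ?_
          have := ((isBad_fromEdgeSet hS (mem_nonDiag.1 (hH hi))).1 (h i hi)).2 y
          rw [if_neg this]
        · exact prod_nonneg fun y _ => prod_nonneg fun i _ => by split_ifs <;> norm_num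
    _ ≤ p ^ #(∅ : Finset (Sym2 V)) *
        Real.exp (-(∑ h ∈ H, (1 - 0)) * p ^ 2 + #H ^ 2 * p ^ 3) ^ #(pairsVerts H)ᶜ :=
        bernExp_subset_mul_prod_cherry_le hp0 hp1 (empty_subset _) (empty_subset _) H
          (P := fun h => h) (s := fun _ => 0) (Set.injOn_id _) (fun h hh => mem_nonDiag.1 (hH hh))
          (fun h hh => subset_insideEdges_pairsVerts H hh) (by simp) (by simp)
    _ = Real.exp (-#H * p ^ 2 + #H ^ 2 * p ^ 3) ^ #(pairsVerts H)ᶜ := by simp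
    _ ≤ _ := by
        refine pow_le_pow_of_le_one (Real.exp_pos _).le (Real.exp_le_one_iff.2 ?_) ?_
        · have : (#H : ℝ) * p ^ 2 * (#H * p) ≤ #H * p ^ 2 * 1 := by gcongr
          nlinarith
        · rw [card_compl]
          have := card_pairsVerts_le H
          omega

/-- It suffices that no edge at all lies inside the vertex set of `H`, and that each outside vertex
sees no cherry of `H`, by a union bound over `H`. These requirements are independent. -/
theorem le_bernExp_forall_isBad (hp0 : 0 ≤ p) (hp1 : p ≤ 1) {H : Finset (Sym2 V)}
    (hH : H ⊆ nonDiag V) (hp : #H * p ^ 2 ≤ 1) :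
    (1 - p) ^ (2 * #H) ^ 2 * (1 - #H * p ^ 2) ^ Fintype.card V ≤
      bernExp p (nonDiag V) (fun S => if ∀ i ∈ H, (fromEdgeSet (S : Set (Sym2 V))).IsBad i
        then 1 else 0) := by
  set R := pairsVerts H with hR
  have hHR := subset_insideEdges_pairsVerts H
  set D := insideEdges R ∩ nonDiag V with hD
  have hDc : #D ≤ (2 * #H) ^ 2 := (card_le_card inter_subset_left).trans
    ((card_insideEdges_le R).trans (Nat.pow_le_pow_left (card_pairsVerts_le H) 2))
  have hg : ∀ y ∈ Rᶜ, 1 - #H * p ^ 2 ≤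
      bernExp p (nonDiag V) (fun S => ∏ h ∈ H, if cherry y h ⊆ S then 0 else 1) := by
    intro y hy
    have hy' : y ∉ R := by simpa using hy
    have h1 : bernExp p (nonDiag V) (fun S => 1 - ∑ h ∈ H, if cherry y h ⊆ S then (1 : ℝ) else 0) =
        1 - #H * p ^ 2 := by
      rw [bernExp_sub, bernExp_const, bernExp_sum, sum_congr rfl (g := fun _ => p ^ 2), sum_const,
        nsmul_eq_mul]
      intro h hh
      rw [bernExp_subset (cherry_subset_nonDiag (hHR hh) hy'), card_cherry (mem_nonDiag.1 (hH hh))]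
    rw [← h1]
    refine bernExp_mono hp0 hp1 fun S _ => ?_
    refine (one_sub_sum_le_prod (fun h _ => ?_) fun h _ => ?_).trans (le_of_eq ?_)
    · split_ifs <;> norm_num
    · split_ifs <;> norm_num
    · exact prod_congr rfl fun h _ => by split_ifs <;> norm_num
  calc (1 - p) ^ (2 * #H) ^ 2 * (1 - #H * p ^ 2) ^ Fintype.card V
      ≤ (1 - p) ^ #D * (1 - #H * p ^ 2) ^ #Rᶜ := by
        refine mul_le_mul ?_ ?_ ?_ ?_
        · exact pow_le_pow_of_le_one (by linarith) (by linarith) hDc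
        · exact pow_le_pow_of_le_one (by linarith)
            (by linarith [mul_nonneg (Nat.cast_nonneg (α := ℝ) #H) (sq_nonneg p)]) (card_le_univ _)
        · exact pow_nonneg (by linarith) _
        · exact pow_nonneg (by linarith) _
    _ ≤ bernExp p (nonDiag V) (fun S => if Disjoint D S then 1 else 0) *
        ∏ y ∈ Rᶜ, bernExp p (nonDiag V)
          (fun S => ∏ h ∈ H, if cherry y h ⊆ S then 0 else 1) := by
        rw [bernExp_disjoint inter_subset_right, ← prod_const (1 - #H * p ^ 2)]
        refine mul_le_mul_of_nonneg_left (prod_le_prod (fun _ _ => by linarith) hg) ?_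
        exact pow_nonneg (by linarith) _
    _ = bernExp p (nonDiag V) (fun S => (if Disjoint D S then 1 else 0) *
          ∏ y ∈ Rᶜ, ∏ h ∈ H, if cherry y h ⊆ S then 0 else 1) := by
        refine (bernExp_inside_mul_prod (R := R) (f := fun S => if Disjoint D S then 1 else 0)
          (g := fun y S => ∏ h ∈ H, if cherry y h ⊆ S then 0 else 1) ?_ ?_).symm
        · intro S
          have : Disjoint D S ↔ Disjoint D (S ∩ insideEdges R) := by
            simp only [Finset.disjoint_left, hD, mem_inter]
            exact forall₂_congr fun a ha => by tauto
          simp only [this]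
        · exact fun y _ => dependsOnFinset_prod_cherry H (P := fun h => h) (fun h hh => hHR hh)
            (fun _ => 0) (fun _ => 1) y
    _ ≤ _ := by
        refine bernExp_mono hp0 hp1 fun S hS => ?_
        have hle1 : ∀ y, ∏ h ∈ H, (if cherry y h ⊆ S then (0 : ℝ) else 1) ≤ 1 := fun y =>
          prod_le_one (fun _ _ => by split_ifs <;> norm_num) fun _ _ => by split_ifs <;> norm_num
        have hnn : ∀ y, 0 ≤ ∏ h ∈ H, (if cherry y h ⊆ S then (0 : ℝ) else 1) := fun y =>
          prod_nonneg fun _ _ => by split_ifs <;> norm_num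
        by_cases hall : ∀ i ∈ H, (fromEdgeSet (S : Set (Sym2 V))).IsBad i
        · rw [if_pos hall]
          refine mul_le_one₀ (by split_ifs <;> norm_num) (prod_nonneg fun y _ => hnn y)
            (prod_le_one (fun y _ => hnn y) fun y _ => hle1 y)
        · rw [if_neg hall]
          refine le_of_eq ?_
          push Not at hall
          obtain ⟨i, hi, hib⟩ := hall
          rw [isBad_fromEdgeSet hS (mem_nonDiag.1 (hH hi))] at hib
          by_cases hdis : Disjoint D S
          swap
          · rw [if_neg hdis, zero_mul]
          have hiS : i ∉ S := fun h => Finset.disjoint_left.1 hdis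
            (mem_inter.2 ⟨hHR hi, hH hi⟩) h
          have : ∃ y, cherry y i ⊆ S := by
            by_contra hcon
            push Not at hcon
            exact hib ⟨hiS, hcon⟩
          obtain ⟨y, hy⟩ := this
          -- A common neighbour inside `R` would give an edge inside `R`, which `hdis` excludes.
          have hyR : y ∈ Rᶜ := by
            rw [mem_compl]
            intro hyR
            have ha := Sym2.out_fst_mem i
            have hmem : s(y, (Quot.out i).1) ∈ cherry y i := mem_cherry.2 ⟨_, ha, rfl⟩
            refine Finset.disjoint_left.1 hdis (mem_inter.2 ⟨?_, hS (hy hmem)⟩) (hy hmem)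
            rw [mem_insideEdges]
            intro b hb
            rcases Sym2.mem_iff.1 hb with rfl | rfl
            · exact hyR
            · exact mem_insideEdges.1 (hHR hi) _ ha
          rw [prod_eq_zero hyR, mul_zero]
          exact prod_eq_zero hi (if_pos hy)

end BadPairs

/-! ### Upper bound on the degrees -/

section Degree
variable {p : ℝ}

/-- Markov's inequality for `2 ^ degree`, whose mean is at most `(1 + p) ^ n ≤ exp (n p)`. -/
theorem binomialRandom_exists_degree_gt_le (p : unitInterval) (d : ℕ) :
    (binomialRandom V p).real {G | ∃ v, d < #{w | G.Adj v w}} ≤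
      Fintype.card V * (Real.exp (Fintype.card V * p) / 2 ^ d) := by
  have hp0 : (0 : ℝ) ≤ p := p.2.1
  have hp1 : (p : ℝ) ≤ 1 := p.2.2
  have hset : {G : SimpleGraph V | ∃ v, d < #{w | G.Adj v w}} ⊆
      ⋃ v ∈ (univ : Finset V), {G : SimpleGraph V | d < #{w | G.Adj v w}} := by
    rintro G ⟨v, hv⟩
    simp only [mem_univ, Set.iUnion_true, Set.mem_iUnion]
    exact ⟨v, hv⟩
  refine (MeasureTheory.measureReal_mono hset (MeasureTheory.measure_ne_top _ _)).trans
    ((MeasureTheory.measureReal_biUnion_finset_le _ _).trans ?_)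
  refine (sum_le_card_nsmul _ _ (Real.exp (Fintype.card V * p) / 2 ^ d) fun v _ => ?_).trans ?_
  swap
  · rw [nsmul_eq_mul, card_univ]
  rw [binomialRandom_real_eq_bernExp]
  have hmean : ∀ w ∈ univ.erase v, bernExp (p : ℝ) (nonDiag V)
      (fun S => if s(v, w) ∈ S then 2 else 1) = 1 + p := by
    intro w hw
    have h1 : (fun S : Finset (Sym2 V) => if s(v, w) ∈ S then (2 : ℝ) else 1) =
        fun S => 1 + if {s(v, w)} ⊆ S then 1 else 0 := by
      ext S
      by_cases h : s(v, w) ∈ S <;> simp [h]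
      norm_num
    have hne : v ≠ w := (mem_erase.1 hw).1.symm
    rw [h1, bernExp_add, bernExp_const, bernExp_subset]
    · simp
    · simpa [mem_nonDiag] using hne
  have hprod : bernExp (p : ℝ) (nonDiag V)
      (fun S => ∏ w ∈ univ.erase v, if s(v, w) ∈ S then 2 else 1) ≤
      Real.exp (Fintype.card V * p) := by
    rw [bernExp_prod (univ.erase v) (F := fun w S => if s(v, w) ∈ S then (2 : ℝ) else 1)
      (D := fun w => {s(v, w)}), prod_congr rfl hmean, prod_const]
    · calc (1 + (p : ℝ)) ^ #(univ.erase v) ≤ (1 + p) ^ Fintype.card V :=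
            pow_le_pow_right₀ (by linarith) (card_le_univ _)
        _ ≤ Real.exp p ^ Fintype.card V := by
            gcongr
            linarith [Real.add_one_le_exp (p : ℝ)]
        _ = _ := by rw [← Real.exp_nat_mul]
    · intro w _ S
      simp
    · intro w hw w' hw' hne
      simp only [Function.onFun, Finset.disjoint_singleton]
      intro h
      rcases Sym2.eq_iff.1 h with h | h
      · exact hne h.2
      · exact hne (h.2.trans h.1)
  have hle : bernExp (p : ℝ) (nonDiag V) (fun S =>
      Set.indicator {G : SimpleGraph V | d < #{w | G.Adj v w}} 1
        (fromEdgeSet (S : Set (Sym2 V)))) ≤ bernExp (p : ℝ) (nonDiag V)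
      (fun S => (2 ^ d)⁻¹ * ∏ w ∈ univ.erase v, if s(v, w) ∈ S then 2 else 1) := by
    refine bernExp_mono hp0 hp1 fun S hS => ?_
    rw [Set.indicator_apply]
    split_ifs with hmem
    · rw [prod_ite, prod_const, prod_const_one, mul_one, inv_mul_eq_div, Pi.one_apply,
        one_le_div (by positivity)]
      refine pow_le_pow_right₀ one_le_two (le_of_lt (lt_of_lt_of_le hmem (card_le_card ?_)))
      intro w hw
      simp only [mem_filter, mem_univ, true_and, adj_fromEdgeSet hS] at hw
      rw [mem_filter, mem_erase]
      refine ⟨⟨?_, mem_univ _⟩, hw⟩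
      rintro rfl
      exact mem_nonDiag.1 (hS hw) rfl
    · exact mul_nonneg (by positivity) (prod_nonneg fun _ _ => by split_ifs <;> norm_num)
  refine hle.trans ?_
  rw [bernExp_const_mul, inv_mul_eq_div]
  gcongr

end Degree

end SimpleGraph

/-! ### Greedy extraction of disjoint configurations -/

section Extraction
open Finset
open scoped Classical

/-- Turns many points `w` with partners `f w` into `m` pairs `(w, f w)` that are vertex-disjoint, as
patterns with distinct vertices require. -/
theorem exists_subset_injOn_disjoint_image {α : Type*} (f : α → α) (t : ℕ) (m : ℕ) (W : Finset α)
    (hne : ∀ w ∈ W, f w ≠ w) (hfib : ∀ x, #{w ∈ W | f w = x} ≤ t) (hW : m * (2 * t + 2) ≤ #W) :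
    ∃ W' ⊆ W, #W' = m ∧ Set.InjOn f W' ∧ ∀ a ∈ W', ∀ b ∈ W', f a ≠ b := by
  induction m generalizing W with
  | zero => exact ⟨∅, by simp, by simp, by simp, by simp⟩
  | succ m ih =>
    have hpos : 0 < #W := by
      refine lt_of_lt_of_le ?_ hW
      positivity
    obtain ⟨w, hw⟩ := card_pos.1 hpos
    -- Everything in conflict with the choice of `w`: the two points and the fibres over `f w` and
    -- `w`, at most `2t + 2` elements.
    set D : Finset α := ({w, f w} ∪ {a ∈ W | f a = f w}) ∪ {a ∈ W | f a = w} with hD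
    have hDc : #D ≤ 2 * t + 2 := by
      rw [hD]
      have h1 := card_union_le ({w, f w} ∪ {a ∈ W | f a = f w}) {a ∈ W | f a = w}
      have h2 := card_union_le {w, f w} {a ∈ W | f a = f w}
      have h3 := card_le_two (a := w) (b := f w)
      have h4 := hfib (f w)
      have h5 := hfib w
      omega
    obtain ⟨W', hW', hc, hinj, hdis⟩ := ih (W \ D) (fun a ha => hne a (mem_sdiff.1 ha).1)
      (fun x => (card_le_card (filter_subset_filter _ sdiff_subset)).trans (hfib x)) (by
        have := le_card_sdiff D W
        rw [add_mul, one_mul] at hW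
        omega)
    have hout : ∀ a ∈ W', a ∈ W ∧ a ≠ w ∧ a ≠ f w ∧ f a ≠ f w ∧ f a ≠ w := by
      intro a ha
      have h := mem_sdiff.1 (hW' ha)
      simp only [hD, mem_union, mem_insert, mem_singleton, mem_filter] at h
      tauto
    have hwW' : w ∉ W' := fun h => (hout w h).2.1 rfl
    refine ⟨insert w W', insert_subset hw fun a ha => (hout a ha).1, ?_, ?_, ?_⟩
    · rw [card_insert_of_notMem hwW', hc]
    · rw [coe_insert, Set.injOn_insert (by simpa using hwW')]
      refine ⟨hinj, ?_⟩
      rintro ⟨a, ha, haw⟩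
      exact (hout a ha).2.2.2.1 haw
    · intro a ha b hb
      rcases mem_insert.1 ha with rfl | ha' <;> rcases mem_insert.1 hb with rfl | hb'
      · exact hne _ hw
      · exact (hout b hb').2.2.1.symm
      · exact (hout a ha').2.2.2.2
      · exact hdis a ha' b hb'

variable {V : Type*} {m : ℕ} {u v : V}

theorem exists_injective_fin_of_le_card {W : Finset V} (h : m ≤ #W) :
    ∃ g : Fin m → V, Function.Injective g ∧ ∀ i, g i ∈ W := by
  obtain ⟨W', hW', hc⟩ := exists_subset_card_eq h
  let e := (W'.equivFinOfCardEq hc).symm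
  exact ⟨fun i => e i, fun i j hij => e.injective (Subtype.ext hij), fun i => hW' (e i).2⟩

theorem injective_triple {x : V} (huv : u ≠ v) (hux : u ≠ x) (hvx : v ≠ x) {g : Fin m → V}
    (hg : Function.Injective g) (hgu : ∀ i, g i ≠ u) (hgv : ∀ i, g i ≠ v) (hgx : ∀ i, g i ≠ x) :
    Function.Injective (Sum.elim ![u, v, x] g) := by
  refine Function.Injective.sumElim ?_ hg ?_
  · intro a b
    fin_cases a <;> fin_cases b <;> simp [huv, huv.symm, hux, hux.symm, hvx, hvx.symm]
  · intro a b
    fin_cases a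
    · exact (hgu b).symm
    · exact (hgv b).symm
    · exact (hgx b).symm

theorem injective_fan {g g' : Fin m → V} (huv : u ≠ v) (hg : Function.Injective g)
    (hg' : Function.Injective g') (hgg' : ∀ i j, g' i ≠ g j) (hgu : ∀ i, g i ≠ u)
    (hgv : ∀ i, g i ≠ v) (hgu' : ∀ i, g' i ≠ u) (hgv' : ∀ i, g' i ≠ v) :
    Function.Injective (Sum.elim ![u, v] (Sum.elim g g')) := by
  refine Function.Injective.sumElim ?_ (Function.Injective.sumElim hg hg' ?_) ?_
  · intro a b
    fin_cases a <;> fin_cases b <;> simp [huv, huv.symm]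
  · exact fun i j => (hgg' j i).symm
  · rintro a (b | b) <;> fin_cases a
    · exact (hgu b).symm
    · exact (hgv b).symm
    · exact (hgu' b).symm
    · exact (hgv' b).symm

theorem exists_fan_of_le_card {W : Finset V} {f : V → V} {t : ℕ} (hne : ∀ w ∈ W, f w ≠ w)
    (hfib : ∀ x, #{w ∈ W | f w = x} ≤ t) (hW : m * (2 * t + 2) ≤ #W) :
    ∃ g : Fin m → V, Function.Injective g ∧ Function.Injective (f ∘ g) ∧
      (∀ i j, f (g i) ≠ g j) ∧ ∀ i, g i ∈ W := by
  obtain ⟨W', hW', hc, hinj, hdis⟩ := exists_subset_injOn_disjoint_image f t m W hne hfib hW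
  obtain ⟨g, hg, hgW⟩ := exists_injective_fin_of_le_card hc.ge
  exact ⟨g, hg, fun i j hij => hg (hinj (hgW i) (hgW j) hij), fun i j => hdis _ (hgW i) _ (hgW j),
    fun i => hW' (hgW i)⟩

end Extraction

/-! ### Pattern-free graphs have enough safe common neighbours -/

namespace SimpleGraph
open Finset
open scoped Classical

variable {V : Type*} [Fintype V] {G : SimpleGraph V} {L M : ℕ} {u v y : V}

/-- The shared edge joins `y` to `u` or to `v`, and in the two-path of the other light pair either
of its ends may be the middle vertex. Each of the four cases yields a third vertex `x` and a
forbidden pattern. -/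
theorem IsDangerous.cases (h : G.IsDangerous L s(u, v) y) :
    ((∃ x, x ≠ v ∧ G.Adj y x ∧ G.IsLight L s(u, x)) ∨ ∃ x, G.Adj u x ∧ G.IsLight L s(y, x)) ∨
    ((∃ x, x ≠ u ∧ G.Adj y x ∧ G.IsLight L s(v, x)) ∨ ∃ x, G.Adj v x ∧ G.IsLight L s(y, x)) := by
  obtain ⟨j, hj, hne, w, hw, hd⟩ := h
  rw [not_disjoint_iff] at hd
  obtain ⟨e, he, he'⟩ := hd
  obtain ⟨b, ⟨x, rfl⟩, hbe⟩ := mem_cherry.1 he'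
  have hwx := (mem_pairNbrs_mk.1 hw).2
  rcases mem_cherry_mk.1 he with rfl | rfl
  · left
    rcases Sym2.eq_iff.1 hbe with ⟨rfl, rfl⟩ | ⟨rfl, rfl⟩
    · exact Or.inl ⟨x, fun h => hne (by rw [h]), hwx, hj⟩
    · exact Or.inr ⟨x, hwx, hj⟩
  · right
    rcases Sym2.eq_iff.1 hbe with ⟨rfl, rfl⟩ | ⟨rfl, rfl⟩
    · exact Or.inl ⟨x, fun h => hne (by rw [h, Sym2.eq_swap]), hwx, hj⟩
    · exact Or.inr ⟨x, hwx, hj⟩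

/-- The allowance for common neighbours in a pattern: `L` for the pairs in `Hl`, else `M`. -/
noncomputable def allowance {ι : Type*} (Hl : Finset (Sym2 ι)) (L M : ℕ) (h : Sym2 ι) : ℕ :=
  if h ∈ Hl then L else M

/-- `G` contains a pattern with edges `F`, in which the pairs from `Hl` have at most `L` and the
pairs from `Hc` have at most `M` common neighbours. -/
def ContainsPoorPattern {ι : Type*} (G : SimpleGraph V) (F Hl Hc : Finset (Sym2 ι)) (L M : ℕ) :
    Prop :=
  G.ContainsPattern F (Hl ∪ Hc) (allowance Hl L M)

theorem containsPoorPattern_of {ι : Type*} {F Hl Hc : Finset (Sym2 ι)} (hd : Disjoint Hl Hc)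
    (φ : ι → V) (hφ : Function.Injective φ) (hF : ∀ e ∈ F, e.map φ ∈ G.edgeSet)
    (hHl : ∀ h ∈ Hl, #(G.pairNbrs (h.map φ)) ≤ L) (hHc : ∀ h ∈ Hc, #(G.pairNbrs (h.map φ)) ≤ M) :
    G.ContainsPoorPattern F Hl Hc L M := by
  refine ⟨⟨φ, hφ⟩, hF, fun h hh => ?_⟩
  rcases mem_union.1 hh with h1 | h1
  · rw [allowance, if_pos h1]
    exact hHl h h1
  · rw [allowance, if_neg fun h2 => Finset.disjoint_left.1 hd h2 h1]
    exact hHc h h1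

/-- The index of the first two vertices, and of the two families, of a pattern. -/
abbrev FanIndex (m : ℕ) := Fin 2 ⊕ (Fin m ⊕ Fin m)

/-- The edges from the first two vertices to the first family, and between the two families. -/
def fanEdges₁ (m : ℕ) : Fin 3 × Fin m → Sym2 (FanIndex m) := fun k =>
  ![s(.inl 0, .inr (.inl k.2)), s(.inl 1, .inr (.inl k.2)), s(.inr (.inl k.2), .inr (.inr k.2))] k.1

/-- The edges from the first two vertices to the first family, and from the first vertex to the
second family. -/
def fanEdges₂ (m : ℕ) : Fin 3 × Fin m → Sym2 (FanIndex m) := fun k =>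
  ![s(.inl 0, .inr (.inl k.2)), s(.inl 1, .inr (.inl k.2)), s(.inl 0, .inr (.inr k.2))] k.1

/-- The pairs of the first vertex and the second family. -/
def fanPairs₁ (m : ℕ) : Fin m → Sym2 (FanIndex m) := fun i => s(.inl 0, .inr (.inr i))

/-- The pairs of corresponding elements of the two families. -/
def fanPairs₂ (m : ℕ) : Fin m → Sym2 (FanIndex m) := fun i => s(.inr (.inl i), .inr (.inr i))

/-- The edges from the first `k` of three vertices to a family. -/
def tripleEdges (k m : ℕ) (hk : k ≤ 3) : Fin k × Fin m → Sym2 (Fin 3 ⊕ Fin m) := fun j =>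
  s(.inl (j.1.castLE hk), .inr j.2)

/-- The pairs of the last of three vertices and a family. -/
def triplePairs (m : ℕ) : Fin m → Sym2 (Fin 3 ⊕ Fin m) := fun i => s(.inl 2, .inr i)

theorem fanEdges₁_injective (m : ℕ) : Function.Injective (fanEdges₁ m) := by
  rintro ⟨k, i⟩ ⟨k', j⟩ h
  fin_cases k <;> fin_cases k' <;> simp [fanEdges₁] at h ⊢ <;> simp_all

theorem fanEdges₂_injective (m : ℕ) : Function.Injective (fanEdges₂ m) := by
  rintro ⟨k, i⟩ ⟨k', j⟩ h
  fin_cases k <;> fin_cases k' <;> simp [fanEdges₂] at h ⊢ <;> simp_all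

theorem fanPairs₁_injective (m : ℕ) : Function.Injective (fanPairs₁ m) := by
  intro i j h
  simpa [fanPairs₁] using h

theorem fanPairs₂_injective (m : ℕ) : Function.Injective (fanPairs₂ m) := by
  intro i j h
  simpa [fanPairs₂] using h

theorem tripleEdges_injective (k m : ℕ) (hk : k ≤ 3) : Function.Injective (tripleEdges k m hk) := by
  rintro ⟨k, i⟩ ⟨k', j⟩ h
  simpa [tripleEdges] using h

theorem triplePairs_injective (m : ℕ) : Function.Injective (triplePairs m) := by
  intro i j h
  simpa [triplePairs] using h

/-- The absence of all patterns that would interfere with colouring the light pairs greedily. -/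
structure PatternFree (G : SimpleGraph V) (L M m : ℕ) : Prop where
  cherry₁ : ¬ G.ContainsPoorPattern (ι := Fin 4) {s(0, 2), s(1, 2), s(2, 3)} {s(0, 3)} {s(0, 1)} L M
  cherry₂ : ¬ G.ContainsPoorPattern (ι := Fin 4) {s(0, 2), s(1, 2), s(0, 3)} {s(2, 3)} {s(0, 1)} L M
  triple₁ : ¬ G.ContainsPoorPattern (univ.image (tripleEdges 3 7 le_rfl)) ∅ ∅ L M
  triple₂ : ¬ G.ContainsPoorPattern (univ.image (tripleEdges 2 7 (by norm_num)))
    (univ.image (triplePairs 7)) ∅ L M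
  fan₁ : ¬ G.ContainsPoorPattern (univ.image (fanEdges₁ m)) (univ.image (fanPairs₁ m)) ∅ L M
  fan₂ : ¬ G.ContainsPoorPattern (univ.image (fanEdges₂ m)) (univ.image (fanPairs₂ m)) ∅ L M
  poor : ¬ G.ContainsPoorPattern (ι := Fin 3) ∅ ∅ {s(0, 1), s(0, 2)} L M

variable {m : ℕ}

theorem PatternFree.not_light_first (hG : G.PatternFree L M m) (huv : u ≠ v)
    (hy : y ∈ G.pairNbrs s(u, v)) (hM : #(G.pairNbrs s(u, v)) ≤ M) {x : V} (hxv : x ≠ v)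
    (hyx : G.Adj y x) : ¬ G.IsLight L s(u, x) := by
  intro hl
  obtain ⟨hyu, hyv⟩ := mem_pairNbrs_mk.1 hy
  have hux : u ≠ x := by simpa using hl.1
  refine hG.cherry₁ (containsPoorPattern_of (by decide) ![u, v, y, x] ?_ ?_ ?_ ?_)
  · intro a b
    fin_cases a <;> fin_cases b <;>
      simp [huv, huv.symm, hux, hux.symm, hxv, hxv.symm, hyu.ne, hyu.ne', hyv.ne, hyv.ne', hyx.ne,
        hyx.ne']
  · simp [hyu.symm, hyv.symm, hyx]
  · simpa using hl.2.2.2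
  · simpa using hM

theorem PatternFree.not_light_second (hG : G.PatternFree L M m) (huv : u ≠ v)
    (hadj : ¬ G.Adj u v) (hy : y ∈ G.pairNbrs s(u, v)) (hM : #(G.pairNbrs s(u, v)) ≤ M) {x : V}
    (hux : G.Adj u x) : ¬ G.IsLight L s(y, x) := by
  intro hl
  obtain ⟨hyu, hyv⟩ := mem_pairNbrs_mk.1 hy
  have hyx : y ≠ x := by simpa using hl.1
  have hxv : x ≠ v := by rintro rfl; exact hadj hux
  refine hG.cherry₂ (containsPoorPattern_of (by decide) ![u, v, y, x] ?_ ?_ ?_ ?_)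
  · intro a b
    fin_cases a <;> fin_cases b <;>
      simp [huv, huv.symm, hux.ne, hux.ne', hxv, hxv.symm, hyu.ne, hyu.ne', hyv.ne, hyv.ne', hyx,
        hyx.symm]
  · simp [hyu.symm, hyv.symm, hux]
  · simpa using hl.2.2.2
  · simpa using hM

theorem PatternFree.card_common_triple_le (hG : G.PatternFree L M m) {x : V} (huv : u ≠ v)
    (hux : u ≠ x) (hvx : v ≠ x) : #{y ∈ G.pairNbrs s(u, v) | G.Adj y x} ≤ 6 := by
  by_contra hlt
  obtain ⟨g, hg, hgW⟩ := exists_injective_fin_of_le_card (m := 7) (not_le.1 hlt)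
  have h : ∀ i, G.Adj (g i) u ∧ G.Adj (g i) v ∧ G.Adj (g i) x := fun i => by
    have := mem_filter.1 (hgW i)
    exact ⟨(mem_pairNbrs_mk.1 this.1).1, (mem_pairNbrs_mk.1 this.1).2, this.2⟩
  refine hG.triple₁ (containsPoorPattern_of (by simp) (Sum.elim ![u, v, x] g) ?_ ?_ (by simp)
    (by simp))
  · exact injective_triple huv hux hvx hg (fun i => (h i).1.ne) (fun i => (h i).2.1.ne)
      (fun i => (h i).2.2.ne)
  · intro e he
    obtain ⟨⟨k, i⟩, -, rfl⟩ := mem_image.1 he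
    fin_cases k
    · exact (h i).1.symm
    · exact (h i).2.1.symm
    · exact (h i).2.2.symm

theorem PatternFree.card_light_star_le (hG : G.PatternFree L M m) {x : V} (huv : u ≠ v)
    (hux : u ≠ x) (hvx : v ≠ x) : #{y ∈ G.pairNbrs s(u, v) | G.IsLight L s(y, x)} ≤ 6 := by
  by_contra hlt
  obtain ⟨g, hg, hgW⟩ := exists_injective_fin_of_le_card (m := 7) (not_le.1 hlt)
  have h : ∀ i, G.Adj (g i) u ∧ G.Adj (g i) v ∧ G.IsLight L s(g i, x) := fun i => by
    have := mem_filter.1 (hgW i)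
    exact ⟨(mem_pairNbrs_mk.1 this.1).1, (mem_pairNbrs_mk.1 this.1).2, this.2⟩
  refine hG.triple₂ (containsPoorPattern_of (by simp) (Sum.elim ![u, v, x] g) ?_ ?_ ?_ (by simp))
  · exact injective_triple huv hux hvx hg (fun i => (h i).1.ne) (fun i => (h i).2.1.ne)
      (fun i => by simpa using (h i).2.2.1)
  · intro e he
    obtain ⟨⟨k, i⟩, -, rfl⟩ := mem_image.1 he
    fin_cases k
    · exact (h i).1.symm
    · exact (h i).2.1.symm
  · intro e he
    obtain ⟨i, -, rfl⟩ := mem_image.1 he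
    have := (h i).2.2.2.2.2
    rw [Sym2.eq_swap] at this
    exact this

/-- Each dangerous `y` has a witness `x = f y`. One witness serves at most six `y`, by
`card_common_triple_le`, so `14 m = (2 * 6 + 2) m` dangerous vertices would contain `m` disjoint
pairs `(y, f y)`, which form the pattern excluded by `fan₁`. -/
theorem PatternFree.card_first_lt (hG : G.PatternFree L M m) (huv : u ≠ v) :
    #{y ∈ G.pairNbrs s(u, v) | ∃ x, x ≠ v ∧ G.Adj y x ∧ G.IsLight L s(u, x)} < m * 14 := by
  by_contra hlt
  rw [not_lt] at hlt
  set W := {y ∈ G.pairNbrs s(u, v) | ∃ x, x ≠ v ∧ G.Adj y x ∧ G.IsLight L s(u, x)} with hW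
  have hWm : ∀ y ∈ W, (G.Adj y u ∧ G.Adj y v) ∧ ∃ x, x ≠ v ∧ G.Adj y x ∧ G.IsLight L s(u, x) :=
    fun y hy => by rw [← mem_pairNbrs_mk]; exact mem_filter.1 hy
  obtain ⟨f, hf⟩ : ∃ f : V → V, ∀ y ∈ W, f y ≠ v ∧ G.Adj y (f y) ∧ G.IsLight L s(u, f y) := by
    have : ∀ y, ∃ x, y ∈ W → x ≠ v ∧ G.Adj y x ∧ G.IsLight L s(u, x) := fun y => by
      by_cases hy : y ∈ W
      · exact (hWm y hy).2.imp fun x hx _ => hx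
      · exact ⟨y, fun h => absurd h hy⟩
    choose f hf using this
    exact ⟨f, hf⟩
  have hfu : ∀ y ∈ W, u ≠ f y := fun y hy => by simpa using (hf y hy).2.2.1
  have hfib : ∀ x, #{w ∈ W | f w = x} ≤ 6 := by
    intro x
    by_cases hx : ∃ w ∈ W, f w = x
    · obtain ⟨w, hw, rfl⟩ := hx
      refine (card_le_card ?_).trans
        (hG.card_common_triple_le huv (hfu w hw) (hf w hw).1.symm)
      intro y hy
      obtain ⟨hyW, hyf⟩ := mem_filter.1 hy
      refine mem_filter.2 ⟨(mem_filter.1 hyW).1, ?_⟩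
      rw [← hyf]
      exact (hf y hyW).2.1
    · rw [filter_eq_empty_iff.2 fun w hw h => hx ⟨w, hw, h⟩]
      simp
  obtain ⟨g, hg, hfg, hne, hgW⟩ := exists_fan_of_le_card (m := m)
    (fun w hw => (hf w hw).2.1.ne') hfib (by omega)
  refine hG.fan₁ (containsPoorPattern_of (by simp)
    (Sum.elim ![u, v] (Sum.elim g (f ∘ g))) ?_ ?_ ?_ (by simp))
  · exact injective_fan huv hg hfg hne (fun i => (hWm _ (hgW i)).1.1.ne)
      (fun i => (hWm _ (hgW i)).1.2.ne) (fun i => (hfu _ (hgW i)).symm)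
      (fun i => (hf _ (hgW i)).1)
  · intro e he
    obtain ⟨⟨k, i⟩, -, rfl⟩ := mem_image.1 he
    fin_cases k
    · exact (hWm _ (hgW i)).1.1.symm
    · exact (hWm _ (hgW i)).1.2.symm
    · exact (hf _ (hgW i)).2.1
  · intro e he
    obtain ⟨i, -, rfl⟩ := mem_image.1 he
    exact (hf _ (hgW i)).2.2.2.2.2

/-- As for `card_first_lt`, but with the other role of the shared edge: a repeated witness is now
the centre of a star of light pairs. -/
theorem PatternFree.card_second_lt (hG : G.PatternFree L M m) (huv : u ≠ v)
    (hadj : ¬ G.Adj u v) :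
    #{y ∈ G.pairNbrs s(u, v) | ∃ x, G.Adj u x ∧ G.IsLight L s(y, x)} < m * 14 := by
  by_contra hlt
  rw [not_lt] at hlt
  set W := {y ∈ G.pairNbrs s(u, v) | ∃ x, G.Adj u x ∧ G.IsLight L s(y, x)} with hW
  have hWm : ∀ y ∈ W, (G.Adj y u ∧ G.Adj y v) ∧ ∃ x, G.Adj u x ∧ G.IsLight L s(y, x) :=
    fun y hy => by rw [← mem_pairNbrs_mk]; exact mem_filter.1 hy
  obtain ⟨f, hf⟩ : ∃ f : V → V, ∀ y ∈ W, G.Adj u (f y) ∧ G.IsLight L s(y, f y) := by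
    have : ∀ y, ∃ x, y ∈ W → G.Adj u x ∧ G.IsLight L s(y, x) := fun y => by
      by_cases hy : y ∈ W
      · exact (hWm y hy).2.imp fun x hx _ => hx
      · exact ⟨y, fun h => absurd h hy⟩
    choose f hf using this
    exact ⟨f, hf⟩
  have hfy : ∀ y ∈ W, y ≠ f y := fun y hy => by simpa using (hf y hy).2.1
  have hfv : ∀ y ∈ W, v ≠ f y := fun y hy h => hadj (h ▸ (hf y hy).1)
  have hfib : ∀ x, #{w ∈ W | f w = x} ≤ 6 := by
    intro x
    by_cases hx : ∃ w ∈ W, f w = x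
    · obtain ⟨w, hw, rfl⟩ := hx
      refine (card_le_card ?_).trans
        (hG.card_light_star_le huv (hf w hw).1.ne (hfv w hw))
      intro y hy
      obtain ⟨hyW, hyf⟩ := mem_filter.1 hy
      refine mem_filter.2 ⟨(mem_filter.1 hyW).1, ?_⟩
      rw [← hyf]
      exact (hf y hyW).2
    · rw [filter_eq_empty_iff.2 fun w hw h => hx ⟨w, hw, h⟩]
      simp
  obtain ⟨g, hg, hfg, hne, hgW⟩ := exists_fan_of_le_card (m := m)
    (fun w hw => (hfy w hw).symm) hfib (by omega)
  refine hG.fan₂ (containsPoorPattern_of (by simp)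
    (Sum.elim ![u, v] (Sum.elim g (f ∘ g))) ?_ ?_ ?_ (by simp))
  · exact injective_fan huv hg hfg hne (fun i => (hWm _ (hgW i)).1.1.ne)
      (fun i => (hWm _ (hgW i)).1.2.ne) (fun i => (hf _ (hgW i)).1.ne')
      (fun i => (hfv _ (hgW i)).symm)
  · intro e he
    obtain ⟨⟨k, i⟩, -, rfl⟩ := mem_image.1 he
    fin_cases k
    · exact (hWm _ (hgW i)).1.1.symm
    · exact (hWm _ (hgW i)).1.2.symm
    · exact (hf _ (hgW i)).1
  · intro e he
    obtain ⟨i, -, rfl⟩ := mem_image.1 he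
    exact (hf _ (hgW i)).2.2.2.2

theorem PatternFree.card_dangerous_le (hG : G.PatternFree L M m) (huv : u ≠ v)
    (hadj : ¬ G.Adj u v) : #{y ∈ G.pairNbrs s(u, v) | G.IsDangerous L s(u, v) y} ≤ m * 56 := by
  have hsub : {y ∈ G.pairNbrs s(u, v) | G.IsDangerous L s(u, v) y} ⊆
      ({y ∈ G.pairNbrs s(u, v) | ∃ x, x ≠ v ∧ G.Adj y x ∧ G.IsLight L s(u, x)} ∪
        {y ∈ G.pairNbrs s(u, v) | ∃ x, G.Adj u x ∧ G.IsLight L s(y, x)}) ∪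
      ({y ∈ G.pairNbrs s(v, u) | ∃ x, x ≠ u ∧ G.Adj y x ∧ G.IsLight L s(v, x)} ∪
        {y ∈ G.pairNbrs s(v, u) | ∃ x, G.Adj v x ∧ G.IsLight L s(y, x)}) := by
    intro y hy
    obtain ⟨hy1, hy2⟩ := mem_filter.1 hy
    have hy1' : y ∈ G.pairNbrs s(v, u) := by rwa [Sym2.eq_swap]
    simp only [mem_union, mem_filter, hy1, hy1', true_and]
    exact hy2.cases
  have h1 := hG.card_first_lt huv
  have h2 := hG.card_second_lt huv hadj
  have h3 := hG.card_first_lt huv.symm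
  have h4 := hG.card_second_lt huv.symm fun h => hadj h.symm
  refine (card_le_card hsub).trans ((card_union_le _ _).trans
    ((add_le_add (card_union_le _ _) (card_union_le _ _)).trans ?_))
  omega

theorem PatternFree.not_isDangerous (hG : G.PatternFree L M m) (huv : u ≠ v)
    (hadj : ¬ G.Adj u v) (hy : y ∈ G.pairNbrs s(u, v)) (hM : #(G.pairNbrs s(u, v)) ≤ M) :
    ¬ G.IsDangerous L s(u, v) y := by
  intro hd
  have hy' : y ∈ G.pairNbrs s(v, u) := by rwa [Sym2.eq_swap]
  have hM' : #(G.pairNbrs s(v, u)) ≤ M := by rwa [Sym2.eq_swap]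
  rcases hd.cases with (⟨x, h1, h2, h3⟩ | ⟨x, h1, h2⟩) | (⟨x, h1, h2, h3⟩ | ⟨x, h1, h2⟩)
  · exact hG.not_light_first huv hy hM h1 h2 h3
  · exact hG.not_light_second huv hadj hy hM h1 h2
  · exact hG.not_light_first huv.symm hy' hM' h1 h2 h3
  · exact hG.not_light_second huv.symm (fun h => hadj h.symm) hy' hM' h1 h2

theorem PatternFree.le_card_safeNbrs (hG : G.PatternFree L M m) (huv : u ≠ v)
    (hadj : ¬ G.Adj u v) : #(G.pairNbrs s(u, v)) - m * 56 ≤ #(G.safeNbrs L s(u, v)) := by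
  have h1 := hG.card_dangerous_le huv hadj
  have h2 : #{y ∈ G.pairNbrs s(u, v) | G.IsDangerous L s(u, v) y} + #(G.safeNbrs L s(u, v)) =
      #(G.pairNbrs s(u, v)) := by
    rw [safeNbrs]
    convert card_filter_add_card_filter_not (s := G.pairNbrs s(u, v)) (G.IsDangerous L s(u, v))
  omega

/-- The threshold `m * 56` is the bound on dangerous common neighbours. Above it one must be safe;
at or below it all are safe, since `cherry₁` and `cherry₂` exclude a dangerous one. -/
theorem PatternFree.safeNbrs_nonempty (hG : G.PatternFree L (m * 56) m) (huv : u ≠ v)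
    (hadj : ¬ G.Adj u v) (hne : (G.pairNbrs s(u, v)).Nonempty) :
    (G.safeNbrs L s(u, v)).Nonempty := by
  by_cases hM : #(G.pairNbrs s(u, v)) ≤ m * 56
  · exact hne.imp fun y hy => mem_filter.2 ⟨hy, hG.not_isDangerous huv hadj hy hM⟩
  · have := hG.le_card_safeNbrs huv hadj
    exact card_pos.1 (by omega)

theorem PatternFree.exists_two_colouring (hG : G.PatternFree L (m * 56) m) {Δ : ℕ}
    (hΔ : ∀ v, #{w | G.Adj v w} ≤ Δ)
    (hq : 4 * (1 / 2 : ℝ) ^ (L + 1 - m * 56) * ((4 * (L + 1 - m * 56) * Δ : ℕ) + 1) ≤ 1) :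
    ∃ χ : Sym2 V → Bool, ∀ u v, u ≠ v → ¬ G.Adj u v → (∃ y, G.Adj y u ∧ G.Adj y v) →
      ∃ y, G.Adj y u ∧ G.Adj y v ∧ χ s(y, u) ≠ χ s(y, v) := by
  refine SimpleGraph.exists_two_colouring (L := L) hΔ ?_ ?_ hq
  · intro i hi
    induction i with
    | _ u v =>
    exact hG.safeNbrs_nonempty (by simpa using hi.1) hi.2.1 hi.2.2.1
  · intro i h1 h2 h3
    induction i with
    | _ u v =>
    have := hG.le_card_safeNbrs (u := u) (v := v) (by simpa using h1) h2
    omega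

theorem PatternFree.badPairs_disjoint (hG : G.PatternFree L M m) :
    ∀ i ∈ G.badPairs, ∀ j ∈ G.badPairs, ∀ a, a ∈ i → a ∈ j → i = j := by
  rintro i hi j hj a ⟨x, rfl⟩ ⟨y, rfl⟩
  by_contra hne
  have hxy : x ≠ y := by rintro rfl; exact hne rfl
  have hi' := mem_badPairs.1 hi
  have hj' := mem_badPairs.1 hj
  have hax : a ≠ x := by simpa using hi'.1
  have hay : a ≠ y := by simpa using hj'.1
  refine hG.poor (containsPoorPattern_of (by simp) ![a, x, y] ?_ (by simp) (by simp) ?_)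
  · intro b c
    fin_cases b <;> fin_cases c <;> simp [hax, hax.symm, hay, hay.symm, hxy, hxy.symm]
  · simp [hi'.2.2, hj'.2.2]

end SimpleGraph

/-! ### Asymptotics of the edge probability -/

namespace SimpleGraph
open Finset Filter Topology
open scoped Classical

section EdgeProbability
variable {c : ℝ} {p : ℕ → unitInterval}

/-- The edge probability is `√((2 log n + c) / n)` for all large `n`. -/
def IsDiameterTwoWindow (c : ℝ) (p : ℕ → unitInterval) : Prop :=
  ∀ᶠ n : ℕ in atTop, (p n : ℝ) = Real.sqrt ((2 * Real.log (n : ℝ) + c) / (n : ℝ))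

theorem tendsto_log_natCast : Tendsto (fun n : ℕ => Real.log n) atTop atTop :=
  Real.tendsto_log_atTop.comp tendsto_natCast_atTop_atTop

theorem tendsto_exp_mul_log {a : ℝ} (ha : a < 0) :
    Tendsto (fun n : ℕ => Real.exp (a * Real.log n)) atTop (𝓝 0) :=
  Real.tendsto_exp_atBot.comp (tendsto_log_natCast.const_mul_atTop_of_neg ha)

theorem IsDiameterTwoWindow.eventually_mul_sq (hp : IsDiameterTwoWindow c p) :
    ∀ᶠ n : ℕ in atTop, (n : ℝ) * (p n : ℝ) ^ 2 = 2 * Real.log n + c := by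
  filter_upwards [hp, eventually_gt_atTop 0, tendsto_log_natCast.eventually_ge_atTop (|c|)]
    with n hn h0 hlog
  have hn0 : (0 : ℝ) < n := by exact_mod_cast h0
  have habs := neg_abs_le c
  rw [hn, Real.sq_sqrt (div_nonneg (by linarith [abs_nonneg c]) hn0.le)]
  field_simp

/-- That is, `p ≤ n ^ (-a)`: after squaring, the ratio is `(2 log n + c) n ^ (2a - 1)`, which tends
to 0. Powers of `n` are written as exponentials of `log n` throughout. -/
theorem IsDiameterTwoWindow.eventually_le_exp (hp : IsDiameterTwoWindow c p) {a : ℝ}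
    (ha : a < 1 / 2) : ∀ᶠ n : ℕ in atTop, (p n : ℝ) ≤ Real.exp (-a * Real.log n) := by
  have hlim : Tendsto (fun x : ℝ => (2 * x + c) * Real.exp (-(1 - 2 * a) * x)) atTop (𝓝 0) := by
    have h1 := Real.tendsto_pow_mul_exp_neg_atTop_nhds_zero 1
    have h2 := Real.tendsto_exp_neg_atTop_nhds_zero
    have hb : 0 < 1 - 2 * a := by linarith
    have h3 := h1.comp (tendsto_id.const_mul_atTop hb)
    have h4 := h2.comp (tendsto_id.const_mul_atTop hb)
    have := (h3.const_mul (2 / (1 - 2 * a))).add (h4.const_mul c)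
    simp only [mul_zero, add_zero] at this
    refine this.congr fun x => ?_
    simp only [Function.comp, id, pow_one]
    rw [neg_mul]
    field_simp
  have hev := (hlim.comp tendsto_log_natCast).eventually_le_const (show (0 : ℝ) < 1 by norm_num)
  filter_upwards [hp.eventually_mul_sq, eventually_gt_atTop 0, hev] with n hn h0 h1
  have hn0 : (0 : ℝ) < n := by exact_mod_cast h0
  simp only [Function.comp] at h1
  refine le_of_sq_le_sq ?_ (Real.exp_pos _).le
  rw [← hn] at h1
  have e1 : Real.exp (-(1 - 2 * a) * Real.log n) = (n : ℝ)⁻¹ * (Real.exp (-a * Real.log n) ^ 2)⁻¹ := by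
    rw [← Real.exp_nat_mul, ← Real.exp_neg]
    nth_rewrite 2 [← Real.exp_log hn0]
    rw [← Real.exp_neg, ← Real.exp_add]
    congr 1
    push_cast
    ring
  rw [e1] at h1
  have e2 : (n : ℝ) * (p n : ℝ) ^ 2 * ((n : ℝ)⁻¹ * (Real.exp (-a * Real.log n) ^ 2)⁻¹) =
      (p n : ℝ) ^ 2 / Real.exp (-a * Real.log n) ^ 2 := by
    field_simp
  rwa [e2, div_le_one (by positivity)] at h1

theorem IsDiameterTwoWindow.tendsto_zero (hp : IsDiameterTwoWindow c p) :
    Tendsto (fun n => (p n : ℝ)) atTop (𝓝 0) :=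
  squeeze_zero' (Eventually.of_forall fun n => (p n).2.1)
    (hp.eventually_le_exp (a := 0.4) (by norm_num)) (tendsto_exp_mul_log (by norm_num))

theorem IsDiameterTwoWindow.tendsto_mul_cube (hp : IsDiameterTwoWindow c p) :
    Tendsto (fun n : ℕ => (n : ℝ) * (p n : ℝ) ^ 3) atTop (𝓝 0) := by
  refine squeeze_zero' (Eventually.of_forall fun n =>
    mul_nonneg (Nat.cast_nonneg _) (pow_nonneg (p n).2.1 _)) ?_
    (tendsto_exp_mul_log (a := -0.2) (by norm_num))
  filter_upwards [hp.eventually_le_exp (a := 0.4) (by norm_num), eventually_gt_atTop 0] with n hn h0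
  have hn0 : (0 : ℝ) < n := by exact_mod_cast h0
  calc (n : ℝ) * (p n : ℝ) ^ 3 ≤ Real.exp (Real.log n) * Real.exp (-0.4 * Real.log n) ^ 3 := by
        rw [Real.exp_log hn0]
        gcongr
        exact (p n).2.1
    _ = _ := by
        rw [← Real.exp_nat_mul, ← Real.exp_add]
        congr 1
        push_cast
        ring

end EdgeProbability

/-! ### Patterns excluded with high probability -/

section Patterns
variable {c : ℝ} {p : ℕ → unitInterval} {ι : Type*}

theorem prod_inv_pow_allowance {Hl Hc : Finset (Sym2 ι)} (hd : Disjoint Hl Hc) (L M : ℕ) (a b : ℝ) :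
    ∏ h ∈ Hl ∪ Hc, ((if h ∈ Hl then a else b) ^ allowance Hl L M h)⁻¹ =
      ((a ^ L)⁻¹) ^ #Hl * ((b ^ M)⁻¹) ^ #Hc := by
  rw [prod_union hd, ← prod_const, ← prod_const]
  congr 1
  · exact prod_congr rfl fun h hh => by rw [allowance, if_pos hh, if_pos hh]
  · refine prod_congr rfl fun h hh => ?_
    have : h ∉ Hl := fun h' => Finset.disjoint_left.1 hd h' hh
    rw [allowance, if_neg this, if_neg this]

theorem sum_one_sub_ite {Hl Hc : Finset (Sym2 ι)} (hd : Disjoint Hl Hc) (a b : ℝ) :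
    ∑ h ∈ Hl ∪ Hc, (1 - if h ∈ Hl then a else b) = #Hl * (1 - a) + #Hc * (1 - b) := by
  rw [sum_union hd, ← nsmul_eq_mul, ← nsmul_eq_mul, ← sum_const, ← sum_const]
  congr 1
  · exact sum_congr rfl fun h hh => by rw [if_pos hh]
  · refine sum_congr rfl fun h hh => ?_
    rw [if_neg fun h' => Finset.disjoint_left.1 hd h' hh]

/-- The hypothesis `hexp` says that the expected count is a negative power of `n`: a vertex
contributes exponent 1, an edge `-0.4999`, a pair with at most `(3/4) log n` common neighbours
`-0.514`, a pair with boundedly many `-1.998`. -/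
theorem IsDiameterTwoWindow.tendsto_containsPoorPattern [Fintype ι] (hp : IsDiameterTwoWindow c p)
    {F Hl Hc : Finset (Sym2 ι)} (hF : ∀ e ∈ F, ¬ e.IsDiag) (hHl : ∀ e ∈ Hl, ¬ e.IsDiag)
    (hHc : ∀ e ∈ Hc, ¬ e.IsDiag) (hd : Disjoint Hl Hc) (M : ℕ)
    (hexp : (Fintype.card ι : ℝ) - 0.4999 * #F - 0.514 * #Hl - 1.998 * #Hc < 0) :
    Tendsto (fun n : ℕ => (binomialRandom (Fin n) (p n)).real
      {G | G.ContainsPoorPattern F Hl Hc ⌊(3 / 4 : ℝ) * Real.log n⌋₊ M}) atTop (𝓝 0) := by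
  set k := Fintype.card ι with hk
  -- For a light pair the exponent is `(3/4) log (1/s) - 2 (1 - s)`, minimal at `s = 3/8`; `s = e⁻¹`
  -- is close to it and gives `0.75 - 2 (1 - 0.368) = -0.514`. For bounded codegree `s ^ (-M)` is a
  -- constant, so a small `s` is affordable and gives `-2 * 0.999`.
  set s : Sym2 ι → ℝ := fun h => if h ∈ Hl then Real.exp (-1) else 1 / 1000 with hs
  set σ : ℝ := #Hl * (1 - Real.exp (-1)) + #Hc * (1 - 1 / 1000) with hσ
  set δ : ℝ := (k : ℝ) - 0.4999 * #F - 0.514 * #Hl - 1.998 * #Hc with hδ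
  set C : ℝ := Real.exp (-σ * c + σ * k + #(Hl ∪ Hc) ^ 2) * (((1 / 1000 : ℝ) ^ M)⁻¹) ^ #Hc with hC
  have hexp1 : Real.exp (-1) ≤ 0.368 := by
    rw [Real.exp_neg, inv_le_comm₀ (Real.exp_pos _) (by norm_num)]
    have := Real.exp_one_gt_d9
    norm_num at this ⊢
    linarith
  have hσ0 : 0 ≤ σ := by
    have : 0 ≤ 1 - Real.exp (-1) := by linarith
    positivity
  refine squeeze_zero' (Eventually.of_forall fun n => MeasureTheory.measureReal_nonneg) ?_
    (by simpa using (tendsto_exp_mul_log hexp).const_mul C)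
  filter_upwards [hp.eventually_mul_sq, hp.eventually_le_exp (a := 0.4999) (by norm_num),
    hp.tendsto_mul_cube.eventually_le_const (show (0 : ℝ) < 1 by norm_num),
    eventually_gt_atTop 0, eventually_ge_atTop k] with n h1 h2 h3 h0 hkn
  have hn0 : (0 : ℝ) < n := by exact_mod_cast h0
  have hp0 : (0 : ℝ) ≤ p n := (p n).2.1
  have hp1 : (p n : ℝ) ≤ 1 := (p n).2.2
  have hlog : 0 ≤ Real.log n := Real.log_natCast_nonneg n
  set x := Real.log n with hx
  have hK := binomialRandom_containsPattern_le (V := Fin n) (p n) (F := F) (H := Hl ∪ Hc) hF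
    (fun h hh => (mem_union.1 hh).elim (hHl h) (hHc h)) (allowance Hl ⌊(3 / 4 : ℝ) * x⌋₊ M)
    (s := s) (fun h _ => by simp only [hs]; split_ifs <;> positivity)
    (fun h _ => by simp only [hs]; split_ifs <;> linarith)
  rw [Fintype.card_fin, ← hk] at hK
  refine hK.trans ?_
  rw [prod_inv_pow_allowance hd, sum_one_sub_ite hd, ← hσ]
  have b1 : (n : ℝ) ^ k = Real.exp (k * x) := by
    rw [Real.exp_nat_mul, hx, Real.exp_log hn0]
  have b2 : ((Real.exp (-1) ^ ⌊(3 / 4 : ℝ) * x⌋₊)⁻¹) ^ #Hl ≤ Real.exp (0.75 * #Hl * x) := by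
    rw [← Real.exp_nat_mul, ← Real.exp_neg, ← Real.exp_nat_mul, Real.exp_le_exp]
    have := Nat.floor_le (show 0 ≤ (3 / 4 : ℝ) * x by positivity)
    have h4 : (0 : ℝ) ≤ #Hl := Nat.cast_nonneg _
    nlinarith [mul_le_mul_of_nonneg_left this h4]
  have b3 : (p n : ℝ) ^ #F ≤ Real.exp (-0.4999 * #F * x) := by
    refine (pow_le_pow_left₀ hp0 h2 _).trans (le_of_eq ?_)
    rw [← Real.exp_nat_mul]
    congr 1
    ring
  have b4 : Real.exp (-σ * (p n : ℝ) ^ 2 + (#(Hl ∪ Hc) : ℝ) ^ 2 * (p n : ℝ) ^ 3) ^ (n - k) ≤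
      Real.exp (-σ * (2 * x)) * Real.exp (-σ * c + σ * k + #(Hl ∪ Hc) ^ 2) := by
    rw [← Real.exp_nat_mul, ← Real.exp_add, Real.exp_le_exp, Nat.cast_sub hkn]
    have h5 : (p n : ℝ) ^ 2 ≤ 1 := pow_le_one₀ hp0 hp1
    have h6 : 0 ≤ σ * k := by positivity
    have h7 : (0 : ℝ) ≤ #(Hl ∪ Hc) ^ 2 := by positivity
    have h8 : (0 : ℝ) ≤ k * (p n : ℝ) ^ 3 := by positivity
    nlinarith [mul_le_mul_of_nonneg_left h5 h6, mul_le_mul_of_nonneg_left h3 h7,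
      mul_nonneg h7 h8]
  have b5 : k * x + 0.75 * #Hl * x + -0.4999 * #F * x + -σ * (2 * x) ≤ δ * x := by
    have h4 : (0 : ℝ) ≤ #Hl * x := by positivity
    rw [hδ, hσ]
    nlinarith [mul_le_mul_of_nonneg_left hexp1 h4]
  have hq : 0 ≤ (((1 / 1000 : ℝ) ^ M)⁻¹) ^ #Hc := by positivity
  calc _ ≤ Real.exp (k * x) * ((Real.exp (0.75 * #Hl * x) * (((1 / 1000 : ℝ) ^ M)⁻¹) ^ #Hc) *
        (Real.exp (-0.4999 * #F * x) * (Real.exp (-σ * (2 * x)) *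
          Real.exp (-σ * c + σ * k + #(Hl ∪ Hc) ^ 2)))) := by
        rw [b1]
        gcongr
    _ = C * Real.exp (k * x + 0.75 * #Hl * x + -0.4999 * #F * x + -σ * (2 * x)) := by
        rw [hC]
        generalize Real.exp (-σ * c + σ * k + #(Hl ∪ Hc) ^ 2) = A
        rw [Real.exp_add, Real.exp_add, Real.exp_add]
        ring
    _ ≤ C * Real.exp (δ * x) := by
        gcongr

theorem card_image_univ_of_injective {α β : Type*} [Fintype α] [DecidableEq β] {f : α → β}
    (hf : Function.Injective f) : #(univ.image f) = Fintype.card α := by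
  rw [card_image_of_injective _ hf, card_univ]

/-- The exponents are about `-0.012` for the cherries, `-0.5` and `-0.6` for the triples, `2 -
0.0137 m` for the fans and `-1` for the two poor pairs with a common vertex. The fans force `m` to
be large, and `m = 200` suffices. In `triple₁`, six common neighbours would leave a positive
exponent. -/
theorem IsDiameterTwoWindow.tendsto_not_patternFree (hp : IsDiameterTwoWindow c p) (M : ℕ) :
    Tendsto (fun n : ℕ => (binomialRandom (Fin n) (p n)).real
      {G | ¬ G.PatternFree ⌊(3 / 4 : ℝ) * Real.log n⌋₊ M 200}) atTop (𝓝 0) := by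
  have t1 := hp.tendsto_containsPoorPattern (ι := Fin 4) (F := {s(0, 2), s(1, 2), s(2, 3)})
    (Hl := {s(0, 3)}) (Hc := {s(0, 1)}) (by simp) (by simp) (by simp) (by decide) M (by
      rw [show #({s(0, 2), s(1, 2), s(2, 3)} : Finset (Sym2 (Fin 4))) = 3 by decide]
      norm_num)
  have t2 := hp.tendsto_containsPoorPattern (ι := Fin 4) (F := {s(0, 2), s(1, 2), s(0, 3)})
    (Hl := {s(2, 3)}) (Hc := {s(0, 1)}) (by simp) (by simp) (by simp) (by decide) M (by
      rw [show #({s(0, 2), s(1, 2), s(0, 3)} : Finset (Sym2 (Fin 4))) = 3 by decide]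
      norm_num)
  have t3 := hp.tendsto_containsPoorPattern (F := univ.image (tripleEdges 3 7 le_rfl))
    (Hl := ∅) (Hc := ∅) (by
      intro e he
      obtain ⟨⟨k, i⟩, -, rfl⟩ := mem_image.1 he
      simp [tripleEdges]) (by simp) (by simp) (by simp) M (by
      rw [card_image_univ_of_injective (tripleEdges_injective _ _ _)]
      norm_num)
  have t4 := hp.tendsto_containsPoorPattern (F := univ.image (tripleEdges 2 7 (by norm_num)))
    (Hl := univ.image (triplePairs 7)) (Hc := ∅) (by
      intro e he
      obtain ⟨⟨k, i⟩, -, rfl⟩ := mem_image.1 he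
      simp [tripleEdges]) (by
      intro e he
      obtain ⟨i, -, rfl⟩ := mem_image.1 he
      simp [triplePairs])
    (by simp) (by simp) M (by
      rw [card_image_univ_of_injective (tripleEdges_injective _ _ _),
        card_image_univ_of_injective (triplePairs_injective _)]
      norm_num)
  have t5 := hp.tendsto_containsPoorPattern (F := univ.image (fanEdges₁ 200))
    (Hl := univ.image (fanPairs₁ 200)) (Hc := ∅) (by
      intro e he
      obtain ⟨⟨k, i⟩, -, rfl⟩ := mem_image.1 he
      fin_cases k <;> simp [fanEdges₁]) (by
      intro e he
      obtain ⟨i, -, rfl⟩ := mem_image.1 he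
      simp [fanPairs₁]) (by simp) (by simp) M (by
      rw [card_image_univ_of_injective (fanEdges₁_injective _),
        card_image_univ_of_injective (fanPairs₁_injective _)]
      norm_num)
  have t6 := hp.tendsto_containsPoorPattern (F := univ.image (fanEdges₂ 200))
    (Hl := univ.image (fanPairs₂ 200)) (Hc := ∅) (by
      intro e he
      obtain ⟨⟨k, i⟩, -, rfl⟩ := mem_image.1 he
      fin_cases k <;> simp [fanEdges₂]) (by
      intro e he
      obtain ⟨i, -, rfl⟩ := mem_image.1 he
      simp [fanPairs₂]) (by simp) (by simp) M (by
      rw [card_image_univ_of_injective (fanEdges₂_injective _),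
        card_image_univ_of_injective (fanPairs₂_injective _)]
      norm_num)
  have t7 := hp.tendsto_containsPoorPattern (ι := Fin 3) (F := ∅)
    (Hl := ∅) (Hc := {s(0, 1), s(0, 2)}) (by simp) (by simp) (by simp) (by simp) M (by
      rw [show #({s(0, 1), s(0, 2)} : Finset (Sym2 (Fin 3))) = 2 by decide]
      norm_num)
  have ht := ((((((t1.add t2).add t3).add t4).add t5).add t6).add t7)
  simp only [add_zero] at ht
  refine squeeze_zero (fun n => MeasureTheory.measureReal_nonneg) (fun n => ?_) ht
  set L := ⌊(3 / 4 : ℝ) * Real.log n⌋₊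
  refine le_trans (MeasureTheory.measureReal_mono (s₂ :=
    ({G : SimpleGraph (Fin n) | G.ContainsPoorPattern (ι := Fin 4) {s(0, 2), s(1, 2), s(2, 3)}
        {s(0, 3)} {s(0, 1)} L M} ∪
      {G | G.ContainsPoorPattern (ι := Fin 4) {s(0, 2), s(1, 2), s(0, 3)} {s(2, 3)} {s(0, 1)} L M} ∪
      {G | G.ContainsPoorPattern (univ.image (tripleEdges 3 7 le_rfl)) ∅ ∅ L M} ∪
      {G | G.ContainsPoorPattern (univ.image (tripleEdges 2 7 (by norm_num)))
        (univ.image (triplePairs 7)) ∅ L M} ∪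
      {G | G.ContainsPoorPattern (univ.image (fanEdges₁ 200)) (univ.image (fanPairs₁ 200)) ∅ L M} ∪
      {G | G.ContainsPoorPattern (univ.image (fanEdges₂ 200)) (univ.image (fanPairs₂ 200)) ∅ L M} ∪
      {G | G.ContainsPoorPattern (ι := Fin 3) ∅ ∅ {s(0, 1), s(0, 2)} L M})) ?_
    (MeasureTheory.measure_ne_top _ _)) ?_
  · intro G hG
    by_contra hcon
    simp only [Set.mem_union, Set.mem_ofPred_eq, not_or] at hcon
    obtain ⟨⟨⟨⟨⟨⟨h1, h2⟩, h3⟩, h4⟩, h5⟩, h6⟩, h7⟩ := hcon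
    exact hG ⟨h1, h2, h3, h4, h5, h6, h7⟩
  · iterate 6 refine (MeasureTheory.measureReal_union_le _ _).trans (add_le_add ?_ le_rfl)
    exact le_rfl

end Patterns

end SimpleGraph

/-! ### Bonferroni inequalities and the Poisson limit -/

namespace SimpleGraph
open Finset Filter Topology
open scoped Classical Asymptotics

section Bonferroni

/-- For positive `X` the alternating sum up to `m` telescopes to `(-1) ^ m * (X - 1).choose m`,
whose sign is the parity of `m`. -/
theorem bonferroni_upper (X k : ℕ) :
    (if X = 0 then (1 : ℝ) else 0) ≤ ∑ r ∈ range (2 * k + 1), (-1 : ℝ) ^ r * X.choose r := by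
  rcases X with _ | X
  · rw [if_pos rfl, sum_range_succ']
    simp
  · have h := Int.alternating_sum_range_choose_eq_choose (n := X) (m := 2 * k)
    have h' : ∑ r ∈ range (2 * k + 1), (-1 : ℝ) ^ r * (X + 1).choose r =
        (-1) ^ (2 * k) * X.choose (2 * k) := by exact_mod_cast h
    rw [h', if_neg (Nat.succ_ne_zero X), pow_mul]
    simp

theorem bonferroni_lower (X k : ℕ) :
    ∑ r ∈ range (2 * k), (-1 : ℝ) ^ r * X.choose r ≤ if X = 0 then 1 else 0 := by
  rcases k with _ | k
  · split_ifs <;> simp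
  rcases X with _ | X
  · rw [if_pos rfl, show 2 * (k + 1) = 2 * k + 1 + 1 by ring, sum_range_succ']
    simp
  · have h := Int.alternating_sum_range_choose_eq_choose (n := X) (m := 2 * k + 1)
    have h' : ∑ r ∈ range (2 * k + 1 + 1), (-1 : ℝ) ^ r * (X + 1).choose r =
        (-1) ^ (2 * k + 1) * X.choose (2 * k + 1) := by exact_mod_cast h
    rw [show 2 * (k + 1) = 2 * k + 1 + 1 by ring, h', if_neg (Nat.succ_ne_zero X), pow_succ, pow_mul]
    simp

/-- Brun's sieve: convergence of the binomial moments to those of a Poisson variable forces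
convergence of the probability of zero. -/
theorem tendsto_of_bonferroni {x : ℕ → ℝ} {b : ℕ → ℕ → ℝ} {μ : ℝ}
    (hb : ∀ r, Tendsto (b r) atTop (𝓝 (μ ^ r / r.factorial)))
    (hup : ∀ k n, x n ≤ ∑ r ∈ range (2 * k + 1), (-1 : ℝ) ^ r * b r n)
    (hlow : ∀ k n, ∑ r ∈ range (2 * k), (-1 : ℝ) ^ r * b r n ≤ x n) :
    Tendsto x atTop (𝓝 (Real.exp (-μ))) := by
  have hpart : ∀ k, Tendsto (fun n => ∑ r ∈ range k, (-1 : ℝ) ^ r * b r n) atTop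
      (𝓝 (∑ r ∈ range k, (-μ) ^ r / r.factorial)) := fun k => by
    refine tendsto_finsetSum _ fun r _ => ?_
    rw [neg_pow μ r, mul_div_assoc]
    exact (hb r).const_mul _
  have hexp : Tendsto (fun k => ∑ r ∈ range k, (-μ) ^ r / (r.factorial : ℝ)) atTop
      (𝓝 (Real.exp (-μ))) := by
    rw [Real.exp_eq_exp_ℝ]
    exact (NormedSpace.expSeries_div_hasSum_exp (-μ)).tendsto_sum_nat
  have h2 : Tendsto (fun k : ℕ => 2 * k) atTop atTop :=
    tendsto_atTop_mono (fun k => show k ≤ 2 * k by omega) tendsto_id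
  have h21 : Tendsto (fun k : ℕ => 2 * k + 1) atTop atTop :=
    tendsto_atTop_mono (fun k => Nat.le_succ _) h2
  rw [tendsto_order]
  constructor
  · intro a ha
    obtain ⟨k, hk⟩ := ((hexp.comp h2).eventually_const_lt ha).exists
    filter_upwards [(hpart (2 * k)).eventually_const_lt hk] with n hn
    exact hn.trans_le (hlow k n)
  · intro a ha
    obtain ⟨k, hk⟩ := ((hexp.comp h21).eventually_lt_const ha).exists
    filter_upwards [(hpart (2 * k + 1)).eventually_lt_const hk] with n hn
    exact (hup k n).trans_lt hn

end Bonferroni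

section BinomialMoments
variable {V : Type*} [Fintype V] {p : ℝ}

theorem badPairs_subset_nonDiag (G : SimpleGraph V) : G.badPairs ⊆ nonDiag V := fun _ hi =>
  mem_nonDiag.2 (mem_badPairs.1 hi).1

theorem choose_card_badPairs (G : SimpleGraph V) (r : ℕ) :
    ((#G.badPairs).choose r : ℝ) =
      ∑ H ∈ (nonDiag V).powersetCard r, if ∀ i ∈ H, G.IsBad i then 1 else 0 := by
  rw [sum_boole, ← card_powersetCard]
  congr 2
  ext H
  simp only [mem_powersetCard, mem_filter, ← mem_badPairs]
  exact ⟨fun h => ⟨⟨h.1.trans (badPairs_subset_nonDiag G), h.2⟩, fun i hi => h.1 hi⟩,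
    fun h => ⟨fun i hi => h.2 i hi, h.1.2⟩⟩

/-- The `r`-th binomial moment of the number of bad pairs of the random graph on `V`. -/
noncomputable def badMoment (V : Type*) [Fintype V] (p : ℝ) (r : ℕ) : ℝ :=
  bernExp p (nonDiag V)
    (fun S => ((#(fromEdgeSet (S : Set (Sym2 V))).badPairs).choose r : ℝ))

theorem badMoment_eq_sum (r : ℕ) :
    badMoment V p r =
    ∑ H ∈ (nonDiag V).powersetCard r, bernExp p (nonDiag V)
      (fun S => if ∀ i ∈ H, (fromEdgeSet (S : Set (Sym2 V))).IsBad i then 1 else 0) := by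
  rw [badMoment, ← bernExp_sum]
  exact bernExp_congr fun S _ => choose_card_badPairs _ r

/-- The bound is the same for every `r`-set of pairs, so sets of overlapping pairs need no separate
treatment, here and in `le_badMoment`. -/
theorem badMoment_le (hp0 : 0 ≤ p) (hp1 : p ≤ 1) {r : ℕ} (hr : r * p ≤ 1) :
    badMoment V p r ≤
    (((Fintype.card V).choose 2).choose r : ℝ) *
      Real.exp (-r * p ^ 2 + r ^ 2 * p ^ 3) ^ (Fintype.card V - 2 * r) := by
  rw [badMoment_eq_sum, ← card_nonDiag, ← card_powersetCard, ← nsmul_eq_mul]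
  refine sum_le_card_nsmul _ _ _ fun H hH => ?_
  obtain ⟨hH', rfl⟩ := mem_powersetCard.1 hH
  exact bernExp_forall_isBad_le hp0 hp1 hH' hr

theorem le_badMoment (hp0 : 0 ≤ p) (hp1 : p ≤ 1) {r : ℕ} (hr : r * p ^ 2 ≤ 1) :
    (((Fintype.card V).choose 2).choose r : ℝ) *
      ((1 - p) ^ (2 * r) ^ 2 * (1 - r * p ^ 2) ^ Fintype.card V) ≤
    badMoment V p r := by
  rw [badMoment_eq_sum, ← card_nonDiag, ← card_powersetCard, ← nsmul_eq_mul]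
  refine card_nsmul_le_sum _ _ _ fun H hH => ?_
  obtain ⟨hH', rfl⟩ := mem_powersetCard.1 hH
  exact le_bernExp_forall_isBad hp0 hp1 hH' hr

theorem sum_mul_badMoment (k : ℕ) : ∑ r ∈ range k, (-1 : ℝ) ^ r * badMoment V p r =
    bernExp p (nonDiag V) (fun S => ∑ r ∈ range k, (-1 : ℝ) ^ r *
      ((#(fromEdgeSet (S : Set (Sym2 V))).badPairs).choose r : ℝ)) := by
  rw [bernExp_sum]
  exact sum_congr rfl fun r _ => (bernExp_const_mul _).symm

theorem binomialRandom_badPairs_eq_empty (p : unitInterval) :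
    (binomialRandom V p).real {G | G.badPairs = ∅} = bernExp p (nonDiag V)
      (fun S => if #(fromEdgeSet (S : Set (Sym2 V))).badPairs = 0 then 1 else 0) := by
  rw [binomialRandom_real_eq_bernExp]
  refine bernExp_congr fun S _ => ?_
  simp [Set.indicator_apply]

theorem binomialRandom_badPairs_eq_empty_le (p : unitInterval) (k : ℕ) :
    (binomialRandom V p).real {G | G.badPairs = ∅} ≤
      ∑ r ∈ range (2 * k + 1), (-1 : ℝ) ^ r * badMoment V p r := by
  rw [sum_mul_badMoment, binomialRandom_badPairs_eq_empty]
  exact bernExp_mono p.2.1 p.2.2 fun S _ => bonferroni_upper _ k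

theorem le_binomialRandom_badPairs_eq_empty (p : unitInterval) (k : ℕ) :
    ∑ r ∈ range (2 * k), (-1 : ℝ) ^ r * badMoment V p r ≤
      (binomialRandom V p).real {G | G.badPairs = ∅} := by
  rw [sum_mul_badMoment, binomialRandom_badPairs_eq_empty]
  exact bernExp_mono p.2.1 p.2.2 fun S _ => bonferroni_lower _ k

theorem binomialRandom_lt_card_badPairs_le (p : unitInterval) {K : ℝ} (hK : 0 < K) :
    (binomialRandom V p).real {G | K < #G.badPairs} ≤ badMoment V p 1 / K := by
  rw [binomialRandom_real_eq_bernExp, div_eq_inv_mul, badMoment, ← bernExp_const_mul]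
  refine bernExp_mono p.2.1 p.2.2 fun S _ => ?_
  rw [Nat.choose_one_right, inv_mul_eq_div]
  rw [Set.indicator_apply]
  split_ifs with hG
  · rw [Pi.one_apply, one_le_div hK]
    exact le_of_lt hG
  · positivity

end BinomialMoments

/-! ### Convergence of the binomial moments -/

section Limit
variable {c : ℝ} {p : ℕ → unitInterval}

theorem tendsto_choose_choose_mul (r : ℕ) :
    Tendsto (fun n : ℕ => ((n.choose 2).choose r : ℝ) * Real.exp (-2 * Real.log n) ^ r) atTop
      (𝓝 ((1 / 2) ^ r / r.factorial)) := by
  have hN : Tendsto (fun n : ℕ => n.choose 2) atTop atTop := by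
    refine tendsto_atTop_mono' _ ?_ (tendsto_sub_atTop_nat 1)
    filter_upwards [eventually_ge_atTop 2] with n hn
    rw [Nat.choose_two_right, Nat.le_div_iff_mul_le (by norm_num), mul_comm]
    exact Nat.mul_le_mul_right _ hn
  have hlim : Tendsto (fun n : ℕ => ((n.choose 2 : ℕ) : ℝ) * Real.exp (-2 * Real.log n)) atTop
      (𝓝 (1 / 2)) := by
    have h1 : Tendsto (fun n : ℕ => (1 / 2 : ℝ) - 1 / 2 * ((n : ℝ)⁻¹)) atTop (𝓝 (1 / 2 - 1 / 2 * 0)) :=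
      (tendsto_inv_atTop_zero.comp tendsto_natCast_atTop_atTop).const_mul _ |>.const_sub _
    rw [mul_zero, sub_zero] at h1
    refine h1.congr' ?_
    filter_upwards [eventually_gt_atTop 0] with n h0
    have hn0 : (0 : ℝ) < n := Nat.cast_pos.2 h0
    rw [Nat.cast_choose_two, show -2 * Real.log n = -(2 * Real.log n) by ring, Real.exp_neg, two_mul,
      Real.exp_add, Real.exp_log hn0]
    field_simp
  have heq : (fun n : ℕ => ((n.choose 2).choose r : ℝ) * Real.exp (-2 * Real.log n) ^ r) ~[atTop]
      fun n : ℕ => (((n.choose 2 : ℕ) : ℝ) * Real.exp (-2 * Real.log n)) ^ r / r.factorial := by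
    have h2 := ((isEquivalent_choose r).comp_tendsto hN).mul
      (Asymptotics.IsEquivalent.refl (u := fun n : ℕ => Real.exp (-2 * Real.log n) ^ r))
    refine h2.trans (EventuallyEq.isEquivalent (.of_eq ?_))
    ext n
    simp only [Pi.mul_apply, Function.comp]
    rw [mul_pow]
    ring
  exact heq.symm.tendsto_nhds ((hlim.pow r).div_const _)

/-- Lets `(1 - r p²) ^ n` be compared with `exp (-r n p²)`; the error exponent `2 r² n p⁴` tends to
0. -/
theorem exp_neg_add_two_mul_sq_le {x : ℝ} (h1 : x ≤ 1 / 2) :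
    Real.exp (-(x + 2 * x ^ 2)) ≤ 1 - x := by
  rw [Real.exp_neg, inv_le_comm₀ (Real.exp_pos _) (by linarith)]
  have h2 := Real.add_one_le_exp (x + 2 * x ^ 2)
  refine le_trans ?_ h2
  rw [inv_le_iff_one_le_mul₀ (by linarith)]
  nlinarith [mul_nonneg (sq_nonneg x) (sub_nonneg.2 h1)]

theorem IsDiameterTwoWindow.tendsto_binomialMoment (hp : IsDiameterTwoWindow c p) (r : ℕ) :
    Tendsto (fun n : ℕ => badMoment (Fin n) (p n) r) atTop
      (𝓝 ((Real.exp (-c) / 2) ^ r / r.factorial)) := by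
  have hp2 : Tendsto (fun n => (p n : ℝ) ^ 2) atTop (𝓝 0) := by simpa using hp.tendsto_zero.pow 2
  have hp3 : Tendsto (fun n => (p n : ℝ) ^ 3) atTop (𝓝 0) := by simpa using hp.tendsto_zero.pow 3
  have hnp3 := hp.tendsto_mul_cube
  have hlimit : (Real.exp (-c) / 2) ^ r / r.factorial =
      (1 / 2) ^ r / r.factorial * Real.exp (-r * c) := by
    rw [show -(r : ℝ) * c = r * (-c) by ring, Real.exp_nat_mul, div_pow, div_pow, one_pow]
    ring
  -- The exponent is `(n - 2r) (-r p² + r² p³)` expanded with `n p² = 2 log n + c`; the part `-2 r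
  -- log n` cancels the growth of the number of `r`-sets.
  have hup : Tendsto (fun n : ℕ => (((n.choose 2).choose r : ℝ) * Real.exp (-2 * Real.log n) ^ r) *
      Real.exp (-r * c + 2 * r ^ 2 * (p n : ℝ) ^ 2 + r ^ 2 * (n * (p n : ℝ) ^ 3) -
        2 * r ^ 3 * (p n : ℝ) ^ 3)) atTop (𝓝 ((Real.exp (-c) / 2) ^ r / r.factorial)) := by
    rw [hlimit]
    refine (tendsto_choose_choose_mul r).mul ((Real.continuous_exp.tendsto _).comp ?_)
    have := (((hp2.const_mul (2 * (r : ℝ) ^ 2)).const_add (-(r : ℝ) * c)).add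
      (hnp3.const_mul ((r : ℝ) ^ 2))).sub (hp3.const_mul (2 * (r : ℝ) ^ 3))
    simpa using this
  have hlow : Tendsto (fun n : ℕ => (((n.choose 2).choose r : ℝ) * Real.exp (-2 * Real.log n) ^ r) *
      ((1 - (p n : ℝ)) ^ (2 * r) ^ 2 *
        Real.exp (-r * c - 2 * r ^ 2 * ((n * (p n : ℝ) ^ 3) * p n)))) atTop
      (𝓝 ((Real.exp (-c) / 2) ^ r / r.factorial)) := by
    rw [hlimit]
    refine (tendsto_choose_choose_mul r).mul ?_
    have h1 : Tendsto (fun n => (1 - (p n : ℝ)) ^ (2 * r) ^ 2) atTop (𝓝 1) := by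
      simpa using (hp.tendsto_zero.const_sub 1).pow ((2 * r) ^ 2)
    have h2 : Tendsto (fun n : ℕ => Real.exp (-r * c - 2 * r ^ 2 * ((n * (p n : ℝ) ^ 3) * p n)))
        atTop (𝓝 (Real.exp (-r * c))) := by
      refine (Real.continuous_exp.tendsto _).comp ?_
      have := ((hnp3.mul hp.tendsto_zero).const_mul (2 * (r : ℝ) ^ 2)).const_sub (-(r : ℝ) * c)
      simpa using this
    simpa using h1.mul h2
  have hr1 : ∀ᶠ n in atTop, (r : ℝ) * p n ≤ 1 := by
    have := hp.tendsto_zero.const_mul (r : ℝ)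
    rw [mul_zero] at this
    exact this.eventually_le_const one_pos
  have hr2 : ∀ᶠ n in atTop, (r : ℝ) * (p n : ℝ) ^ 2 ≤ 1 / 2 := by
    have := hp2.const_mul (r : ℝ)
    rw [mul_zero] at this
    exact this.eventually_le_const (by norm_num)
  refine tendsto_of_tendsto_of_tendsto_of_le_of_le' hlow hup ?_ ?_
  · filter_upwards [hr2, hp.eventually_mul_sq] with n h2 hsq
    have hp0 : (0 : ℝ) ≤ p n := (p n).2.1
    have hp1 : (p n : ℝ) ≤ 1 := (p n).2.2
    refine le_trans ?_ (le_badMoment (V := Fin n) hp0 hp1 (by linarith))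
    rw [Fintype.card_fin, mul_assoc]
    refine mul_le_mul_of_nonneg_left ?_ (Nat.cast_nonneg _)
    rw [mul_left_comm]
    refine mul_le_mul_of_nonneg_left ?_ (pow_nonneg (by linarith) _)
    have h3 := pow_le_pow_left₀ (Real.exp_pos _).le
      (exp_neg_add_two_mul_sq_le (x := r * (p n : ℝ) ^ 2) h2) n
    refine le_trans (le_of_eq ?_) h3
    rw [← Real.exp_nat_mul, ← Real.exp_nat_mul, ← Real.exp_add]
    congr 1
    linear_combination r * hsq
  · filter_upwards [hr1, hp.eventually_mul_sq, eventually_ge_atTop (2 * r)] with n h1 hsq hn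
    have hp0 : (0 : ℝ) ≤ p n := (p n).2.1
    have hp1 : (p n : ℝ) ≤ 1 := (p n).2.2
    refine (badMoment_le (V := Fin n) hp0 hp1 h1).trans (le_of_eq ?_)
    rw [Fintype.card_fin, mul_assoc]
    congr 1
    rw [← Real.exp_nat_mul, ← Real.exp_nat_mul, ← Real.exp_add, Nat.cast_sub hn]
    congr 1
    push_cast
    linear_combination -r * hsq

theorem IsDiameterTwoWindow.tendsto_badPairs_eq_empty (hp : IsDiameterTwoWindow c p) :
    Tendsto (fun n : ℕ => (binomialRandom (Fin n) (p n)).real {G | G.badPairs = ∅}) atTop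
      (𝓝 (Real.exp (-Real.exp (-c) / 2))) := by
  rw [neg_div]
  exact tendsto_of_bonferroni hp.tendsto_binomialMoment
    (fun k n => binomialRandom_badPairs_eq_empty_le (p n) k)
    fun k n => le_binomialRandom_badPairs_eq_empty (p n) k

end Limit

end SimpleGraph

/-! ### Typical graphs -/

namespace SimpleGraph
open Finset Filter Topology
open scoped Classical

section Complete
variable {V : Type*} [Fintype V]

theorem binomialRandom_top_le (p : unitInterval) {u v : V} (huv : u ≠ v) :
    (binomialRandom V p).real {G | G = ⊤} ≤ p := by
  have hsub : ({s(u, v)} : Finset (Sym2 V)) ⊆ nonDiag V := by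
    simpa [mem_nonDiag] using huv
  have h := bernExp_subset (p := (p : ℝ)) hsub
  rw [card_singleton, pow_one] at h
  rw [binomialRandom_real_eq_bernExp]
  refine (bernExp_mono p.2.1 p.2.2 fun S hS => ?_).trans h.le
  rw [Set.indicator_apply]
  split_ifs with h1 h2
  · exact le_rfl
  · refine absurd ?_ h2
    have : (fromEdgeSet (S : Set (Sym2 V))).Adj u v := by
      rw [Set.mem_ofPred_eq] at h1
      rw [h1]
      exact huv
    simpa using (adj_fromEdgeSet hS).1 this
  · norm_num
  · exact le_rfl

end Complete

section Typical
variable {V : Type*} [Fintype V] {G : SimpleGraph V}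

/-- The properties of a typical random graph that determine its rainbow connection number. -/
structure IsTypical (G : SimpleGraph V) (L Δ : ℕ) (K : ℝ) : Prop where
  patternFree : G.PatternFree L (200 * 56) 200
  degree_le : ∀ v, #{w | G.Adj v w} ≤ Δ
  card_badPairs_le : #G.badPairs ≤ K
  ne_top : G ≠ ⊤

variable {L Δ : ℕ} {K : ℝ}

theorem IsTypical.rainbowConnectionNumber (hG : G.IsTypical L Δ K)
    (hq : 4 * (1 / 2 : ℝ) ^ (L + 1 - 200 * 56) * ((4 * (L + 1 - 200 * 56) * Δ : ℕ) + 1) ≤ 1)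
    (hK : 2 + 3 * K * (1 + Δ) ≤ Fintype.card V) :
    (G.rainbowConnectionNumber = 2 ↔ G.badPairs = ∅) ∧
      (G.rainbowConnectionNumber = 3 ↔ ¬ G.badPairs = ∅) := by
  obtain ⟨χ, hχ⟩ := hG.patternFree.exists_two_colouring hG.degree_le hq
  have hdisj := hG.patternFree.badPairs_disjoint
  -- Otherwise `u` has fewer than `3K` neighbours, and the count of vertices within distance two
  -- contradicts `hK`.
  have hdeg : ∀ u, 3 * #G.badPairs ≤ #{w | G.Adj u w} := by
    intro u
    by_contra hlt
    rw [not_le] at hlt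
    have h1 := card_le_of_badPairs_disjoint hG.degree_le hdisj u
    have h2 : ((#{w | G.Adj u w} + 1 : ℕ) : ℝ) ≤ (3 * #G.badPairs : ℕ) := by exact_mod_cast hlt
    have h3 : (Fintype.card V : ℝ) ≤ 2 + #{w | G.Adj u w} * (1 + Δ) := by exact_mod_cast h1
    push_cast at h2
    have h4 := hG.card_badPairs_le
    have h5 : (0 : ℝ) ≤ Δ := Nat.cast_nonneg _
    have h6 : ((#{w | G.Adj u w} : ℝ) + 1) * (1 + Δ) ≤ 3 * K * (1 + Δ) :=
      mul_le_mul_of_nonneg_right (by linarith) (by linarith)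
    linarith
  have hle3 := rainbowConnectionNumber_le_three_of_colouring χ hχ hdisj hdeg
  have hge2 : 2 ≤ G.rainbowConnectionNumber := by
    have : ∃ u v, u ≠ v ∧ ¬ G.Adj u v := by
      by_contra hcon
      push Not at hcon
      refine hG.ne_top ?_
      ext u v
      exact ⟨fun h => h.ne, fun h => hcon u v h⟩
    obtain ⟨u, v, huv, hadj⟩ := this
    exact two_le_rainbowConnectionNumber huv hadj
  have htwo : G.rainbowConnectionNumber = 2 ↔ G.badPairs = ∅ := by
    constructor
    · intro h
      exact badPairs_eq_empty_of_rainbowConnectionNumber_le_two (by rw [h]; rfl)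
    · intro h
      exact le_antisymm (rainbowConnectionNumber_le_two_of_colouring χ hχ h) hge2
  refine ⟨htwo, ?_⟩
  rw [← htwo]
  constructor
  · intro h h'
    rw [h] at h'
    exact absurd h' (by decide)
  · intro h
    obtain ⟨k, hk⟩ := ENat.ne_top_iff_exists.1 (ne_top_of_le_ne_top (ENat.natCast_ne_top 3) hle3)
    rw [← hk] at h hge2 hle3 ⊢
    have h1 : 2 ≤ k := by exact_mod_cast hge2
    have h2 : k ≤ 3 := by exact_mod_cast hle3
    have h3 : k ≠ 2 := fun h' => h (by rw [h']; rfl)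
    have h4 : k = 3 := by omega
    rw [h4]
    rfl

theorem binomialRandom_not_isTypical_le (p : unitInterval) {u v : V} (huv : u ≠ v) (hK : 0 < K) :
    (binomialRandom V p).real {G | ¬ G.IsTypical L Δ K} ≤
      (binomialRandom V p).real {G | ¬ G.PatternFree L (200 * 56) 200} +
        Fintype.card V * (Real.exp (Fintype.card V * p) / 2 ^ Δ) + badMoment V p 1 / K + p := by
  have hsub : {G : SimpleGraph V | ¬ G.IsTypical L Δ K} ⊆
      {G : SimpleGraph V | ¬ G.PatternFree L (200 * 56) 200} ∪
      {G : SimpleGraph V | ∃ v, Δ < #{w | G.Adj v w}} ∪ {G : SimpleGraph V | K < #G.badPairs} ∪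
      {G : SimpleGraph V | G = ⊤} := by
    intro G hG
    by_contra hcon
    simp only [Set.mem_union, Set.mem_ofPred_eq, not_or, not_not, not_exists, not_lt] at hcon
    exact hG ⟨hcon.1.1.1, hcon.1.1.2, hcon.1.2, hcon.2⟩
  refine (MeasureTheory.measureReal_mono hsub (MeasureTheory.measure_ne_top _ _)).trans ?_
  refine (MeasureTheory.measureReal_union_le _ _).trans (add_le_add ?_ (binomialRandom_top_le p huv))
  refine (MeasureTheory.measureReal_union_le _ _).trans
    (add_le_add ?_ (binomialRandom_lt_card_badPairs_le p hK))
  exact (MeasureTheory.measureReal_union_le _ _).trans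
    (add_le_add le_rfl (binomialRandom_exists_degree_gt_le p Δ))

end Typical

/-! ### Choice of the bounds and conclusion -/

section Main
variable {c : ℝ} {p : ℕ → unitInterval}

/-- The maximal number of common neighbours of a light pair. -/
noncomputable def lightBound (n : ℕ) : ℕ := ⌊(3 / 4 : ℝ) * Real.log n⌋₊

/-- A typical upper bound for the degrees. -/
noncomputable def degreeBound (n : ℕ) : ℕ := ⌈4 * Real.exp (0.5001 * Real.log n)⌉₊

/-- A typical upper bound for the number of bad pairs. -/
noncomputable def badBound (n : ℕ) : ℝ := Real.exp (0.1 * Real.log n)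

theorem degreeBound_le {n : ℕ} : (degreeBound n : ℝ) ≤ 5 * Real.exp (0.5001 * Real.log n) := by
  have h1 := Nat.ceil_lt_add_one (show 0 ≤ 4 * Real.exp (0.5001 * Real.log n) by positivity)
  have h2 : 1 ≤ Real.exp (0.5001 * Real.log n) :=
    Real.one_le_exp (mul_nonneg (by norm_num) (Real.log_natCast_nonneg n))
  rw [degreeBound]
  linarith

theorem eventually_mul_log_le_exp {a : ℝ} (ha : 0 < a) (b : ℝ) :
    ∀ᶠ n : ℕ in atTop, b * Real.log n ≤ Real.exp (a * Real.log n) := by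
  have h1 := (Real.tendsto_pow_mul_exp_neg_atTop_nhds_zero 1).comp
    ((tendsto_id.const_mul_atTop ha).comp tendsto_log_natCast)
  have h2 := h1.const_mul (b / a)
  rw [mul_zero] at h2
  filter_upwards [h2.eventually_le_const one_pos] with n hn
  simp only [Function.comp, id, pow_one, Real.exp_neg] at hn
  have h3 := Real.exp_pos (a * Real.log n)
  have h4 : b / a * (a * Real.log n * (Real.exp (a * Real.log n))⁻¹) =
      b * Real.log n / Real.exp (a * Real.log n) := by
    field_simp
  rwa [h4, div_le_one h3] at hn

theorem eventually_bad_degree_le :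
    ∀ᶠ n : ℕ in atTop, 2 + 3 * badBound n * (1 + degreeBound n) ≤ n := by
  have h := (tendsto_exp_mul_log (a := -0.3) (by norm_num)).eventually_le_const
    (show (0 : ℝ) < 1 / 20 by norm_num)
  filter_upwards [h, eventually_gt_atTop 0] with n h1 h0
  have hn0 : (0 : ℝ) < n := Nat.cast_pos.2 h0
  have hx := Real.log_natCast_nonneg n
  set x := Real.log n with hxdef
  have hd := degreeBound_le (n := n)
  have e1 : 1 ≤ Real.exp (0.5001 * x) := Real.one_le_exp (by positivity)
  have e2 : 1 ≤ Real.exp (0.1 * x) := Real.one_le_exp (by positivity)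
  have e3 : Real.exp (0.1 * x) * Real.exp (0.5001 * x) ≤ Real.exp (0.7 * x) := by
    rw [← Real.exp_add, Real.exp_le_exp]
    linarith
  have e4 : Real.exp (0.7 * x) = n * Real.exp (-0.3 * x) := by
    rw [show 0.7 * x = x + -0.3 * x by ring, Real.exp_add, hxdef, Real.exp_log hn0]
  have e5 : Real.exp (0.7 * x) ≤ n * (1 / 20) := by rw [e4]; gcongr
  have e6 : 1 ≤ Real.exp (0.1 * x) * Real.exp (0.5001 * x) := one_le_mul_of_one_le_of_one_le e2 e1
  calc 2 + 3 * badBound n * (1 + degreeBound n)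
      ≤ 2 + 3 * Real.exp (0.1 * x) * (6 * Real.exp (0.5001 * x)) := by
        rw [badBound, ← hxdef]
        gcongr
        linarith
    _ = 2 + 18 * (Real.exp (0.1 * x) * Real.exp (0.5001 * x)) := by ring
    _ ≤ n := by linarith

/-- The powers of `n` add up to a negative exponent: `-(3/4) log 2 < -0.5195` from the failure
probability, `0.5001` from the degree bound, and `0.01` to absorb the logarithmic number of common
neighbours used. -/
theorem eventually_local_lemma_condition (M : ℕ) :
    ∀ᶠ n : ℕ in atTop, 4 * (1 / 2 : ℝ) ^ (lightBound n + 1 - M) *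
      ((4 * (lightBound n + 1 - M) * degreeBound n : ℕ) + 1) ≤ 1 := by
  have h := ((tendsto_exp_mul_log (a := -0.009) (by norm_num)).const_mul
    (4 * 2 ^ M * 21 : ℝ))
  rw [mul_zero] at h
  filter_upwards [h.eventually_le_const one_pos,
    eventually_mul_log_le_exp (a := 0.01) (by norm_num) 2,
    tendsto_log_natCast.eventually_ge_atTop 1] with n h1 h2 hx1
  have hd := degreeBound_le (n := n)
  rw [lightBound]
  set x := Real.log n with hxdef
  set L := ⌊(3 / 4 : ℝ) * x⌋₊ with hL
  have hL1 : (L : ℝ) ≤ 3 / 4 * x := Nat.floor_le (by linarith)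
  have hL2 : 3 / 4 * x < L + 1 := Nat.lt_floor_add_one _
  have hsub : ((L + 1 - M : ℕ) : ℝ) ≤ Real.exp (0.01 * x) := by
    have : ((L + 1 - M : ℕ) : ℝ) ≤ L + 1 := by exact_mod_cast Nat.sub_le _ _
    linarith
  have hpow : (1 / 2 : ℝ) ^ (L + 1 - M) ≤ 2 ^ M * Real.exp (-0.5195 * x) := by
    have e1 : (1 / 2 : ℝ) ^ (L + 1 - M) ≤ 2 ^ M * (1 / 2) ^ (L + 1) := by
      have e2 : (1 / 2 : ℝ) ^ (L + 1 - M + M) ≤ (1 / 2) ^ (L + 1) :=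
        pow_le_pow_of_le_one (by norm_num) (by norm_num) (by omega)
      have e4 : (1 / 2 : ℝ) ^ (L + 1 - M) = 2 ^ M * (1 / 2) ^ (L + 1 - M + M) := by
        rw [pow_add, mul_comm, mul_assoc, ← mul_pow]
        norm_num
      rw [e4]
      gcongr
    refine e1.trans ?_
    gcongr
    have hlog2 := Real.log_two_gt_d9
    rw [one_div, inv_pow, ← Real.exp_log (show (0 : ℝ) < 2 by norm_num), ← Real.exp_nat_mul,
      ← Real.exp_neg, Real.exp_le_exp]
    push_cast
    nlinarith
  have e1 : 1 ≤ Real.exp (0.01 * x) := Real.one_le_exp (by linarith)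
  have e2 : 1 ≤ Real.exp (0.5001 * x) := Real.one_le_exp (by linarith)
  have e3 : 1 ≤ Real.exp (0.01 * x) * Real.exp (0.5001 * x) := one_le_mul_of_one_le_of_one_le e1 e2
  calc _ ≤ 4 * (2 ^ M * Real.exp (-0.5195 * x)) *
        (4 * Real.exp (0.01 * x) * (5 * Real.exp (0.5001 * x)) + 1) := by
        push_cast
        gcongr
    _ ≤ 4 * (2 ^ M * Real.exp (-0.5195 * x)) *
        (21 * (Real.exp (0.01 * x) * Real.exp (0.5001 * x))) := by
        gcongr
        linarith
    _ = 4 * 2 ^ M * 21 * Real.exp (-0.5195 * x + 0.01 * x + 0.5001 * x) := by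
        rw [Real.exp_add, Real.exp_add]
        ring
    _ ≤ 4 * 2 ^ M * 21 * Real.exp (-0.009 * x) := by
        gcongr
        linarith
    _ ≤ 1 := h1

/-- Since `n p ≤ n ^ 0.5001` and `4 log 2 > 2`, the power `2 ^ degreeBound n` beats `exp (n p)` by a
factor `exp (n ^ 0.5001)`, which outweighs the union over vertices. -/
theorem IsDiameterTwoWindow.tendsto_degree (hp : IsDiameterTwoWindow c p) :
    Tendsto (fun n : ℕ => (n : ℝ) * (Real.exp (n * p n) / 2 ^ degreeBound n)) atTop (𝓝 0) := by
  refine squeeze_zero' (Eventually.of_forall fun n => by positivity) ?_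
    (tendsto_exp_mul_log (a := -1) (by norm_num))
  filter_upwards [hp.eventually_le_exp (a := 0.4999) (by norm_num), eventually_gt_atTop 0,
    eventually_mul_log_le_exp (a := 0.5001) (by norm_num) 2] with n h1 h0 h2
  have hn0 : (0 : ℝ) < n := Nat.cast_pos.2 h0
  have hy : n * (p n : ℝ) ≤ Real.exp (0.5001 * Real.log n) := by
    calc n * (p n : ℝ) ≤ Real.exp (Real.log n) * Real.exp (-0.4999 * Real.log n) := by
          rw [Real.exp_log hn0]
          gcongr
      _ = _ := by
          rw [← Real.exp_add]
          congr 1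
          ring
  have hpow : Real.exp (2 * Real.exp (0.5001 * Real.log n)) ≤ 2 ^ degreeBound n := by
    have hlog2 := Real.log_two_gt_d9
    have hceil : 4 * Real.exp (0.5001 * Real.log n) ≤ degreeBound n := Nat.le_ceil _
    have h3 := Real.exp_pos (0.5001 * Real.log n)
    have h2pow : (2 : ℝ) ^ degreeBound n = Real.exp (degreeBound n * Real.log 2) := by
      rw [Real.exp_nat_mul, Real.exp_log two_pos]
    rw [h2pow, Real.exp_le_exp]
    nlinarith
  calc (n : ℝ) * (Real.exp (n * p n) / 2 ^ degreeBound n)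
      ≤ Real.exp (Real.log n) * (Real.exp (Real.exp (0.5001 * Real.log n)) /
          Real.exp (2 * Real.exp (0.5001 * Real.log n))) := by
        rw [Real.exp_log hn0]
        gcongr
    _ = Real.exp (Real.log n - Real.exp (0.5001 * Real.log n)) := by
        rw [← Real.exp_sub, ← Real.exp_add]
        congr 1
        ring
    _ ≤ Real.exp (-1 * Real.log n) := by
        rw [Real.exp_le_exp]
        linarith

theorem IsDiameterTwoWindow.tendsto_not_isTypical (hp : IsDiameterTwoWindow c p) :
    Tendsto (fun n : ℕ => (binomialRandom (Fin n) (p n)).real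
      {G | ¬ G.IsTypical (lightBound n) (degreeBound n) (badBound n)}) atTop (𝓝 0) := by
  have hbad : Tendsto (fun n : ℕ => badMoment (Fin n) (p n) 1 / badBound n) atTop (𝓝 0) := by
    have h := (hp.tendsto_binomialMoment 1).mul (tendsto_exp_mul_log (a := -0.1) (by norm_num))
    rw [mul_zero] at h
    refine h.congr fun n => ?_
    rw [badBound, div_eq_mul_inv, ← Real.exp_neg]
    congr 2
    ring
  have ht := (((hp.tendsto_not_patternFree (200 * 56)).add hp.tendsto_degree).add hbad).add
    hp.tendsto_zero
  simp only [add_zero] at ht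
  refine squeeze_zero' (Eventually.of_forall fun n => MeasureTheory.measureReal_nonneg) ?_ ht
  filter_upwards [eventually_ge_atTop 2] with n hn
  have hne : (⟨0, by omega⟩ : Fin n) ≠ ⟨1, by omega⟩ := by simp
  have h := binomialRandom_not_isTypical_le (p n) (L := lightBound n) (Δ := degreeBound n)
    (K := badBound n) hne (Real.exp_pos _)
  rwa [Fintype.card_fin] at h

/-- Two sequences of events that agree outside a sequence of negligible events have the same
limiting probability. -/
theorem tendsto_real_of_agree {Ω : ℕ → Type*} [∀ n, MeasurableSpace (Ω n)]
    {μ : ∀ n, MeasureTheory.Measure (Ω n)} [∀ n, MeasureTheory.IsProbabilityMeasure (μ n)]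
    {A B N : ∀ n, Set (Ω n)} {l : ℝ} (hN : Tendsto (fun n => (μ n).real (N n)) atTop (𝓝 0))
    (hB : Tendsto (fun n => (μ n).real (B n)) atTop (𝓝 l))
    (h : ∀ᶠ n in atTop, ∀ ω, ω ∉ N n → (ω ∈ A n ↔ ω ∈ B n)) :
    Tendsto (fun n => (μ n).real (A n)) atTop (𝓝 l) := by
  have key : ∀ n (S T : Set (Ω n)), (∀ ω, ω ∉ N n → ω ∈ S → ω ∈ T) →
      (μ n).real S ≤ (μ n).real T + (μ n).real (N n) := fun n S T hST => by
    refine (MeasureTheory.measureReal_mono (s₂ := T ∪ N n) (fun ω hω => ?_)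
      (MeasureTheory.measure_ne_top _ _)).trans (MeasureTheory.measureReal_union_le _ _)
    by_cases hωN : ω ∈ N n
    · exact Or.inr hωN
    · exact Or.inl (hST ω hωN hω)
  have h1 := hB.sub hN
  have h2 := hB.add hN
  rw [sub_zero] at h1
  rw [add_zero] at h2
  refine tendsto_of_tendsto_of_tendsto_of_le_of_le' h1 h2 ?_ ?_
  · filter_upwards [h] with n hn
    linarith [key n (B n) (A n) fun ω hω => (hn ω hω).2]
  · filter_upwards [h] with n hn
    exact key n (A n) (B n) fun ω hω => (hn ω hω).1

theorem measurableSet_of_finite {V : Type*} [Finite V] (A : Set (SimpleGraph V)) :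
    MeasurableSet A := by
  have := Fintype.ofFinite V
  have h : A = edgeSet ⁻¹' (edgeSet '' A) := (Set.preimage_image_eq A edgeSet_injective).symm
  rw [h]
  exact measurable_edgeSet (Set.toFinite _).measurableSet

theorem IsDiameterTwoWindow.tendsto_rainbowConnectionNumber (hp : IsDiameterTwoWindow c p) :
    Tendsto (fun n : ℕ => (binomialRandom (Fin n) (p n)).real
        {G : SimpleGraph (Fin n) | G.rainbowConnectionNumber = 2}) atTop
        (𝓝 (Real.exp (-Real.exp (-c) / 2))) ∧
      Tendsto (fun n : ℕ => (binomialRandom (Fin n) (p n)).real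
        {G : SimpleGraph (Fin n) | G.rainbowConnectionNumber = 3}) atTop
        (𝓝 (1 - Real.exp (-Real.exp (-c) / 2))) := by
  have hagree : ∀ᶠ n : ℕ in atTop, ∀ G : SimpleGraph (Fin n),
      G.IsTypical (lightBound n) (degreeBound n) (badBound n) →
      (G.rainbowConnectionNumber = 2 ↔ G.badPairs = ∅) ∧
      (G.rainbowConnectionNumber = 3 ↔ ¬ G.badPairs = ∅) := by
    filter_upwards [eventually_local_lemma_condition (200 * 56), eventually_bad_degree_le]
      with n h1 h2 G hG
    exact hG.rainbowConnectionNumber h1 (by rwa [Fintype.card_fin])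
  have hB := hp.tendsto_badPairs_eq_empty
  have hB' : Tendsto (fun n : ℕ => (binomialRandom (Fin n) (p n)).real {G | ¬ G.badPairs = ∅})
      atTop (𝓝 (1 - Real.exp (-Real.exp (-c) / 2))) := by
    refine (hB.const_sub 1).congr fun n => ?_
    exact (MeasureTheory.probReal_compl_eq_one_sub (measurableSet_of_finite _)).symm
  constructor
  · refine tendsto_real_of_agree hp.tendsto_not_isTypical hB ?_
    filter_upwards [hagree] with n hn G hG
    exact (hn G (not_not.1 hG)).1
  · refine tendsto_real_of_agree hp.tendsto_not_isTypical hB' ?_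
    filter_upwards [hagree] with n hn G hG
    exact (hn G (not_not.1 hG)).2

end Main

end SimpleGraph

theorem mainTheorem5 (c : ℝ) (p : ℕ → unitInterval)
    (hp : ∀ᶠ n : ℕ in Filter.atTop,
      (p n : ℝ) = Real.sqrt ((2 * Real.log (n : ℝ) + c) / (n : ℝ))) :
    Filter.Tendsto
        (fun n : ℕ => (SimpleGraph.binomialRandom (Fin n) (p n)).real
          {G : SimpleGraph (Fin n) | G.rainbowConnectionNumber = 2})
        Filter.atTop (nhds (Real.exp (-Real.exp (-c) / 2))) ∧
      Filter.Tendsto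
        (fun n : ℕ => (SimpleGraph.binomialRandom (Fin n) (p n)).real
          {G : SimpleGraph (Fin n) | G.rainbowConnectionNumber = 3})
        Filter.atTop (nhds (1 - Real.exp (-Real.exp (-c) / 2))) :=
  SimpleGraph.IsDiameterTwoWindow.tendsto_rainbowConnectionNumber hp
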